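/- Let $d\ge1$, $\mathcal M(v)=(2\pi)^{-d/2}e^{-|v|^2/2}$ and $d\gamma=\mathcal M(v)^{-1}dv$ on $\mathbb R^d$. Let $\mathsf L$ be either the Fokker--Planck operator $\mathsf L_1f=\Delta_vf+\nabla_v\cdot(vf)$ or the linear BGK operator $\mathsf L_2f=\rho_f\,\mathcal M-f$ with $\rho_f=\int_{\mathbb R^d}f\,dv$. For $\xi\in\mathbb R^d\setminus\{0\}$ and complex-valued $F=F(v)$, put $\mathsf TF=i\,(v\cdot\xi)F$, $\Pi F=\mathcal M\int F\,dv$, $\mathsf AF=-\frac{i\,\xi}{1+|\xi|^2}\cdot\big(\int wF(w)\,dw\big)\mathcal M$, and, with the inner product and norm of $\mathrm L^2(d\gamma)$ and for $\delta>0$, $$\mathsf H_1[F]=\tfrac12\|F\|^2+\delta\,\mathrm{Re}\langle\mathsf AF,F\rangle,$$ $$\mathsf D[F]=-\langle\mathsf LF,F\rangle+\delta\langle\mathsf{AT}\Pi F,F\rangle-\delta\,\mathrm{Re}\langle\mathsf{TA}F,F\rangle+\delta\,\mathrm{Re}\langle\mathsf{AT}(\mathrm{Id}-\Pi)F,F\rangle-\delta\,\mathrm{Re}\langle\mathsf{AL}F,F\rangle.$$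 Let $\lambda(\xi)$ be the supremum of all $\lambda\in\mathbb R$ for which there is a $\delta>0$ such that $\mathsf D[F]\ge\lambda\,\mathsf H_1[F]$ for all smooth $F$ with $F,\mathsf LF,\mathsf TF\in\mathrm L^2(d\gamma)$, and let $$\lambda_\star:=\liminf_{L\to0_+}\ \inf_{\xi\in(2\pi/L)\mathbb Z^d\setminus\{0\}}\lambda(\xi).$$ Then $\lambda_\star\ge1-\sqrt{3/7}$ for $\mathsf L=\mathsf L_1$ and for $\mathsf L=\mathsf L_2$. Moreover, for any $\varepsilon>0$ there exists $L_\varepsilon>0$ such that, for every $0<L\le L_\varepsilon$, with $\mathcal X=[0,L)^d$ and for $\mathsf L=\mathsf L_1$ or $\mathsf L=\mathsf L_2$, every solution $f\in C([0,\infty);\mathrm L^2(\mathcal X\times\mathbb R^d,dx\,d\gamma))$ (in the sense of distributions, with periodic boundary conditions in $x$) of $$\partial_tf+v\cdot\nabla_xf=\mathsf Lf,\qquad f(0,\cdot,\cdot)=f_0\in\mathrm L^2(\mathcal X\times\mathbb R^d,dx\,d\gamma),$$ satisfies $$\|f(t,\cdot,\cdot)-\bar f\mathcal M\|^2_{\mathrm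 L^2(dx\,d\gamma)}\le(1+\varepsilon)\,\|f_0-\bar f\mathcal M\|^2_{\mathrm L^2(dx\,d\gamma)}\,e^{-\min\{2,\lambda_\star-\varepsilon\}\,t}\qquad\forall\,t\ge0,$$ where $\bar f=\frac1{L^d}\iint_{\mathcal X\times\mathbb R^d}f_0(x,v)\,dx\,dv$. -/

import Mathlib

open MeasureTheory Filter Topology
open scoped ContDiff ENNReal InnerProductSpace

noncomputable section

namespace Kinetic

/-- The space `ℝ^d` with its Euclidean norm; both positions and velocities live there. -/
abbrev Space (d : ℕ) : Type := EuclideanSpace ℝ (Fin d)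

/-- The normalized Gaussian `M(v) = (2π)^(-d/2) exp(-|v|²/2)`. -/
def maxwellian (d : ℕ) (v : Space d) : ℝ :=
  Real.exp (-(‖v‖ ^ 2 / 2)) / (2 * Real.pi) ^ ((d : ℝ) / 2)

/-- The measure `dγ = M(v)⁻¹ dv` on the velocity space. -/
def gammaMeasure (d : ℕ) : Measure (Space d) :=
  volume.withDensity fun v => ENNReal.ofReal (maxwellian d v)⁻¹

/-- The two collision operators. -/
inductive Collision
  | fokkerPlanck
  | bgk

/-- `L₁ F = Δ_v F + ∇_v · (v F)` and `L₂ F = ρ_F M - F` with `ρ_F = ∫ F dv`,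
acting on real or complex valued functions of the velocity. -/
def collisionOp {d : ℕ} {V : Type} [NormedAddCommGroup V] [NormedSpace ℝ V]
    (op : Collision) (F : Space d → V) (v : Space d) : V :=
  match op with
  | Collision.fokkerPlanck =>
      Laplacian.laplacian F v
        + ∑ i : Fin d, fderiv ℝ (fun w : Space d => w i • F w) v (EuclideanSpace.single i 1)
  | Collision.bgk => maxwellian d v • (∫ w, F w) - F v

section Modes

/-! ### A single Fourier mode `ξ`, in the complex Hilbert space `L²(dγ)` -/

variable {d : ℕ}

/-- The inner product `⟨F, G⟩ = ∫ F conj(G) dγ`. -/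
def ip (F G : Space d → ℂ) : ℂ :=
  ∫ v, F v * (starRingEnd ℂ) (G v) ∂(gammaMeasure d)

/-- The squared norm `‖F‖² = ∫ |F|² dγ`. -/
def sqNorm (F : Space d → ℂ) : ℝ := ∫ v, ‖F v‖ ^ 2 ∂(gammaMeasure d)

/-- The transport operator in Fourier variables, `(T F)(v) = i (v · ξ) F(v)`. -/
def transportMode (ξ : Space d) (F : Space d → ℂ) (v : Space d) : ℂ :=
  Complex.I * ((⟪v, ξ⟫_ℝ : ℝ) : ℂ) * F v

/-- The projection `Π F = M ∫ F dv`. -/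
def proj (F : Space d → ℂ) (v : Space d) : ℂ :=
  (maxwellian d v : ℂ) * ∫ w, F w

/-- The operator `(A F)(v) = - (i ξ / (1 + |ξ|²)) · (∫ w F(w) dw) M(v)`. -/
def opA (ξ : Space d) (F : Space d → ℂ) (v : Space d) : ℂ :=
  -(Complex.I / (1 + (‖ξ‖ : ℂ) ^ 2)) * (∫ w, ((⟪ξ, w⟫_ℝ : ℝ) : ℂ) * F w)
    * (maxwellian d v : ℂ)

/-- The twisted functional `H₁[F] = ½ ‖F‖² + δ Re⟨A F, F⟩`. -/
def entropyH (ξ : Space d) (δ : ℝ) (F : Space d → ℂ) : ℝ :=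
  sqNorm F / 2 + δ * (ip (opA ξ F) F).re

/-- The entropy production `D[F] = -⟨L F, F⟩ + δ ⟨A T Π F, F⟩ - δ Re⟨T A F, F⟩
+ δ Re⟨A T (Id - Π) F, F⟩ - δ Re⟨A L F, F⟩`. -/
def productionD (op : Collision) (ξ : Space d) (δ : ℝ) (F : Space d → ℂ) : ℝ :=
  -(ip (collisionOp op F) F).re
    + δ * (ip (opA ξ (transportMode ξ (proj F))) F).re
    - δ * (ip (transportMode ξ (opA ξ F)) F).re
    + δ * (ip (opA ξ (transportMode ξ (F - proj F))) F).re
    - δ * (ip (opA ξ (collisionOp op F)) F).re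

/-- The functions on which the two functionals are evaluated: smooth elements of `L²(dγ)` that
`L` and `T` map to `L²(dγ)`. They contain all smooth compactly supported functions. -/
structure Admissible (op : Collision) (ξ : Space d) (F : Space d → ℂ) : Prop where
  smooth : ContDiff ℝ ∞ F
  memLp : MemLp F 2 (gammaMeasure d)
  collision_memLp : MemLp (collisionOp op F) 2 (gammaMeasure d)
  transport_memLp : MemLp (transportMode ξ F) 2 (gammaMeasure d)

/-- The optimal constant `λ(ξ)` in `D[F] ≥ λ H₁[F]`, for the best possible choice of `δ > 0`. -/
def modalRate (op : Collision) (ξ : Space d) : ℝ :=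
  sSup {lam : ℝ | ∃ δ : ℝ, 0 < δ ∧
    ∀ F : Space d → ℂ, Admissible op ξ F → lam * entropyH ξ δ F ≤ productionD op ξ δ F}

/-- The frequency `(2π/L) j`, `j ∈ ℤ^d`. -/
def frequency (L : ℝ) (j : Fin d → ℤ) : Space d :=
  WithLp.toLp 2 fun i => 2 * Real.pi / L * (j i : ℝ)

end Modes

/-- `λ_⋆ = liminf_{L → 0+} inf {λ(ξ) : ξ ∈ (2π/L) ℤ^d, ξ ≠ 0}`. -/
def lambdaStar (d : ℕ) (op : Collision) : ℝ :=
  liminf (fun L : ℝ => ⨅ j : {j : Fin d → ℤ // j ≠ 0}, modalRate op (frequency L j.1)) (𝓝[>] 0)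

/-! ### The evolution equation on the torus of size `L` -/

/-- The cube `[0, L)^d`. -/
def cube (d : ℕ) (L : ℝ) : Set (Space d) := {x | ∀ i, x i ∈ Set.Ico 0 L}

/-- The measure `dx dγ` on `[0, L)^d × ℝ^d`. -/
def phaseMeasure (d : ℕ) (L : ℝ) : Measure (Space d × Space d) :=
  (volume.restrict (cube d L)).prod (gammaMeasure d)

/-- The space `L²([0, L)^d × ℝ^d, dx dγ)`. -/
abbrev PhaseL2 (d : ℕ) (L : ℝ) : Type := Lp ℝ 2 (phaseMeasure d L)

/-- Test functions: smooth, `L`-periodic in each coordinate of `x`, vanishing for large `|v|`. -/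
structure IsTestFunction (d : ℕ) (L : ℝ) (ψ : Space d × Space d → ℝ) : Prop where
  smooth : ContDiff ℝ ∞ ψ
  periodic : ∀ (x v : Space d) (i : Fin d), ψ (x + EuclideanSpace.single i L, v) = ψ (x, v)
  compact : ∃ R : ℝ, ∀ x v : Space d, R < ‖v‖ → ψ (x, v) = 0

/-- `v · ∇_x ψ + L ψ`, with `L` acting on the velocity only. Since `v · ∇_x` is antisymmetric and
`L` is symmetric in `L²(dx dγ)`, it is the formal adjoint in `L²(dx dγ)` of `-v · ∇_x + L`. -/
def adjointGenerator {d : ℕ} (op : Collision) (ψ : Space d × Space d → ℝ)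
    (p : Space d × Space d) : ℝ :=
  fderiv ℝ (fun y : Space d => ψ (y, p.2)) p.1 p.2
    + collisionOp op (fun w : Space d => ψ (p.1, w)) p.2

/-- `f ∈ C([0, ∞); L²(dx dγ))` solves `∂_t f + v · ∇_x f = L f`, `f(0) = f₀`, with periodic
boundary conditions on `[0, L)^d`, in the sense of distributions. -/
structure IsSolution {d : ℕ} {L : ℝ} (op : Collision) (f₀ : PhaseL2 d L)
    (f : ℝ → PhaseL2 d L) : Prop where
  continuousOn : ContinuousOn f (Set.Ici 0)
  initial : f 0 = f₀
  weak : ∀ ψ : Space d × Space d → ℝ, IsTestFunction d L ψ → ∀ t : ℝ, 0 ≤ t →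
    (∫ p, f t p * ψ p ∂(phaseMeasure d L)) - (∫ p, f₀ p * ψ p ∂(phaseMeasure d L))
      = ∫ s in (0 : ℝ)..t, ∫ p, f s p * adjointGenerator op ψ p ∂(phaseMeasure d L)

/-- The average `L^(-d) ∬ f₀ dx dv` over `[0, L)^d × ℝ^d`. -/
def average {d : ℕ} {L : ℝ} (f₀ : PhaseL2 d L) : ℝ :=
  (L ^ d)⁻¹ * ∫ p, f₀ p ∂((volume.restrict (cube d L)).prod (volume : Measure (Space d)))

/-- `‖g - c M‖²` in `L²(dx dγ)`. -/
def sqDistEquilibrium {d : ℕ} {L : ℝ} (g : PhaseL2 d L) (c : ℝ) : ℝ :=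
  ∫ p, |g p - c * maxwellian d p.2| ^ 2 ∂(phaseMeasure d L)

end Kinetic

end

open MeasureTheory Filter Topology
open scoped ContDiff ENNReal InnerProductSpace

noncomputable section

namespace Kinetic

/-! ### Normalized Hermite polynomials in one variable -/

/-! Everything is read off in Fourier modes in `x` and Hermite functions in `v`. Both collision
operators are diagonal there, with eigenvalue 0 on the Maxwellian, -1 in degree one and at most -1
on every nonzero index, and multiplication by `⟪v, ξ⟫` is the ladder operator coupling neighbouring
degrees. No other property of the two operators enters the decay estimates.

Lower bound on the rate. With `X = ‖(1 - Π)F‖` and `Y = ‖ΠF‖`, the spectral gap gives `X²`, the term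
`ATΠ` gives `δ Y²` up to the factor `|ξ|²/(1 + |ξ|²)`, and the remaining terms are controlled by
Cauchy-Schwarz; the second moments contribute the constant `√2` (`twistC_ge`). As `|ξ| → ∞` the
production is bounded below by `(1 - δ)X² - √2 δ XY + δ Y²` and `H₁` tends to `(X² + Y²)/2`.
Comparing them gives the rate `1 - √(1/3)` at `δ = 1/3`, and about 0.417 at the fixed value `δ =
0.3` used here. Since `1 - √(3/7) < 0.3455`, the margin absorbs all errors once `|ξ| ≥ 100`
(`rate_quadratic_form`, `rate_lower_bound`), which covers every nonzero frequency of a small torus.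

Decay of solutions. For a rate slightly below the supremum, `δ` is not at one's disposal, but
testing the inequality on degree-one functions bounds it, so the twist in `H₁` is at most a multiple
`dL` of `‖F‖²/2` (`exists_rate`). Thus passing from `H₁` to the norm costs only `(1 + dL)/(1 - dL) ≤
1 + ε`. The modes with `ξ = 0` are damped directly at rate 2, which explains the minimum in the
exponent.

The identity `dH₁/dt = -D` is only formal, because a weak solution need not lie in the domain of the
operators. Testing with truncated Hermite functions turns the weak formulation into an infinite
system of ordinary differential equations (`IsSolution.modeCoef_eq`). Truncation by total degree
produces a flux through the boundary degrees of size square root of the degree times the mass of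
nearby shells. Averaging over `M` truncations makes the flux `O(M^(-1/2))`, so Gronwall's lemma
survives the limit (`entropyC_le_of_production`). Parseval then sums the modes. -/

/-- The Hermite polynomials, normalized in `L²` of the standard Gaussian. -/
def hermiteN : ℕ → ℝ → ℝ
  | 0, _ => 1
  | 1, x => x
  | n + 2, x => (x * hermiteN (n + 1) x - √(n + 1) * hermiteN n x) / √(n + 2)

/-- The recursion solved for the product. At `n = 0` the truncated index `n - 1` is harmless because
its coefficient `√n` vanishes; the other lowering formulas rely on the same convention. -/
theorem mul_hermiteN (n : ℕ) (x : ℝ) :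
    x * hermiteN n x = √(n + 1) * hermiteN (n + 1) x + √n * hermiteN (n - 1) x := by
  cases n with
  | zero => simp [hermiteN]
  | succ n =>
    have h : √((n : ℝ) + 2) ≠ 0 := by positivity
    have e : ((n + 1 : ℕ) : ℝ) + 1 = n + 2 := by push_cast; ring
    rw [e]
    simp only [hermiteN, Nat.add_sub_cancel]
    push_cast
    field_simp
    ring

theorem hasDerivAt_hermiteN (n : ℕ) (x : ℝ) :
    HasDerivAt (hermiteN n) (√n * hermiteN (n - 1) x) x := by
  induction n using Nat.strong_induction_on with
  | _ n ih =>
    match n with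
    | 0 => simpa [hermiteN] using! hasDerivAt_const x (1 : ℝ)
    | 1 => simpa [hermiteN] using! hasDerivAt_id x
    | n + 2 =>
      have h1 := ih (n + 1) (by omega)
      have h0 := ih n (by omega)
      have hd := (((hasDerivAt_id x).mul h1).sub (h0.const_mul (√((n : ℝ) + 1)))).div_const
        (√((n : ℝ) + 2))
      have hs : √((n : ℝ) + 2) ≠ 0 := by positivity
      have hx := mul_hermiteN n x
      have e1 : √((n : ℝ) + 1) * √((n : ℝ) + 1) = n + 1 := Real.mul_self_sqrt (by positivity)
      have e2 : √((n : ℝ) + 2) * √((n : ℝ) + 2) = n + 2 := Real.mul_self_sqrt (by positivity)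
      refine HasDerivAt.congr_deriv hd (Eq.symm ?_)
      rw [eq_div_iff hs, show n + 2 - 1 = n + 1 from rfl]
      simp only [id, one_mul, Nat.add_sub_cancel]
      push_cast
      linear_combination (hermiteN (n + 1) x) * e2 - √((n : ℝ) + 1) * hx
        - (hermiteN (n + 1) x) * e1

theorem exists_polynomial_hermiteN (n : ℕ) : ∃ p : Polynomial ℝ, ∀ x, hermiteN n x = p.eval x := by
  induction n using Nat.strong_induction_on with
  | _ n ih =>
    match n with
    | 0 => exact ⟨1, by simp [hermiteN]⟩
    | 1 => exact ⟨Polynomial.X, by simp [hermiteN]⟩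
    | n + 2 =>
      obtain ⟨p, hp⟩ := ih (n + 1) (by omega)
      obtain ⟨q, hq⟩ := ih n (by omega)
      refine ⟨Polynomial.C (√((n : ℝ) + 2))⁻¹ * (Polynomial.X * p
        - Polynomial.C (√((n : ℝ) + 1)) * q), fun x => ?_⟩
      simp only [hermiteN, hp, hq, Polynomial.eval_mul, Polynomial.eval_C, Polynomial.eval_sub,
        Polynomial.eval_X]
      ring

theorem contDiff_hermiteN (n : ℕ) : ContDiff ℝ ∞ (hermiteN n) := by
  obtain ⟨p, hp⟩ := exists_polynomial_hermiteN n
  rw [show hermiteN n = fun x => p.eval x from funext hp]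
  simpa only [Polynomial.coe_aeval_eq_eval] using! p.contDiff_aeval (𝕜 := ℝ) ∞

/-- The density of the standard Gaussian on the line. -/
def gauss (x : ℝ) : ℝ := Real.exp (-(x ^ 2 / 2)) / √(2 * Real.pi)

theorem gauss_pos (x : ℝ) : 0 < gauss x := by unfold gauss; positivity

theorem hasDerivAt_gauss (x : ℝ) : HasDerivAt gauss (-x * gauss x) x := by
  have h : HasDerivAt (fun x : ℝ => -(x ^ 2 / 2)) (-x) x := by
    simpa using! ((hasDerivAt_pow 2 x).div_const 2).neg
  refine HasDerivAt.congr_deriv ((h.exp).div_const (√(2 * Real.pi))) (Eq.symm ?_)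
  simp only [gauss]; ring

theorem contDiff_gauss : ContDiff ℝ ∞ gauss := by unfold gauss; fun_prop

theorem integrable_polynomial_mul_gauss (p : Polynomial ℝ) :
    Integrable fun x => p.eval x * gauss x := by
  induction p using Polynomial.induction_on' with
  | add p q hp hq => simpa [add_mul] using! hp.add hq
  | monomial n a =>
    have h := integrable_rpow_mul_exp_neg_mul_sq (b := 1 / 2) (by norm_num) (s := n)
      (by have : (0 : ℝ) ≤ n := n.cast_nonneg
          linarith)
    refine (h.const_mul (a / √(2 * Real.pi))).congr (ae_of_all _ fun x => ?_)
    simp only [Polynomial.eval_monomial, gauss, Real.rpow_natCast]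
    rw [show -(1 / 2) * x ^ 2 = -(x ^ 2 / 2) by ring]
    ring

theorem integrable_hermiteN_mul (m n : ℕ) :
    Integrable fun x => hermiteN m x * hermiteN n x * gauss x := by
  obtain ⟨p, hp⟩ := exists_polynomial_hermiteN m
  obtain ⟨q, hq⟩ := exists_polynomial_hermiteN n
  simpa [hp, hq] using! integrable_polynomial_mul_gauss (p * q)

/-- The Hermite functions `hₙ w`, with `w` the Gaussian density. -/
def hermiteG (n : ℕ) (x : ℝ) : ℝ := hermiteN n x * gauss x

theorem contDiff_hermiteG (n : ℕ) : ContDiff ℝ ∞ (hermiteG n) :=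
  (contDiff_hermiteN n).mul contDiff_gauss

theorem mul_hermiteG (n : ℕ) (x : ℝ) :
    x * hermiteG n x = √(n + 1) * hermiteG (n + 1) x + √n * hermiteG (n - 1) x := by
  unfold hermiteG
  linear_combination gauss x * mul_hermiteN n x

theorem hasDerivAt_hermiteG (n : ℕ) (x : ℝ) :
    HasDerivAt (hermiteG n) (-√(n + 1) * hermiteG (n + 1) x) x := by
  refine HasDerivAt.congr_deriv ((hasDerivAt_hermiteN n x).mul (hasDerivAt_gauss x)) ?_
  have := mul_hermiteN n x
  simp only [hermiteG]
  linear_combination -gauss x * this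

/-- Integration by parts: raising is adjoint to lowering for the Gaussian weight, so both degrees
drop together. This is the induction step for orthonormality. -/
theorem integral_hermiteN_succ_mul (m n : ℕ) :
    √(m + 1) * ∫ x, hermiteN (m + 1) x * hermiteN n x * gauss x
      = √n * ∫ x, hermiteN m x * hermiteN (n - 1) x * gauss x := by
  have h := integral_mul_deriv_eq_deriv_mul_of_integrable (u := hermiteN n) (v := hermiteG m)
    (fun x _ => hasDerivAt_hermiteN n x) (fun x _ => hasDerivAt_hermiteG m x)
    (((integrable_hermiteN_mul (m + 1) n).const_mul (-√(m + 1))).congr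
      (ae_of_all _ fun x => by simp only [Pi.mul_apply, hermiteG]; ring))
    (((integrable_hermiteN_mul m (n - 1)).const_mul (√n)).congr
      (ae_of_all _ fun x => by simp only [Pi.mul_apply, hermiteG]; ring))
    ((integrable_hermiteN_mul m n).congr
      (ae_of_all _ fun x => by simp only [Pi.mul_apply, hermiteG]; ring))
  rw [← integral_const_mul, ← integral_const_mul, ← neg_inj, ← integral_neg]
  convert h using 1
  · exact integral_congr_ae (ae_of_all _ fun x => by simp only [hermiteG]; ring)
  · exact congrArg Neg.neg (integral_congr_ae (ae_of_all _ fun x => by simp only [hermiteG]; ring))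

theorem integral_gauss : ∫ x, gauss x = 1 := by
  have h := integral_gaussian (1 / 2)
  have e : ∀ x : ℝ, gauss x = Real.exp (-(1 / 2) * x ^ 2) / √(2 * Real.pi) := fun x => by
    unfold gauss; congr 2; ring
  simp_rw [e]
  rw [integral_div, h, show Real.pi / (1 / 2) = 2 * Real.pi by ring]
  exact div_self (by positivity)

theorem integral_hermiteN_mul (m n : ℕ) :
    ∫ x, hermiteN m x * hermiteN n x * gauss x = if m = n then 1 else 0 := by
  have key : ∀ m, ∫ x, hermiteN (m + 1) x * hermiteN 0 x * gauss x = 0 := fun m => by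
    have h := integral_hermiteN_succ_mul m 0
    have hs : √((m : ℝ) + 1) ≠ 0 := by positivity
    simpa [hs] using h
  induction m generalizing n with
  | zero =>
    cases n with
    | zero => simp [hermiteN, integral_gauss]
    | succ n =>
      rw [if_neg (by omega), ← key n]
      congr 1; ext x; ring
  | succ m ih =>
    cases n with
    | zero => simpa using key m
    | succ n =>
      have h := integral_hermiteN_succ_mul m (n + 1)
      have hs : √((m : ℝ) + 1) ≠ 0 := by positivity
      rw [Nat.add_sub_cancel, ih n] at h
      by_cases hmn : m = n
      · subst hmn
        simp only [if_true, mul_one] at h ⊢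
        push_cast at h
        exact mul_left_cancel₀ hs (h.trans (mul_one _).symm)
      · simpa [hmn, hs] using h


/-! ### Hermite functions in several variables -/

section HermiteFunctions

variable {d : ℕ}

/-- Tensor product of normalized Hermite polynomials. -/
def hermP (α : Fin d → ℕ) (v : Space d) : ℝ := ∏ i, hermiteN (α i) (v i)

/-- Tensor product of Hermite functions, `hermP α` times the Maxwellian. -/
def hermF (α : Fin d → ℕ) (v : Space d) : ℝ := ∏ i, hermiteG (α i) (v i)

theorem maxwellian_eq_prod (v : Space d) : maxwellian d v = ∏ i, gauss (v i) := by
  unfold maxwellian gauss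
  rw [Finset.prod_div_distrib, ← Real.exp_sum, Finset.prod_const, Finset.card_univ,
    Fintype.card_fin, EuclideanSpace.norm_sq_eq, Finset.sum_neg_distrib, ← Finset.sum_div]
  congr 1
  · simp
  · rw [Real.sqrt_eq_rpow, ← Real.rpow_natCast, ← Real.rpow_mul (by positivity)]
    congr 1; ring

theorem maxwellian_pos (v : Space d) : 0 < maxwellian d v := by
  rw [maxwellian_eq_prod]; exact Finset.prod_pos fun i _ => gauss_pos _

theorem hermF_eq (α : Fin d → ℕ) (v : Space d) : hermF α v = hermP α v * maxwellian d v := by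
  rw [maxwellian_eq_prod, hermP, ← Finset.prod_mul_distrib]; rfl

theorem hermP_eq (α : Fin d → ℕ) (v : Space d) : hermP α v = (maxwellian d v)⁻¹ * hermF α v := by
  rw [hermF_eq]; field_simp [(maxwellian_pos v).ne']

theorem hermP_zero (v : Space d) : hermP (0 : Fin d → ℕ) v = 1 := by simp [hermP, hermiteN]

theorem hermF_zero (v : Space d) : hermF (0 : Fin d → ℕ) v = maxwellian d v := by
  simp [hermF_eq, hermP_zero]

theorem contDiff_maxwellian : ContDiff ℝ ∞ (maxwellian d) := by
  have : maxwellian d = fun v => ∏ i, gauss (v i) := funext maxwellian_eq_prod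
  rw [this]
  exact contDiff_prod fun i _ => contDiff_gauss.comp
    (EuclideanSpace.proj (𝕜 := ℝ) i : Space d →L[ℝ] ℝ).contDiff

theorem contDiff_hermF (α : Fin d → ℕ) : ContDiff ℝ ∞ (hermF α) :=
  contDiff_prod fun i _ => (contDiff_hermiteG _).comp
    (EuclideanSpace.proj (𝕜 := ℝ) i : Space d →L[ℝ] ℝ).contDiff

theorem contDiff_hermP (α : Fin d → ℕ) : ContDiff ℝ ∞ (hermP α) :=
  contDiff_prod fun i _ => (contDiff_hermiteN _).comp
    (EuclideanSpace.proj (𝕜 := ℝ) i : Space d →L[ℝ] ℝ).contDiff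

theorem continuous_hermF (α : Fin d → ℕ) : Continuous (hermF α) := (contDiff_hermF α).continuous

theorem continuous_hermP (α : Fin d → ℕ) : Continuous (hermP α) := (contDiff_hermP α).continuous

theorem continuous_maxwellian : Continuous (maxwellian d) := contDiff_maxwellian.continuous

theorem hermF_split (α β : Fin d → ℕ) (i : Fin d) (h : ∀ k, k ≠ i → β k = α k) (v : Space d) :
    hermF β v = hermiteG (β i) (v i) * ∏ k ∈ Finset.univ.erase i, hermiteG (α k) (v k) := by
  rw [hermF, ← Finset.mul_prod_erase _ _ (Finset.mem_univ i)]
  congr 1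
  exact Finset.prod_congr rfl fun k hk => by rw [h k (Finset.ne_of_mem_erase hk)]

/-- Raise the `i`-th index by one. -/
def up (α : Fin d → ℕ) (i : Fin d) : Fin d → ℕ := α + Pi.single i 1

/-- Lower the `i`-th index by one. -/
def down (α : Fin d → ℕ) (i : Fin d) : Fin d → ℕ := α - Pi.single i 1

theorem up_self (α : Fin d → ℕ) (i : Fin d) : up α i i = α i + 1 := by simp [up]

theorem down_self (α : Fin d → ℕ) (i : Fin d) : down α i i = α i - 1 := by simp [down]

theorem up_ne (α : Fin d → ℕ) {i k : Fin d} (h : k ≠ i) : up α i k = α k := by simp [up, h]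

theorem down_ne (α : Fin d → ℕ) {i k : Fin d} (h : k ≠ i) : down α i k = α k := by simp [down, h]

theorem up_down (α : Fin d → ℕ) (i : Fin d) (h : α i ≠ 0) : up (down α i) i = α := by
  ext k
  by_cases hk : k = i
  · subst hk; rw [up_self, down_self]; omega
  · rw [up_ne _ hk, down_ne _ hk]

theorem up_injective (i : Fin d) : Function.Injective fun α : Fin d → ℕ => up α i :=
  fun _ _ h => add_right_cancel h

theorem mul_hermF (α : Fin d → ℕ) (i : Fin d) (v : Space d) :
    v i * hermF α v = √(α i + 1) * hermF (up α i) v + √(α i) * hermF (down α i) v := by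
  rw [hermF_split α α i (fun _ _ => rfl), hermF_split α (up α i) i fun k hk => up_ne α hk,
    hermF_split α (down α i) i fun k hk => down_ne α hk, up_self, down_self]
  linear_combination (∏ k ∈ Finset.univ.erase i, hermiteG (α k) (v k)) * mul_hermiteG (α i) (v i)

theorem mul_hermP (α : Fin d → ℕ) (i : Fin d) (v : Space d) :
    v i * hermP α v = √(α i + 1) * hermP (up α i) v + √(α i) * hermP (down α i) v := by
  simp only [hermP_eq]
  linear_combination (maxwellian d v)⁻¹ * mul_hermF α i v

theorem fderiv_hermF (α : Fin d → ℕ) (i : Fin d) (v : Space d) :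
    fderiv ℝ (hermF α) v (EuclideanSpace.single i 1) = -√(α i + 1) * hermF (up α i) v := by
  have hd : DifferentiableAt ℝ (hermF α) v := (contDiff_hermF α).differentiable (by simp) v
  rw [← hd.lineDeriv_eq_fderiv]
  refine HasDerivAt.deriv ?_
  have e : (fun t : ℝ => hermF α (v + t • EuclideanSpace.single i 1))
      = fun t => hermiteG (α i) (v i + t) * ∏ k ∈ Finset.univ.erase i, hermiteG (α k) (v k) := by
    ext t
    rw [hermF_split α α i (fun _ _ => rfl)]
    congr 1
    · simp
    · refine Finset.prod_congr rfl fun k hk => ?_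
      simp [Finset.ne_of_mem_erase hk]
  rw [e, hermF_split α (up α i) i fun k hk => up_ne α hk, up_self]
  have h := hasDerivAt_hermiteG (α i) (v i + 0)
  have h2 := (h.comp_const_add (v i) 0).mul_const
    (∏ k ∈ Finset.univ.erase i, hermiteG (α k) (v k))
  refine h2.congr_deriv ?_
  simp only [add_zero]; ring

/-! ### Growth and integrability -/

/-- Letting the exponent grow with `n` allows each factor `x` of the recursion to be absorbed by
`|x| ≤ exp |x|`. The crude bound suffices, since it is only used against a Gaussian. -/
theorem exists_abs_hermiteN_le (n : ℕ) : ∃ C, 0 ≤ C ∧ ∀ x, |hermiteN n x| ≤ C * Real.exp (n * |x|) := by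
  induction n using Nat.strong_induction_on with
  | _ n ih =>
    have hx : ∀ x : ℝ, |x| ≤ Real.exp |x| := fun x =>
      (by linarith : |x| ≤ |x| + 1).trans (Real.add_one_le_exp _)
    match n with
    | 0 => exact ⟨1, zero_le_one, by simp [hermiteN]⟩
    | 1 => exact ⟨1, zero_le_one, fun x => by simpa [hermiteN] using hx x⟩
    | n + 2 =>
      obtain ⟨A, hA, hA'⟩ := ih (n + 1) (by omega)
      obtain ⟨B, hB, hB'⟩ := ih n (by omega)
      refine ⟨(A + √((n : ℝ) + 1) * B) / √((n : ℝ) + 2), by positivity, fun x => ?_⟩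
      have e : Real.exp (((n + 2 : ℕ) : ℝ) * |x|) = Real.exp |x| * Real.exp (((n + 1 : ℕ) : ℝ) * |x|) := by
        rw [← Real.exp_add]; push_cast; ring_nf
      have h1 : Real.exp ((n : ℝ) * |x|) ≤ Real.exp (((n + 2 : ℕ) : ℝ) * |x|) := by
        apply Real.exp_le_exp.2; push_cast; nlinarith [abs_nonneg x]
      have h2 : |x * hermiteN (n + 1) x| ≤ A * Real.exp (((n + 2 : ℕ) : ℝ) * |x|) := by
        rw [abs_mul, e]
        calc _ ≤ Real.exp |x| * (A * Real.exp (((n + 1 : ℕ) : ℝ) * |x|)) :=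
              mul_le_mul (hx x) (hA' x) (abs_nonneg _) (Real.exp_pos _).le
          _ = _ := by ring
      have h3 : |√((n : ℝ) + 1) * hermiteN n x| ≤
          √((n : ℝ) + 1) * B * Real.exp (((n + 2 : ℕ) : ℝ) * |x|) := by
        rw [abs_mul, abs_of_nonneg (Real.sqrt_nonneg _), mul_assoc]
        exact mul_le_mul_of_nonneg_left ((hB' x).trans (mul_le_mul_of_nonneg_left h1 hB))
          (Real.sqrt_nonneg _)
      simp only [hermiteN]
      rw [abs_div, abs_of_nonneg (Real.sqrt_nonneg ((n : ℝ) + 2)), div_mul_eq_mul_div, add_mul]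
      exact div_le_div_of_nonneg_right ((abs_sub _ _).trans (add_le_add h2 h3)) (Real.sqrt_nonneg _)

theorem abs_apply_le_norm (v : Space d) (i : Fin d) : |v i| ≤ ‖v‖ := by
  simpa using PiLp.norm_apply_le v i

theorem exists_abs_hermP_le (α : Fin d → ℕ) :
    ∃ C c : ℝ, 0 ≤ C ∧ ∀ v, |hermP α v| ≤ C * Real.exp (c * ‖v‖) := by
  choose C hC hC' using fun n => exists_abs_hermiteN_le n
  refine ⟨∏ i, C (α i), ∑ i, α i, Finset.prod_nonneg fun i _ => hC _, fun v => ?_⟩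
  rw [hermP, Finset.abs_prod, Finset.sum_mul, Real.exp_sum, ← Finset.prod_mul_distrib]
  refine Finset.prod_le_prod (fun i _ => abs_nonneg _) fun i _ => (hC' _ _).trans ?_
  refine mul_le_mul_of_nonneg_left (Real.exp_le_exp.2 ?_) (hC _)
  exact mul_le_mul_of_nonneg_left (abs_apply_le_norm v i) (Nat.cast_nonneg _)

theorem integrable_exp_neg_mul_sq {b : ℝ} (hb : 0 < b) :
    Integrable fun v : Space d => Real.exp (-b * ‖v‖ ^ 2) := by
  refine Integrable.of_integral_ne_zero ?_
  rw [GaussianFourier.integral_rexp_neg_mul_sq_norm hb]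
  positivity

theorem integrable_exp_mul_maxwellian (c : ℝ) :
    Integrable fun v : Space d => Real.exp (c * ‖v‖) * maxwellian d v := by
  refine ((integrable_exp_neg_mul_sq (d := d) (b := 1 / 4) (by norm_num)).const_mul
    (Real.exp (c ^ 2) / (2 * Real.pi) ^ ((d : ℝ) / 2))).mono'
    (by have := continuous_maxwellian (d := d); fun_prop) (ae_of_all _ fun v => ?_)
  rw [Real.norm_of_nonneg (mul_nonneg (Real.exp_pos _).le (maxwellian_pos v).le), maxwellian,
    mul_div_assoc', div_mul_eq_mul_div, ← Real.exp_add, ← Real.exp_add]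
  refine div_le_div_of_nonneg_right (Real.exp_le_exp.2 ?_) (by positivity)
  -- The square gives `c‖v‖ ≤ c² + ‖v‖²/4`, which leaves half of the Gaussian exponent.
  nlinarith [sq_nonneg (c - ‖v‖ / 2)]

theorem measurable_maxwellian_inv :
    Measurable fun v : Space d => ENNReal.ofReal (maxwellian d v)⁻¹ :=
  (continuous_maxwellian.measurable.inv).ennreal_ofReal

instance : SigmaFinite (gammaMeasure d) :=
  SigmaFinite.withDensity_of_ne_top (ae_of_all _ fun _ => ENNReal.ofReal_ne_top)

theorem integral_gamma {V : Type*} [NormedAddCommGroup V] [NormedSpace ℝ V] (F : Space d → V) :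
    ∫ v, F v ∂(gammaMeasure d) = ∫ v, (maxwellian d v)⁻¹ • F v := by
  rw [gammaMeasure, integral_withDensity_eq_integral_toReal_smul measurable_maxwellian_inv
    (ae_of_all _ fun _ => ENNReal.ofReal_lt_top)]
  simp_rw [ENNReal.toReal_ofReal (inv_pos.2 (maxwellian_pos _)).le]

theorem integrable_gamma {V : Type*} [NormedAddCommGroup V] [NormedSpace ℝ V] {F : Space d → V} :
    Integrable F (gammaMeasure d) ↔ Integrable fun v => (maxwellian d v)⁻¹ • F v := by
  rw [gammaMeasure, integrable_withDensity_iff_integrable_smul' measurable_maxwellian_inv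
    (ae_of_all _ fun _ => ENNReal.ofReal_lt_top)]
  simp_rw [ENNReal.toReal_ofReal (inv_pos.2 (maxwellian_pos _)).le]

theorem gamma_absolutelyContinuous : gammaMeasure d ≪ volume := withDensity_absolutelyContinuous _ _

theorem absolutelyContinuous_gamma : (volume : Measure (Space d)) ≪ gammaMeasure d :=
  withDensity_absolutelyContinuous' measurable_maxwellian_inv.aemeasurable
    (ae_of_all _ fun v => by simpa using maxwellian_pos v)

theorem memLp_exp_mul_maxwellian (c : ℝ) :
    MemLp (fun v : Space d => Real.exp (c * ‖v‖) * maxwellian d v) 2 (gammaMeasure d) := by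
  have hm := continuous_maxwellian (d := d)
  rw [memLp_two_iff_integrable_sq (by fun_prop), integrable_gamma]
  refine (integrable_exp_mul_maxwellian (d := d) (2 * c)).congr (ae_of_all _ fun v => ?_)
  have h := (maxwellian_pos v).ne'
  simp only [smul_eq_mul]
  field_simp
  rw [← Real.exp_nat_mul]
  congr 1; push_cast; ring

theorem memLp_hermF (α : Fin d → ℕ) : MemLp (hermF α) 2 (gammaMeasure d) := by
  obtain ⟨C, c, hC, h⟩ := exists_abs_hermP_le α
  refine ((memLp_exp_mul_maxwellian (d := d) c).const_mul C).mono
    (continuous_hermF α).aestronglyMeasurable (ae_of_all _ fun v => ?_)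
  rw [Real.norm_eq_abs, Real.norm_eq_abs, hermF_eq, abs_mul, ← mul_assoc, abs_mul _ (maxwellian d v)]
  exact mul_le_mul_of_nonneg_right ((h v).trans (le_abs_self _)) (abs_nonneg _)

theorem memLp_hermF_complex (α : Fin d → ℕ) :
    MemLp (fun v => (hermF α v : ℂ)) 2 (gammaMeasure d) := (memLp_hermF α).ofReal

/-- Square integrability against the inverse Gaussian controls every exponential moment. -/
theorem MemLp.integrable_exp_smul {F : Space d → ℂ} (hF : MemLp F 2 (gammaMeasure d)) (c : ℝ) :
    Integrable fun v => Real.exp (c * ‖v‖) • F v := by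
  have hE : MemLp (fun v : Space d => ((Real.exp (c * ‖v‖) * maxwellian d v : ℝ) : ℂ)) 2
    (gammaMeasure d) := (memLp_exp_mul_maxwellian (d := d) c).ofReal
  have h := MemLp.integrable_mul hE hF
  rw [integrable_gamma] at h
  refine h.congr (ae_of_all _ fun v => ?_)
  have h := (maxwellian_pos v).ne'
  simp only [Pi.mul_apply, Complex.real_smul]
  rw [Complex.ofReal_mul, Complex.ofReal_inv]
  have h' : (maxwellian d v : ℂ) ≠ 0 := by exact_mod_cast h
  field_simp

/-- Hermite coefficients. -/
def coef (α : Fin d → ℕ) (F : Space d → ℂ) : ℂ := ∫ v, (hermP α v : ℂ) * F v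

theorem integrable_hermP_mul (α : Fin d → ℕ) {F : Space d → ℂ}
    (hF : ∀ c : ℝ, Integrable fun v => Real.exp (c * ‖v‖) • F v) :
    Integrable fun v => (hermP α v : ℂ) * F v := by
  obtain ⟨C, c, hC, h⟩ := exists_abs_hermP_le α
  have hm : AEStronglyMeasurable F volume := by simpa using (hF 0).aestronglyMeasurable
  refine ((hF c).norm.const_mul C).mono' ((by have := continuous_hermP α; fun_prop :
    Continuous fun v => (hermP α v : ℂ)).aestronglyMeasurable.mul hm) (ae_of_all _ fun v => ?_)
  rw [norm_mul, norm_smul, Complex.norm_real, Real.norm_eq_abs, Real.norm_eq_abs, Real.abs_exp,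
    ← mul_assoc]
  exact mul_le_mul_of_nonneg_right (h v) (norm_nonneg _)

/-- Having all exponential moments is stable under multiplication by linear functions, which
`L²(dγ)` is not. For this reason the coefficient identities assume exponential moments. -/
theorem integrable_exp_smul_apply_mul {F : Space d → ℂ}
    (hF : ∀ c : ℝ, Integrable fun v => Real.exp (c * ‖v‖) • F v) (k : Space d) (c : ℝ) :
    Integrable fun v => Real.exp (c * ‖v‖) • (((⟪v, k⟫_ℝ : ℝ) : ℂ) * F v) := by
  have hm : AEStronglyMeasurable F volume := by simpa using (hF 0).aestronglyMeasurable
  refine ((hF (c + 1)).norm.const_mul ‖k‖).mono' ?_ (ae_of_all _ fun v => ?_)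
  · exact (by fun_prop : Continuous fun v : Space d => Real.exp (c * ‖v‖)).aestronglyMeasurable.smul
      ((by fun_prop : Continuous fun v : Space d =>
        ((⟪v, k⟫_ℝ : ℝ) : ℂ)).aestronglyMeasurable.mul hm)
  · rw [norm_smul, norm_smul, norm_mul, Complex.norm_real, Real.norm_eq_abs,
      Real.norm_eq_abs, Real.norm_eq_abs, Real.abs_exp, Real.abs_exp, add_mul, Real.exp_add, one_mul]
    have h1 : ‖v‖ ≤ Real.exp ‖v‖ := (by linarith : ‖v‖ ≤ ‖v‖ + 1).trans (Real.add_one_le_exp _)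
    calc _ ≤ Real.exp (c * ‖v‖) * (‖v‖ * ‖k‖ * ‖F v‖) := by
          gcongr; exact abs_real_inner_le_norm v k
      _ ≤ Real.exp (c * ‖v‖) * (Real.exp ‖v‖ * ‖k‖ * ‖F v‖) := by gcongr
      _ = _ := by ring

/-- Multiplication by `⟨v, ξ⟩` acting on Hermite coefficients. -/
def ladder (ξ : Space d) (c : (Fin d → ℕ) → ℂ) (α : Fin d → ℕ) : ℂ :=
  ∑ i, (ξ i : ℂ) * ((√(α i + 1) : ℝ) * c (up α i) + (√(α i) : ℝ) * c (down α i))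

theorem inner_mul_hermP (ξ v : Space d) (α : Fin d → ℕ) : ⟪v, ξ⟫_ℝ * hermP α v
    = ∑ i, ξ i * (√(α i + 1) * hermP (up α i) v + √(α i) * hermP (down α i) v) := by
  rw [PiLp.inner_apply, Finset.sum_mul]
  refine Finset.sum_congr rfl fun i _ => ?_
  rw [← mul_hermP]; simp; ring

theorem inner_mul_hermF (ξ v : Space d) (α : Fin d → ℕ) : ⟪v, ξ⟫_ℝ * hermF α v
    = ∑ i, ξ i * (√(α i + 1) * hermF (up α i) v + √(α i) * hermF (down α i) v) := by
  rw [PiLp.inner_apply, Finset.sum_mul]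
  refine Finset.sum_congr rfl fun i _ => ?_
  rw [← mul_hermF]; simp; ring

/-- The multiplication is moved onto the polynomial, where the three-term recursion applies. -/
theorem coef_inner_mul {F : Space d → ℂ}
    (hF : ∀ c : ℝ, Integrable fun v => Real.exp (c * ‖v‖) • F v) (ξ : Space d) (α : Fin d → ℕ) :
    coef α (fun v => ((⟪v, ξ⟫_ℝ : ℝ) : ℂ) * F v) = ladder ξ (fun β => coef β F) α := by
  have e : ∀ v, (hermP α v : ℂ) * (((⟪v, ξ⟫_ℝ : ℝ) : ℂ) * F v)
      = ∑ i, (ξ i : ℂ) * ((√(α i + 1) : ℝ) * ((hermP (up α i) v : ℂ) * F v)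
        + (√(α i) : ℝ) * ((hermP (down α i) v : ℂ) * F v)) := fun v => by
    rw [← mul_assoc, ← Complex.ofReal_mul, mul_comm (hermP α v), inner_mul_hermP]
    push_cast
    rw [Finset.sum_mul]
    refine Finset.sum_congr rfl fun i _ => ?_
    ring
  have hi := fun β => integrable_hermP_mul (d := d) β hF
  simp only [coef, ladder]
  simp_rw [e]
  rw [integral_finsetSum]
  swap
  · exact fun i _ => (((hi _).const_mul _).add ((hi _).const_mul _)).const_mul _
  refine Finset.sum_congr rfl fun i _ => ?_
  rw [integral_const_mul, integral_add ((hi _).const_mul _) ((hi _).const_mul _),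
    integral_const_mul, integral_const_mul]

/-! ### Completeness -/

/-- By duality: every smooth compactly supported function is the Fourier transform of a Schwartz
function, and moving the transform onto `F` makes the pairing vanish. -/
theorem ae_eq_zero_of_fourier_eq_zero {F : Space d → ℂ} (hF : Integrable F)
    (h : ∀ k : Space d, ∫ v, Complex.exp (((-2 * Real.pi * ⟪v, k⟫_ℝ : ℝ) : ℂ) * Complex.I) * F v = 0) :
    F =ᵐ[volume] 0 := by
  refine ae_eq_zero_of_integral_contDiff_smul_eq_zero hF.locallyIntegrable fun g hg hgc => ?_
  have hg' : ContDiff ℝ ∞ fun v => (g v : ℂ) := Complex.ofRealCLM.contDiff.comp hg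
  have hgc' : HasCompactSupport fun v => (g v : ℂ) := hgc.comp_left (g := Complex.ofReal) rfl
  let φ : SchwartzMap (Space d) ℂ := hgc'.toSchwartzMap hg'
  let ψ : SchwartzMap (Space d) ℂ := (FourierTransform.fourierCLE ℂ _).symm φ
  have hψ : (FourierTransform.fourierCLE ℂ _) ψ = φ := ContinuousLinearEquiv.apply_symm_apply _ _
  have key := VectorFourier.integral_fourierIntegral_smul_eq_flip (L := innerₗ (Space d))
      (μ := volume) (ν := volume) (f := ψ) (g := F)
      Real.continuous_fourierChar continuous_inner ψ.integrable hF
  have h0 : ∀ x, VectorFourier.fourierIntegral Real.fourierChar volume (innerₗ (Space d)).flip F x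
      = 0 := fun x => by
    rw [← h x]
    simp only [VectorFourier.fourierIntegral]
    congr 1; ext v
    rw [Circle.smul_def, Real.fourierChar_apply]
    simp
  have h1 : ∀ x, VectorFourier.fourierIntegral Real.fourierChar volume (innerₗ (Space d)) ψ x
      = (g x : ℂ) := fun x => by
    have := congrArg (fun f : SchwartzMap (Space d) ℂ => f x) hψ
    exact this
  simp only [h0, h1, smul_zero, integral_zero] at key
  simpa using key

/-- The ladder sends the zero family to itself, so vanishing coefficients persist after
multiplication by any power of `⟪v, k⟫`. -/
theorem integral_inner_pow_mul_hermP {F : Space d → ℂ}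
    (hF : ∀ c : ℝ, Integrable fun v => Real.exp (c * ‖v‖) • F v) (h : ∀ α, coef α F = 0)
    (k : Space d) (n : ℕ) : (∀ α, coef α (fun v => ((⟪v, k⟫_ℝ : ℝ) : ℂ) ^ n * F v) = 0) ∧
      ∀ c : ℝ, Integrable fun v => Real.exp (c * ‖v‖) • (((⟪v, k⟫_ℝ : ℝ) : ℂ) ^ n * F v) := by
  induction n with
  | zero =>
    simp only [pow_zero, one_mul]
    exact ⟨h, hF⟩
  | succ n ih =>
    have e : ∀ v, ((⟪v, k⟫_ℝ : ℝ) : ℂ) ^ (n + 1) * F v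
        = ((⟪v, k⟫_ℝ : ℝ) : ℂ) * (((⟪v, k⟫_ℝ : ℝ) : ℂ) ^ n * F v) := fun v => by ring
    simp_rw [e]
    refine ⟨fun α => ?_, integrable_exp_smul_apply_mul ih.2 k⟩
    rw [coef_inner_mul ih.2]
    simp [ladder, ih.1]

/-- The series of absolute values sums to `exp ‖a v‖ ‖F v‖ ≤ exp (K‖v‖) ‖F v‖`, an integrable
dominating function. -/
theorem hasSum_integral_pow_mul {F : Space d → ℂ}
    (hF : ∀ c : ℝ, Integrable fun v => Real.exp (c * ‖v‖) • F v) {a : Space d → ℂ}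
    (hac : Continuous a) {K : ℝ} (hna : ∀ v, ‖a v‖ ≤ K * ‖v‖) :
    HasSum (fun n : ℕ => ∫ v, a v ^ n / n.factorial * F v) (∫ v, Complex.exp (a v) * F v) := by
  have hF0 : AEStronglyMeasurable F volume := by simpa using (hF 0).aestronglyMeasurable
  have hs : ∀ v, HasSum (fun n : ℕ => a v ^ n / n.factorial) (Complex.exp (a v)) := fun v => by
    rw [Complex.exp_eq_exp_ℂ]; exact NormedSpace.expSeries_div_hasSum_exp (a v)
  have hsn : ∀ v, HasSum (fun n : ℕ => ‖a v‖ ^ n / n.factorial) (Real.exp ‖a v‖) := fun v => by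
    rw [Real.exp_eq_exp_ℝ]; exact NormedSpace.expSeries_div_hasSum_exp ‖a v‖
  refine hasSum_integral_of_dominated_convergence
    (fun n v => ‖a v‖ ^ n / n.factorial * ‖F v‖)
    (fun n => ((hac.pow n).div_const _).aestronglyMeasurable.mul hF0)
    (fun n => ae_of_all _ fun v => by simp)
    (ae_of_all _ fun v => (hsn v).summable.mul_right _) ?_
    (ae_of_all _ fun v => (hs v).mul_right _)
  simp_rw [fun v => ((hsn v).mul_right ‖F v‖).tsum_eq]
  refine (hF K).norm.mono' ((Real.continuous_exp.comp hac.norm).aestronglyMeasurable.mul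
    hF0.norm) (ae_of_all _ fun v => ?_)
  rw [norm_mul, norm_norm, norm_smul, Real.norm_eq_abs, Real.norm_eq_abs, Real.abs_exp,
    Real.abs_exp]
  exact mul_le_mul_of_nonneg_right (Real.exp_le_exp.2 (hna v)) (norm_nonneg _)

/-- Expanding the character in its power series writes the Fourier transform of `F` as a series of
moments. Each moment is the coefficient of index zero of a power of `⟪v, k⟫` times `F`, hence zero.
-/
theorem ae_eq_zero_of_coef_eq_zero {F : Space d → ℂ}
    (hF : ∀ c : ℝ, Integrable fun v => Real.exp (c * ‖v‖) • F v) (h : ∀ α, coef α F = 0) :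
    F =ᵐ[volume] 0 := by
  have hF0 : Integrable F := by
    have h0 := hF 0
    simp only [zero_mul, Real.exp_zero, one_smul] at h0
    exact h0
  refine ae_eq_zero_of_fourier_eq_zero hF0 fun k => ?_
  have hsum := hasSum_integral_pow_mul hF
    (a := fun v => ((-2 * Real.pi * ⟪v, k⟫_ℝ : ℝ) : ℂ) * Complex.I) (by fun_prop)
    (K := 2 * Real.pi * ‖k‖) (fun v => by
      rw [norm_mul, Complex.norm_I, mul_one, Complex.norm_real, Real.norm_eq_abs, abs_mul, abs_mul,
        abs_neg, abs_two, abs_of_pos Real.pi_pos]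
      have := abs_real_inner_le_norm v k
      nlinarith [Real.pi_pos])
  refine hsum.unique ?_
  convert! hasSum_zero using 2 with n
  have h1 := (integral_inner_pow_mul_hermP hF h k n).1 0
  simp only [coef, hermP_zero, Complex.ofReal_one, one_mul] at h1
  have e : ∀ v, (((-2 * Real.pi * ⟪v, k⟫_ℝ : ℝ) : ℂ) * Complex.I) ^ n / n.factorial * F v
      = ((-2 * Real.pi : ℝ) * Complex.I) ^ n / n.factorial
        * (((⟪v, k⟫_ℝ : ℝ) : ℂ) ^ n * F v) := fun v => by
    rw [Complex.ofReal_mul]; ring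
  simp_rw [e]
  rw [integral_const_mul, h1, mul_zero]

/-! ### Orthonormality -/

theorem integral_prod_coord {f : Fin d → ℝ → ℝ} :
    ∫ v : Space d, ∏ i, f i (v i) = ∏ i, ∫ x, f i x := by
  rw [← integral_fintype_prod_volume_eq_prod]
  exact (EuclideanSpace.volume_preserving_symm_measurableEquiv_toLp (Fin d)).integral_comp
    (MeasurableEquiv.measurableEmbedding _) (fun x : Fin d → ℝ => ∏ i, f i (x i))

theorem integral_hermP_mul_hermF (α β : Fin d → ℕ) :
    ∫ v, hermP α v * hermF β v = if α = β then 1 else 0 := by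
  have e : ∀ v : Space d, hermP α v * hermF β v
      = ∏ i, hermiteN (α i) (v i) * hermiteN (β i) (v i) * gauss (v i) := fun v => by
    rw [hermP, hermF, ← Finset.prod_mul_distrib]
    exact Finset.prod_congr rfl fun i _ => by rw [hermiteG]; ring
  simp_rw [e]
  rw [integral_prod_coord (f := fun i x => hermiteN (α i) x * hermiteN (β i) x * gauss x)]
  simp_rw [integral_hermiteN_mul]
  by_cases h : α = β
  · simp [h]
  · obtain ⟨i, hi⟩ := Function.ne_iff.1 h
    rw [if_neg h]
    exact Finset.prod_eq_zero (Finset.mem_univ i) (if_neg hi)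

theorem coef_hermF (α β : Fin d → ℕ) :
    coef α (fun v => (hermF β v : ℂ)) = if α = β then 1 else 0 := by
  rw [coef]
  simp_rw [← Complex.ofReal_mul]
  rw [integral_complex_ofReal, integral_hermP_mul_hermF]
  split_ifs <;> simp

/-- The weight cancels the Maxwellian contained in `hermF`, so projections in `L²(dγ)` become
Lebesgue integrals against polynomials. -/
theorem integral_mul_hermF_gamma (α : Fin d → ℕ) (F : Space d → ℂ) :
    ∫ v, (hermF α v : ℂ) * F v ∂(gammaMeasure d) = coef α F := by
  rw [integral_gamma, coef]
  congr 1; ext v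
  rw [hermP_eq, Complex.real_smul]; push_cast; ring

/-- The Hermite functions as elements of `L²(dγ)`. -/
def hermLp (α : Fin d → ℕ) : Lp ℂ 2 (gammaMeasure d) := (memLp_hermF_complex α).toLp _

theorem inner_hermLp (α : Fin d → ℕ) (F : Lp ℂ 2 (gammaMeasure d)) :
    ⟪hermLp α, F⟫_ℂ = coef α F := by
  rw [L2.inner_def, ← integral_mul_hermF_gamma]
  refine integral_congr_ae ?_
  filter_upwards [(memLp_hermF_complex α).coeFn_toLp] with v hv
  rw [hermLp, hv]
  simp [mul_comm]

theorem coef_congr {F H : Space d → ℂ} (h : F =ᵐ[gammaMeasure d] H) (α : Fin d → ℕ) :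
    coef α F = coef α H :=
  integral_congr_ae (by
    filter_upwards [absolutelyContinuous_gamma.ae_eq h] with v hv
    rw [hv])

theorem orthonormal_hermLp : Orthonormal ℂ (hermLp (d := d)) := by
  classical
  rw [orthonormal_iff_ite]
  intro α β
  rw [inner_hermLp, hermLp, coef_congr (memLp_hermF_complex β).coeFn_toLp, coef_hermF]

/-- The Hermite basis of `L²(dγ)`. -/
def hermBasis : HilbertBasis (Fin d → ℕ) ℂ (Lp ℂ 2 (gammaMeasure d)) :=
  HilbertBasis.mkOfOrthogonalEqBot orthonormal_hermLp (by
    rw [Submodule.eq_bot_iff]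
    intro F hF
    rw [Lp.eq_zero_iff_ae_eq_zero]
    refine gamma_absolutelyContinuous.ae_eq (ae_eq_zero_of_coef_eq_zero
      (MemLp.integrable_exp_smul (Lp.memLp F)) fun α => ?_)
    rw [← inner_hermLp]
    exact hF _ (Submodule.subset_span ⟨α, rfl⟩))

theorem hermBasis_apply (α : Fin d → ℕ) : hermBasis α = hermLp α := by
  rw [hermBasis, HilbertBasis.coe_mkOfOrthogonalEqBot]

/-- Parseval's identity in the Hermite basis. -/
theorem hasSum_coef_mul_conj {F H : Space d → ℂ} (hF : MemLp F 2 (gammaMeasure d))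
    (hH : MemLp H 2 (gammaMeasure d)) :
    HasSum (fun α => coef α F * (starRingEnd ℂ) (coef α H)) (ip F H) := by
  have h := hermBasis.hasSum_inner_mul_inner (hH.toLp H) (hF.toLp F)
  simp only [hermBasis_apply, inner_hermLp, coef_congr hF.coeFn_toLp] at h
  have e1 : ∀ α, ⟪hH.toLp H, hermLp α⟫_ℂ = (starRingEnd ℂ) (coef α H) := fun α => by
    rw [← inner_conj_symm, inner_hermLp, coef_congr hH.coeFn_toLp]
  have e2 : ⟪hH.toLp H, hF.toLp F⟫_ℂ = ip F H := by
    rw [L2.inner_def, ip]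
    refine integral_congr_ae ?_
    filter_upwards [hF.coeFn_toLp, hH.coeFn_toLp] with v h1 h2
    rw [h1, h2]; simp
  simp only [e1, e2] at h
  simpa only [mul_comm] using h

theorem ip_self (F : Space d → ℂ) : ip F F = sqNorm F := by
  rw [ip, sqNorm, ← integral_complex_ofReal]
  congr 1; ext v
  rw [Complex.mul_conj, Complex.normSq_eq_norm_sq]

theorem hasSum_norm_sq_coef {F : Space d → ℂ} (hF : MemLp F 2 (gammaMeasure d)) :
    HasSum (fun α => ‖coef α F‖ ^ 2) (sqNorm F) := by
  have h := hasSum_coef_mul_conj hF hF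
  rw [ip_self] at h
  have h2 := Complex.hasSum_ofReal.1 (by simpa [Complex.mul_conj, Complex.normSq_eq_norm_sq] using h :
    HasSum (fun α => ((‖coef α F‖ ^ 2 : ℝ) : ℂ)) (sqNorm F : ℂ))
  exact h2

end HermiteFunctions

/-! ### The collision operators on smooth functions -/

section Collisions

variable {d : ℕ} {V : Type} [NormedAddCommGroup V] [NormedSpace ℝ V]

/-- Partial derivatives. -/
def pd (i : Fin d) (F : Space d → V) (v : Space d) : V := fderiv ℝ F v (EuclideanSpace.single i 1)

theorem contDiff_pd {F : Space d → V} (hF : ContDiff ℝ ∞ F) (i : Fin d) : ContDiff ℝ ∞ (pd i F) :=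
  (hF.fderiv_right (m := ∞) (by simp)).clm_apply contDiff_const

theorem contDiff_coord (i : Fin d) : ContDiff ℝ ∞ fun v : Space d => v i :=
  (EuclideanSpace.proj (𝕜 := ℝ) i : Space d →L[ℝ] ℝ).contDiff

theorem contDiff_coord_smul {F : Space d → V} (hF : ContDiff ℝ ∞ F) (i : Fin d) :
    ContDiff ℝ ∞ fun w : Space d => w i • F w := (contDiff_coord i).smul hF

theorem contDiff_pd_add {F : Space d → V} (hF : ContDiff ℝ ∞ F) (i : Fin d) :
    ContDiff ℝ ∞ fun w : Space d => pd i F w + w i • F w :=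
  (contDiff_pd hF i).add (contDiff_coord_smul hF i)

theorem pd_add {F H : Space d → V} {v : Space d} (hF : DifferentiableAt ℝ F v)
    (hH : DifferentiableAt ℝ H v) (i : Fin d) :
    pd i (fun w => F w + H w) v = pd i F v + pd i H v := by
  simp only [pd]; rw [fderiv_fun_add hF hH]; rfl

theorem pd_smul {a : Space d → ℝ} {F : Space d → V} {v : Space d} (ha : DifferentiableAt ℝ a v)
    (hF : DifferentiableAt ℝ F v) (i : Fin d) :
    pd i (fun w => a w • F w) v = a v • pd i F v + pd i a v • F v := by
  simp only [pd]; rw [fderiv_fun_smul ha hF]; simp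

theorem laplacian_eq_sum_pd {F : Space d → V} (hF : ContDiff ℝ ∞ F) (v : Space d) :
    Laplacian.laplacian F v = ∑ i, pd i (pd i F) v := by
  rw [InnerProductSpace.laplacian_eq_iteratedFDeriv_orthonormalBasis F
    (EuclideanSpace.basisFun (Fin d) ℝ)]
  refine Finset.sum_congr rfl fun i _ => ?_
  have hd : DifferentiableAt ℝ (fderiv ℝ F) v :=
    (hF.fderiv_right (m := ∞) (by simp)).differentiable (by simp) v
  rw [iteratedFDeriv_two_apply]
  change _ = fderiv ℝ (fun w => fderiv ℝ F w (EuclideanSpace.single i 1)) v _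
  rw [fderiv_clm_apply hd (differentiableAt_const _)]
  simp

/-- The divergence form of the operator, from which product rule, eigenvalues and symmetry all
follow. -/
theorem collisionOp_fokkerPlanck {F : Space d → V} (hF : ContDiff ℝ ∞ F) (v : Space d) :
    collisionOp Collision.fokkerPlanck F v = ∑ i, pd i (fun w => pd i F w + w i • F w) v := by
  simp only [collisionOp]
  rw [laplacian_eq_sum_pd hF, ← Finset.sum_add_distrib]
  refine Finset.sum_congr rfl fun i _ => ?_
  rw [pd_add ((contDiff_pd hF i).differentiable (by simp) v)
    ((contDiff_coord_smul hF i).differentiable (by simp) v)]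
  rfl

/-- Since the operator acts on the argument only, it commutes with real-linear maps of the values.
This passes between real and complex functions, and to real and imaginary parts of plane waves. -/
theorem collisionOp_clm_comp [CompleteSpace V] {W : Type} [NormedAddCommGroup W] [NormedSpace ℝ W]
    [CompleteSpace W] (op : Collision) (l : V →L[ℝ] W) {F : Space d → V} (hF : ContDiff ℝ ∞ F)
    (hi : Integrable F) (v : Space d) :
    collisionOp op (fun w => l (F w)) v = l (collisionOp op F v) := by
  have hp : ∀ {H : Space d → V} (_ : ContDiff ℝ ∞ H) (i : Fin d) (w : Space d),
      pd i (fun w => l (H w)) w = l (pd i H w) := fun {H} hH i w => by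
    simp only [pd]
    have h := l.hasFDerivAt.comp w (hH.differentiable (by simp) w).hasFDerivAt
    rw [show (fun w => l (H w)) = l ∘ H from rfl, h.fderiv]
    rfl
  cases op with
  | fokkerPlanck =>
    have hlF : ContDiff ℝ ∞ fun w => l (F w) := l.contDiff.comp hF
    rw [collisionOp_fokkerPlanck hlF, collisionOp_fokkerPlanck hF, map_sum]
    refine Finset.sum_congr rfl fun i _ => ?_
    rw [← hp (contDiff_pd_add hF i)]
    congr 1; ext w
    rw [hp hF, map_add, map_smul]
  | bgk =>
    simp only [collisionOp]
    rw [l.integral_comp_comm hi, map_sub, map_smul]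

theorem collisionOp_add (op : Collision) {F H : Space d → V} (hF : ContDiff ℝ ∞ F)
    (hH : ContDiff ℝ ∞ H) (hFi : Integrable F) (hHi : Integrable H) (v : Space d) :
    collisionOp op (fun w => F w + H w) v = collisionOp op F v + collisionOp op H v := by
  have hp : ∀ {A B : Space d → V} (_ : ContDiff ℝ ∞ A) (_ : ContDiff ℝ ∞ B) (i : Fin d)
      (w : Space d), pd i (fun w => A w + B w) w = pd i A w + pd i B w := fun hA hB i w =>
    pd_add (hA.differentiable (by simp) w) (hB.differentiable (by simp) w) i
  cases op with
  | fokkerPlanck =>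
    rw [collisionOp_fokkerPlanck (hF.add hH), collisionOp_fokkerPlanck hF,
      collisionOp_fokkerPlanck hH, ← Finset.sum_add_distrib]
    refine Finset.sum_congr rfl fun i _ => ?_
    rw [← hp (contDiff_pd_add hF i)
      (contDiff_pd_add hH i)]
    congr 1; ext w
    rw [hp hF hH, smul_add]; abel
  | bgk =>
    simp only [collisionOp]
    rw [integral_add hFi hHi, smul_add]; abel

theorem collisionOp_sum {ι : Type*} (op : Collision) (s : Finset ι) {F : ι → Space d → V}
    (hF : ∀ k, ContDiff ℝ ∞ (F k)) (hi : ∀ k, Integrable (F k)) (v : Space d) :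
    collisionOp op (fun w => ∑ k ∈ s, F k w) v = ∑ k ∈ s, collisionOp op (F k) v := by
  classical
  induction s using Finset.induction_on generalizing v with
  | empty =>
    cases op with
    | fokkerPlanck =>
      simp only [Finset.sum_empty]
      rw [collisionOp_fokkerPlanck contDiff_const]
      simp [pd]
    | bgk => simp [collisionOp]
  | insert k s hk ih =>
    simp only [Finset.sum_insert hk]
    rw [collisionOp_add op (hF k) (ContDiff.sum fun j _ => hF j) (hi k)
      (integrable_finsetSum _ fun j _ => hi j), ih]

/-! ### Spectrum of the collision operators -/

/-- The eigenvalue of `-L` on the Hermite function of index `α`. -/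
def decay (op : Collision) (α : Fin d → ℕ) : ℝ :=
  match op with
  | Collision.fokkerPlanck => ∑ i, (α i : ℝ)
  | Collision.bgk => if α = 0 then 0 else 1

theorem decay_zero (op : Collision) : decay op (0 : Fin d → ℕ) = 0 := by
  cases op <;> simp [decay]

/-- The common spectral gap of the two operators, which lets the estimates treat them together. -/
theorem one_le_decay (op : Collision) {α : Fin d → ℕ} (h : α ≠ 0) : 1 ≤ decay op α := by
  cases op with
  | bgk => simp [decay, h]
  | fokkerPlanck =>
    obtain ⟨i, hi⟩ := Function.ne_iff.1 h
    have h1 : (1 : ℝ) ≤ α i := by exact_mod_cast Nat.one_le_iff_ne_zero.2 hi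
    exact h1.trans (Finset.single_le_sum (f := fun i => (α i : ℝ)) (fun _ _ => Nat.cast_nonneg _)
      (Finset.mem_univ i))

theorem up_zero_ne (i : Fin d) : up 0 i ≠ 0 := fun h => by
  have := congrFun h i
  simp [up] at this

theorem decay_up_zero (op : Collision) (i : Fin d) : decay op (up 0 i) = 1 := by
  cases op with
  | bgk => simp [decay, up_zero_ne]
  | fokkerPlanck =>
    simp only [decay]
    rw [Finset.sum_eq_single i (fun j _ hj => by rw [up_ne _ hj]; simp) (by simp), up_self]
    simp

theorem pd_hermF (α : Fin d → ℕ) (i : Fin d) :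
    pd i (hermF α) = fun v => -√(α i + 1) * hermF (up α i) v :=
  funext fun v => fderiv_hermF α i v

theorem integrable_hermF (α : Fin d → ℕ) : Integrable (hermF α) := by
  obtain ⟨C, c, hC, h⟩ := exists_abs_hermP_le α
  refine ((integrable_exp_mul_maxwellian (d := d) c).const_mul C).mono'
    (continuous_hermF α).aestronglyMeasurable (ae_of_all _ fun v => ?_)
  rw [Real.norm_eq_abs, hermF_eq, abs_mul, ← mul_assoc, abs_of_pos (maxwellian_pos v)]
  exact mul_le_mul_of_nonneg_right (h v) (maxwellian_pos v).le

theorem integral_hermF (α : Fin d → ℕ) : ∫ v, hermF α v = if α = 0 then 1 else 0 := by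
  have h := integral_hermP_mul_hermF 0 α
  simp only [hermP_zero, one_mul, eq_comm] at h
  simp only [← h]

theorem pd_hermF_add (α : Fin d → ℕ) (i : Fin d) (v : Space d) :
    pd i (hermF α) v + v i • hermF α v = √(α i) * hermF (down α i) v := by
  rw [pd_hermF, smul_eq_mul, mul_hermF]; ring

/-- In divergence form, `∂ᵢ + vᵢ` lowers the `i`-th index and `∂ᵢ` raises it again, contributing
`-√(α i)²`. -/
theorem collisionOp_hermF (op : Collision) (α : Fin d → ℕ) (v : Space d) :
    collisionOp op (hermF α) v = -decay op α * hermF α v := by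
  cases op with
  | fokkerPlanck =>
    rw [collisionOp_fokkerPlanck (contDiff_hermF α), decay, neg_mul, Finset.sum_mul,
      ← Finset.sum_neg_distrib]
    refine Finset.sum_congr rfl fun i _ => ?_
    simp_rw [pd_hermF_add]
    have h := pd_smul (a := fun _ : Space d => √(α i)) (F := hermF (down α i)) (v := v)
      (differentiableAt_const _) ((contDiff_hermF _).differentiable (by simp) v) i
    simp only [smul_eq_mul] at h
    rw [h, pd_hermF]
    -- Raising undoes lowering only when the index is positive; at zero the factor `√(α i)` kills
    -- the term.
    by_cases hi : α i = 0
    · simp [hi, pd]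
    · rw [up_down α i hi, down_self]
      have : ((α i - 1 : ℕ) : ℝ) + 1 = α i := by
        rw [Nat.cast_sub (Nat.one_le_iff_ne_zero.2 hi)]; simp
      rw [this]
      have h2 : √(α i : ℝ) * √(α i) = α i := Real.mul_self_sqrt (Nat.cast_nonneg _)
      simp only [pd, fderiv_fun_const, Pi.zero_apply, zero_apply, zero_mul, add_zero]
      linear_combination -hermF α v * h2
  | bgk =>
    simp only [collisionOp, decay, integral_hermF]
    by_cases h : α = 0
    · simp [h, hermF_zero]
    · simp [h]

/-! ### Symmetry of the Fokker-Planck operator -/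

theorem pd_maxwellian (i : Fin d) (v : Space d) : pd i (maxwellian d) v = -v i * maxwellian d v := by
  have h : maxwellian d = hermF 0 := funext fun v => (hermF_zero v).symm
  have h2 := mul_hermF (0 : Fin d → ℕ) i v
  rw [h, pd_hermF]
  simp only [Pi.zero_apply, Nat.cast_zero, Real.sqrt_zero, zero_mul, add_zero] at h2 ⊢
  linarith

theorem contDiff_maxwellian_inv_smul {F : Space d → V} (hF : ContDiff ℝ ∞ F) :
    ContDiff ℝ ∞ fun v => (maxwellian d v)⁻¹ • F v :=
  (contDiff_maxwellian.inv fun v => (maxwellian_pos v).ne').smul hF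

/-- Conjugation by the Maxwellian turns `∂ᵢ` into `∂ᵢ + vᵢ`. The product rule is applied to `F = M
H`, which avoids differentiating the inverse. -/
theorem pd_maxwellian_inv_smul {F : Space d → V} (hF : ContDiff ℝ ∞ F) (i : Fin d) (v : Space d) :
    pd i (fun w => (maxwellian d w)⁻¹ • F w) v = (maxwellian d v)⁻¹ • (pd i F v + v i • F v) := by
  set H : Space d → V := fun w => (maxwellian d w)⁻¹ • F w with hH
  have hHd : ContDiff ℝ ∞ H := contDiff_maxwellian_inv_smul hF
  have hFH : F = fun w => maxwellian d w • H w := funext fun w => by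
    simp only [hH]; rw [smul_smul, mul_inv_cancel₀ (maxwellian_pos w).ne', one_smul]
  clear_value H
  have h := pd_smul (contDiff_maxwellian.differentiable (by simp) v)
    (hHd.differentiable (by simp) v) i
  have hm := (maxwellian_pos v).ne'
  rw [← hFH, pd_maxwellian] at h
  rw [h]
  have hFv : F v = maxwellian d v • H v := congrFun hFH v
  rw [hFv, smul_smul, neg_mul, neg_smul, add_assoc, neg_add_cancel, add_zero, smul_smul,
    inv_mul_cancel₀ hm, one_smul]

theorem hasCompactSupport_pd {F : Space d → V} (hF : HasCompactSupport F) (i : Fin d) :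
    HasCompactSupport (pd i F) := hF.fderiv_apply (𝕜 := ℝ) _

theorem hasCompactSupport_smul {a : Space d → ℝ} {F : Space d → V} (hF : HasCompactSupport F) :
    HasCompactSupport fun v => a v • F v :=
  hF.mono fun v hv h => hv (by simp only [h, smul_zero])

theorem hasCompactSupport_add {W : Type*} [AddZeroClass W] [TopologicalSpace W] [ContinuousAdd W]
    {F H : Space d → W} (hF : HasCompactSupport F)
    (hH : HasCompactSupport H) : HasCompactSupport fun v => F v + H v := hF.add hH

theorem integrable_mul_of_hasCompactSupport {P Q : Space d → ℂ} (hP : Continuous P)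
    (hQ : Continuous Q) (hc : HasCompactSupport P ∨ HasCompactSupport Q) :
    Integrable fun v => P v * Q v :=
  (hP.mul hQ).integrable_of_hasCompactSupport
    (hc.elim (fun h => h.mul_right) fun h => h.mul_left)

theorem integral_mul_pd {P Q : Space d → ℂ} (hP : ContDiff ℝ ∞ P) (hQ : ContDiff ℝ ∞ Q)
    (hc : HasCompactSupport P ∨ HasCompactSupport Q) (i : Fin d) :
    ∫ v, P v * pd i Q v = -∫ v, pd i P v * Q v :=
  integral_mul_fderiv_eq_neg_fderiv_mul_of_integrable
    (integrable_mul_of_hasCompactSupport (contDiff_pd hP i).continuous hQ.continuous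
      (hc.imp_left fun h => hasCompactSupport_pd h i))
    (integrable_mul_of_hasCompactSupport hP.continuous (contDiff_pd hQ i).continuous
      (hc.imp_right fun h => hasCompactSupport_pd h i))
    (integrable_mul_of_hasCompactSupport hP.continuous hQ.continuous hc)
    (fun v _ => hP.differentiable (by simp) v) (fun v _ => hQ.differentiable (by simp) v)

/-- The Dirichlet form of the Fokker-Planck operator. -/
theorem integral_mul_fokkerPlanck {A B : Space d → ℂ} (hA : ContDiff ℝ ∞ A) (hB : ContDiff ℝ ∞ B)
    (hc : HasCompactSupport B ∨ HasCompactSupport A) :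
    ∫ v, B v * collisionOp Collision.fokkerPlanck A v ∂(gammaMeasure d)
      = -∫ v, ∑ i, (pd i B v + v i • B v) * (pd i A v + v i • A v) ∂(gammaMeasure d) := by
  have hHd : ContDiff ℝ ∞ fun w => (maxwellian d w)⁻¹ • B w := contDiff_maxwellian_inv_smul hB
  have hKd := contDiff_pd_add hA
  have hc' : ∀ i, HasCompactSupport (fun w => (maxwellian d w)⁻¹ • B w)
      ∨ HasCompactSupport fun w => pd i A w + w i • A w := fun i =>
    hc.imp (fun h => hasCompactSupport_smul h) fun h =>
      hasCompactSupport_add (hasCompactSupport_pd h i) (hasCompactSupport_smul h)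
  rw [integral_gamma, integral_gamma]
  have e1 : ∀ v, (maxwellian d v)⁻¹ • (B v * collisionOp Collision.fokkerPlanck A v)
      = ∑ i, (maxwellian d v)⁻¹ • B v * pd i (fun w => pd i A w + w i • A w) v := fun v => by
    rw [collisionOp_fokkerPlanck hA, ← smul_mul_assoc, Finset.mul_sum]
  have e2 : ∀ v, (maxwellian d v)⁻¹ • ∑ i, (pd i B v + v i • B v) * (pd i A v + v i • A v)
      = ∑ i, pd i (fun w => (maxwellian d w)⁻¹ • B w) v * (pd i A v + v i • A v) := fun v => by
    rw [Finset.smul_sum]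
    refine Finset.sum_congr rfl fun i _ => ?_
    rw [pd_maxwellian_inv_smul hB, smul_mul_assoc]
  rw [integral_congr_ae (ae_of_all _ e1), integral_congr_ae (ae_of_all _ e2)]
  have i1 : ∀ i, Integrable fun v =>
      (maxwellian d v)⁻¹ • B v * pd i (fun w => pd i A w + w i • A w) v := fun i =>
    integrable_mul_of_hasCompactSupport hHd.continuous
      (contDiff_pd (hKd i) i).continuous ((hc' i).imp_right fun h => hasCompactSupport_pd h i)
  have i2 : ∀ i, Integrable fun v =>
      pd i (fun w => (maxwellian d w)⁻¹ • B w) v * (pd i A v + v i • A v) := fun i =>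
    integrable_mul_of_hasCompactSupport
      (contDiff_pd hHd i).continuous (hKd i).continuous
      ((hc' i).imp_left fun h => hasCompactSupport_pd h i)
  rw [integral_finsetSum _ fun i _ => i1 i, integral_finsetSum _ fun i _ => i2 i,
    ← Finset.sum_neg_distrib]
  exact Finset.sum_congr rfl fun i _ => integral_mul_pd hHd (hKd i) (hc' i) i

/-- The Dirichlet form is symmetric in its arguments, and one compactly supported factor is enough
to integrate by parts in either order. -/
theorem integral_mul_fokkerPlanck_comm {A B : Space d → ℂ} (hA : ContDiff ℝ ∞ A)
    (hB : ContDiff ℝ ∞ B) (hc : HasCompactSupport B) :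
    ∫ v, B v * collisionOp Collision.fokkerPlanck A v ∂(gammaMeasure d)
      = ∫ v, collisionOp Collision.fokkerPlanck B v * A v ∂(gammaMeasure d) := by
  rw [integral_mul_fokkerPlanck hA hB (Or.inl hc)]
  simp_rw [mul_comm _ (A _)]
  rw [integral_mul_fokkerPlanck hB hA (Or.inr hc)]
  simp_rw [mul_comm]

/-! ### Cutoffs -/

/-- A smooth cutoff, equal to one on the unit ball and to zero outside the ball of radius two. -/
def bump (d : ℕ) : ContDiffBump (0 : Space d) := ⟨1, 2, one_pos, one_lt_two⟩

/-- The cutoff at scale `n + 1`. -/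
def cut (n : ℕ) (v : Space d) : ℝ := bump d (((n : ℝ) + 1)⁻¹ • v)

theorem contDiff_cut (n : ℕ) : ContDiff ℝ ∞ (cut n : Space d → ℝ) :=
  (bump d).contDiff.comp (contDiff_const_smul _)

theorem abs_cut_le (n : ℕ) (v : Space d) : |cut n v| ≤ 1 := by
  rw [cut, abs_of_nonneg (bump d).nonneg]; exact (bump d).le_one

theorem cut_eq_zero (n : ℕ) (v : Space d) (h : 2 * ((n : ℝ) + 1) < ‖v‖) : cut n v = 0 := by
  refine (bump d).zero_of_le_dist ?_
  rw [dist_zero_right, norm_smul, Real.norm_eq_abs, abs_of_pos (by positivity),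
    inv_mul_eq_div, le_div_iff₀ (by positivity)]
  exact h.le

theorem hasCompactSupport_cut (n : ℕ) : HasCompactSupport (cut n : Space d → ℝ) :=
  HasCompactSupport.intro (isCompact_closedBall (0 : Space d) (2 * ((n : ℝ) + 1))) fun v hv =>
    cut_eq_zero n v (by simpa using hv)

theorem tendsto_cut (v : Space d) : Tendsto (fun n => cut n v) atTop (𝓝 1) := by
  obtain ⟨N, hN⟩ := exists_nat_ge ‖v‖
  refine tendsto_const_nhds.congr' ?_
  filter_upwards [eventually_ge_atTop N] with n hn
  refine ((bump d).one_of_mem_closedBall ?_).symm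
  have : (N : ℝ) ≤ n := by exact_mod_cast hn
  rw [mem_closedBall_zero_iff, norm_smul, Real.norm_eq_abs, abs_of_pos (by positivity),
    inv_mul_eq_div, div_le_iff₀ (by positivity)]
  simp only [bump]; linarith

theorem pd_scale {F : Space d → V} (hF : ContDiff ℝ ∞ F) (a : ℝ) (i : Fin d) (v : Space d) :
    pd i (fun w => F (a • w)) v = a • pd i F (a • v) := by
  have h := (hF.differentiable (by simp) (a • v)).hasFDerivAt.comp v
    ((hasFDerivAt_id v).const_smul a)
  simp only [pd]
  rw [show (fun w => F (a • w)) = F ∘ fun w => a • id w from rfl]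
  erw [h.fderiv]
  simp

/-- Each derivative of a rescaled cutoff yields a factor `(n + 1)⁻¹`; for the second derivative one
of the two factors is discarded. -/
theorem exists_pd_cut_le (i : Fin d) : ∃ C, 0 ≤ C ∧ ∀ (n : ℕ) (v : Space d),
    |pd i (cut n) v| ≤ C * ((n : ℝ) + 1)⁻¹ ∧ |pd i (pd i (cut n)) v| ≤ C * ((n : ℝ) + 1)⁻¹ := by
  have hb : ContDiff ℝ ∞ (bump d : Space d → ℝ) := (bump d).contDiff
  have h1 := contDiff_pd hb i
  have h2 := contDiff_pd h1 i
  have hc1 := hasCompactSupport_pd (bump d).hasCompactSupport i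
  obtain ⟨C1, hC1⟩ := hc1.exists_bound_of_continuous h1.continuous
  obtain ⟨C2, hC2⟩ := (hasCompactSupport_pd hc1 i).exists_bound_of_continuous h2.continuous
  refine ⟨max C1 C2, (norm_nonneg _).trans ((hC1 0).trans (le_max_left _ _)), fun n v => ?_⟩
  have hp : (0 : ℝ) < ((n : ℝ) + 1)⁻¹ := by positivity
  have hp1 : ((n : ℝ) + 1)⁻¹ ≤ 1 := inv_le_one_of_one_le₀ (by linarith [n.cast_nonneg (α := ℝ)])
  have e : pd i (cut n) = fun w : Space d => ((n : ℝ) + 1)⁻¹ • pd i (bump d) (((n : ℝ) + 1)⁻¹ • w) :=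
    funext fun w => pd_scale hb _ i w
  have e2 : pd i (pd i (cut n)) v
      = ((n : ℝ) + 1)⁻¹ • ((n : ℝ) + 1)⁻¹ • pd i (pd i (bump d)) (((n : ℝ) + 1)⁻¹ • v) := by
    have h1' : ContDiff ℝ ∞ fun w : Space d => pd i (bump d) (((n : ℝ) + 1)⁻¹ • w) :=
      h1.comp (contDiff_const_smul _)
    have h3 := pd_smul (a := fun _ => ((n : ℝ) + 1)⁻¹) (differentiableAt_const _)
      (h1'.differentiable (by simp) v) i
    rw [e, h3, pd_scale h1]
    simp [pd]
  constructor
  · rw [e]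
    simp only [smul_eq_mul]
    rw [abs_mul, abs_of_pos hp, mul_comm]
    exact mul_le_mul_of_nonneg_right ((hC1 _).trans (le_max_left _ _)) hp.le
  · rw [e2]
    simp only [smul_eq_mul]
    rw [abs_mul, abs_mul, abs_of_pos hp, mul_comm]
    refine mul_le_mul_of_nonneg_right ?_ hp.le
    have := (hC2 (((n : ℝ) + 1)⁻¹ • v)).trans (le_max_right C1 _)
    rw [Real.norm_eq_abs] at this
    nlinarith [abs_nonneg (pd i (pd i (bump d)) (((n : ℝ) + 1)⁻¹ • v))]

end Collisions

/-! ### Hermite functions with a cutoff -/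

section Cutoff

variable {d : ℕ}

theorem pd_mul {a b : Space d → ℝ} (ha : ContDiff ℝ ∞ a) (hb : ContDiff ℝ ∞ b) (i : Fin d)
    (v : Space d) : pd i (fun w => a w * b w) v = a v * pd i b v + pd i a v * b v := by
  simpa only [smul_eq_mul] using
    pd_smul (ha.differentiable (by simp) v) (hb.differentiable (by simp) v) i

/-- Apart from the main term, every summand contains a derivative of `χ`, so the commutator with a
cutoff disappears as the cutoff is removed. -/
theorem fokkerPlanck_mul {G χ : Space d → ℝ} (hG : ContDiff ℝ ∞ G) (hχ : ContDiff ℝ ∞ χ)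
    (v : Space d) :
    collisionOp Collision.fokkerPlanck (fun w => G w * χ w) v
      = collisionOp Collision.fokkerPlanck G v * χ v
        + ∑ i, ((2 * pd i G v + v i * G v) * pd i χ v + G v * pd i (pd i χ) v) := by
  rw [collisionOp_fokkerPlanck (hG.mul hχ), collisionOp_fokkerPlanck hG, Finset.sum_mul,
    ← Finset.sum_add_distrib]
  refine Finset.sum_congr rfl fun i _ => ?_
  have e : (fun w => pd i (fun u => G u * χ u) w + w i • (G w * χ w))
      = fun w => (pd i G w + w i • G w) * χ w + G w * pd i χ w := funext fun w => by
    rw [pd_mul hG hχ]; simp only [smul_eq_mul]; ring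
  have hK := contDiff_pd_add hG i
  have hp := contDiff_pd hχ i
  rw [e, pd_add ((hK.mul hχ).differentiable (by simp) v) ((hG.mul hp).differentiable (by simp) v),
    pd_mul hK hχ, pd_mul hG hp]
  simp only [smul_eq_mul]; ring

theorem memLp_coord_mul_hermF (α : Fin d → ℕ) (i : Fin d) :
    MemLp (fun v => v i * hermF α v) 2 (gammaMeasure d) := by
  simp_rw [mul_hermF]
  exact ((memLp_hermF _).const_mul _).add ((memLp_hermF _).const_mul _)

theorem memLp_pd_hermF (α : Fin d → ℕ) (i : Fin d) :
    MemLp (pd i (hermF α)) 2 (gammaMeasure d) := by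
  rw [pd_hermF]; exact (memLp_hermF _).const_mul _

theorem memLp_maxwellian : MemLp (maxwellian d) 2 (gammaMeasure d) := by
  have h := memLp_hermF (0 : Fin d → ℕ)
  rwa [show hermF (0 : Fin d → ℕ) = maxwellian d from funext hermF_zero] at h

/-- The truncated Hermite functions `hermF α * cut n` approximate `hermF α` in the graph norm of
the collision operator. -/
theorem exists_bound_collisionOp_cut (op : Collision) (α : Fin d → ℕ) :
    ∃ B : Space d → ℝ, MemLp B 2 (gammaMeasure d) ∧
      (∀ n v, |collisionOp op (fun w => hermF α w * cut n w) v| ≤ B v) ∧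
      ∀ v, Tendsto (fun n => collisionOp op (fun w => hermF α w * cut n w) v) atTop
        (𝓝 (-decay op α * hermF α v)) := by
  cases op with
  | fokkerPlanck =>
    -- The constants bound the commutator terms uniformly in `n`, for domination, and with the
    -- factor `(n + 1)⁻¹`, for convergence.
    choose C hC hC' using fun i : Fin d => exists_pd_cut_le i
    refine ⟨fun v => |decay Collision.fokkerPlanck α * hermF α v|
      + ∑ i, ((2 * |pd i (hermF α) v| + |v i * hermF α v|) * C i + |hermF α v| * C i), ?_, ?_, ?_⟩
    · refine ((memLp_hermF α).const_mul _).norm.add (memLp_finsetSum _ fun i _ => ?_)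
      have h1 := (((memLp_pd_hermF α i).norm.const_mul 2).add
        (memLp_coord_mul_hermF α i).norm).const_mul (C i)
      have h2 := (memLp_hermF α).norm.const_mul (C i)
      refine (h1.add h2).ae_eq (ae_of_all _ fun v => ?_)
      simp only [Pi.add_apply, Real.norm_eq_abs]; ring
    · intro n v
      have hp1 : ((n : ℝ) + 1)⁻¹ ≤ 1 :=
        inv_le_one_of_one_le₀ (by linarith [n.cast_nonneg (α := ℝ)])
      rw [fokkerPlanck_mul (contDiff_hermF α) (contDiff_cut n), collisionOp_hermF]
      refine (abs_add_le _ _).trans (add_le_add ?_ ((Finset.abs_sum_le_sum_abs _ _).trans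
        (Finset.sum_le_sum fun i _ => (abs_add_le _ _).trans (add_le_add ?_ ?_))))
      · rw [abs_mul, neg_mul, abs_neg]
        exact mul_le_of_le_one_right (abs_nonneg _) (abs_cut_le n v)
      · rw [abs_mul]
        refine mul_le_mul ((abs_add_le _ _).trans (by rw [abs_mul, abs_two]))
          (((hC' i n v).1).trans (mul_le_of_le_one_right (hC i) hp1)) (abs_nonneg _) (by positivity)
      · rw [abs_mul]
        exact mul_le_mul_of_nonneg_left (((hC' i n v).2).trans
          (mul_le_of_le_one_right (hC i) hp1)) (abs_nonneg _)
    · intro v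
      have hz : ∀ i, Tendsto (fun n : ℕ => C i * ((n : ℝ) + 1)⁻¹) atTop (𝓝 0) := fun i => by
        simpa using (tendsto_inv_atTop_nhds_zero_nat (𝕜 := ℝ)).comp (tendsto_add_atTop_nat 1)
          |>.const_mul (C i)
      have h1 : ∀ i, Tendsto (fun n => pd i (cut n) v) atTop (𝓝 0) := fun i =>
        squeeze_zero_norm (fun n => (hC' i n v).1) (hz i)
      have h2 : ∀ i, Tendsto (fun n => pd i (pd i (cut n)) v) atTop (𝓝 0) := fun i =>
        squeeze_zero_norm (fun n => (hC' i n v).2) (hz i)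
      simp_rw [fun n => fokkerPlanck_mul (contDiff_hermF α) (contDiff_cut n) v, collisionOp_hermF]
      have h3 := ((tendsto_cut v).const_mul (-decay Collision.fokkerPlanck α * hermF α v)).add
        (tendsto_finsetSum Finset.univ fun i _ =>
          ((h1 i).const_mul (2 * pd i (hermF α) v + v i * hermF α v)).add
            ((h2 i).const_mul (hermF α v)))
      simpa using h3
  | bgk =>
    have hb : ∀ n (v : Space d), |hermF α v * cut n v| ≤ |hermF α v| := fun n v => by
      rw [abs_mul]; exact mul_le_of_le_one_right (abs_nonneg _) (abs_cut_le n v)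
    refine ⟨fun v => maxwellian d v * (∫ w, |hermF α w|) + |hermF α v|,
      (memLp_maxwellian.mul_const _).add (memLp_hermF α).norm, fun n v => ?_, fun v => ?_⟩
    · simp only [collisionOp, smul_eq_mul]
      refine (abs_sub _ _).trans (add_le_add ?_ (hb n v))
      rw [abs_mul, abs_of_pos (maxwellian_pos v)]
      refine mul_le_mul_of_nonneg_left ((abs_integral_le_integral_abs).trans ?_)
        (maxwellian_pos v).le
      refine integral_mono_of_nonneg (ae_of_all _ fun w => abs_nonneg _)
        (integrable_hermF α).norm (ae_of_all _ fun w => hb n w)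
    · rw [← collisionOp_hermF]
      simp only [collisionOp, smul_eq_mul]
      have ht : ∀ w : Space d, Tendsto (fun n => hermF α w * cut n w) atTop (𝓝 (hermF α w)) :=
        fun w => by simpa using (tendsto_cut w).const_mul (hermF α w)
      refine (Tendsto.const_mul _ ?_).sub (ht v)
      exact tendsto_integral_of_dominated_convergence (fun w => |hermF α w|)
        (fun n => ((continuous_hermF α).mul (contDiff_cut n).continuous).aestronglyMeasurable)
        (integrable_hermF α).norm (fun n => ae_of_all _ fun w => hb n w) (ae_of_all _ ht)

theorem contDiff_hermF_cut (α : Fin d → ℕ) (n : ℕ) :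
    ContDiff ℝ ∞ fun w : Space d => hermF α w * cut n w := (contDiff_hermF α).mul (contDiff_cut n)

theorem hasCompactSupport_hermF_cut (α : Fin d → ℕ) (n : ℕ) :
    HasCompactSupport fun w : Space d => hermF α w * cut n w :=
  (hasCompactSupport_cut n).mul_left

theorem integrable_hermF_cut (α : Fin d → ℕ) (n : ℕ) :
    Integrable fun w : Space d => hermF α w * cut n w :=
  (contDiff_hermF_cut α n).continuous.integrable_of_hasCompactSupport
    (hasCompactSupport_hermF_cut α n)

theorem continuous_collisionOp (op : Collision) {F : Space d → ℝ} (hF : ContDiff ℝ ∞ F) :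
    Continuous (collisionOp op F) := by
  cases op with
  | fokkerPlanck =>
    rw [show collisionOp Collision.fokkerPlanck F = _ from funext (collisionOp_fokkerPlanck hF)]
    exact continuous_finsetSum _ fun i _ => (contDiff_pd (contDiff_pd_add hF i) i).continuous
  | bgk =>
    exact (continuous_maxwellian.smul continuous_const).sub hF.continuous

/-- Dominated convergence in `L²`: pairing with a fixed square integrable function. -/
theorem tendsto_integral_mul_of_memLp {X : Type*} [MeasurableSpace X] {μ : Measure X}
    {h B : X → ℝ} {F : X → ℂ} {K : ℕ → X → ℝ} (hF : MemLp F 2 μ) (hB : MemLp B 2 μ)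
    (hK : ∀ n, AEStronglyMeasurable (K n) μ) (hb : ∀ n x, |K n x| ≤ B x)
    (ht : ∀ x, Tendsto (fun n => K n x) atTop (𝓝 (h x))) :
    Tendsto (fun n => ∫ x, (K n x : ℂ) * F x ∂μ) atTop (𝓝 (∫ x, (h x : ℂ) * F x ∂μ)) := by
  refine tendsto_integral_of_dominated_convergence (fun x => B x * ‖F x‖)
    (fun n => (Complex.continuous_ofReal.comp_aestronglyMeasurable (hK n)).mul
      hF.aestronglyMeasurable) (MemLp.integrable_mul hB hF.norm)
    (fun n => ae_of_all _ fun x => ?_) (ae_of_all _ fun x => ?_)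
  · rw [norm_mul, Complex.norm_real, Real.norm_eq_abs]
    exact mul_le_mul_of_nonneg_right (hb n x) (norm_nonneg _)
  · exact ((Complex.continuous_ofReal.tendsto _).comp (ht x)).mul_const _

/-- Nothing is assumed on the size of the derivatives of `F`, so in the Fokker-Planck case the
operator is moved onto a truncated Hermite function. The cutoff is then removed by dominated
convergence, using only that `F` and `L F` are square integrable. The BGK case is a direct
computation. -/
theorem coef_collisionOp (op : Collision) {F : Space d → ℂ} (hs : ContDiff ℝ ∞ F)
    (hF : MemLp F 2 (gammaMeasure d)) (hL : MemLp (collisionOp op F) 2 (gammaMeasure d))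
    (α : Fin d → ℕ) : coef α (collisionOp op F) = -decay op α * coef α F := by
  cases op with
  | fokkerPlanck =>
    obtain ⟨B, hB, hb, ht⟩ := exists_bound_collisionOp_cut Collision.fokkerPlanck α
    have hb0 : ∀ n (v : Space d), |hermF α v * cut n v| ≤ |hermF α v| := fun n v => by
      rw [abs_mul]; exact mul_le_of_le_one_right (abs_nonneg _) (abs_cut_le n v)
    have ht0 : ∀ w : Space d, Tendsto (fun n => hermF α w * cut n w) atTop (𝓝 (hermF α w)) :=
      fun w => by simpa using (tendsto_cut w).const_mul (hermF α w)
    have h1 := tendsto_integral_mul_of_memLp hL (memLp_hermF α).norm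
      (fun n => (contDiff_hermF_cut α n).continuous.aestronglyMeasurable) hb0 ht0
    have h2 := tendsto_integral_mul_of_memLp hF hB
      (fun n => (continuous_collisionOp _ (contDiff_hermF_cut α n)).aestronglyMeasurable) hb ht
    have e : ∀ n, ∫ v, ((hermF α v * cut n v : ℝ) : ℂ) * collisionOp Collision.fokkerPlanck F v
          ∂(gammaMeasure d)
        = ∫ v, ((collisionOp Collision.fokkerPlanck (fun w => hermF α w * cut n w) v : ℝ) : ℂ)
          * F v ∂(gammaMeasure d) := fun n => by
      have hB' : ContDiff ℝ ∞ fun w : Space d => ((hermF α w * cut n w : ℝ) : ℂ) :=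
        Complex.ofRealCLM.contDiff.comp (contDiff_hermF_cut α n)
      rw [integral_mul_fokkerPlanck_comm hs hB'
        ((hasCompactSupport_hermF_cut α n).comp_left (g := Complex.ofReal) rfl)]
      congr 1; ext v
      congr 1
      exact collisionOp_clm_comp _ Complex.ofRealCLM (contDiff_hermF_cut α n)
        (integrable_hermF_cut α n) v
    simp_rw [e] at h1
    have h3 := tendsto_nhds_unique h1 h2
    rw [integral_mul_hermF_gamma] at h3
    rw [h3, ← integral_mul_hermF_gamma, ← integral_const_mul]
    congr 1; ext v; push_cast; ring
  | bgk =>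
    have h0 : ∫ w, F w = coef 0 F := by simp [coef, hermP_zero]
    have i1 := integrable_hermP_mul α (MemLp.integrable_exp_smul hF)
    have e : ∀ v, (hermP α v : ℂ) * collisionOp Collision.bgk F v
        = (hermF α v : ℂ) * coef 0 F - (hermP α v : ℂ) * F v := fun v => by
      simp only [collisionOp, h0, hermF_eq, Complex.real_smul]; push_cast; ring
    have i0 : Integrable fun v : Space d => (hermF α v : ℂ) * coef 0 F :=
      (integrable_hermF α).ofReal.mul_const _
    rw [coef]
    simp_rw [e]
    rw [integral_sub i0 i1, integral_mul_const,
      integral_complex_ofReal, integral_hermF, ← coef, decay]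
    by_cases h : α = 0
    · simp [h]
    · simp [h]

end Cutoff

/-! ### The functionals in terms of Hermite coefficients -/

section Functionals

variable {d : ℕ}

theorem integral_eq_coef_zero (F : Space d → ℂ) : ∫ v, F v = coef 0 F := by
  simp [coef, hermP_zero]

theorem integral_inner_mul_eq_ladder {F : Space d → ℂ}
    (hF : ∀ c : ℝ, Integrable fun v => Real.exp (c * ‖v‖) • F v) (ξ : Space d) :
    ∫ w, ((⟪ξ, w⟫_ℝ : ℝ) : ℂ) * F w = ladder ξ (fun α => coef α F) 0 := by
  rw [← coef_inner_mul hF, ← integral_eq_coef_zero]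
  simp_rw [real_inner_comm]

theorem ip_mul_maxwellian (z : ℂ) (F : Space d → ℂ) :
    ip (fun v => z * (maxwellian d v : ℂ)) F = z * (starRingEnd ℂ) (coef 0 F) := by
  rw [ip, integral_gamma, ← integral_eq_coef_zero, ← integral_conj, ← integral_const_mul]
  congr 1; ext v
  have h : (maxwellian d v : ℂ) ≠ 0 := by exact_mod_cast (maxwellian_pos v).ne'
  rw [Complex.real_smul, Complex.ofReal_inv]
  field_simp

theorem opA_eq {F : Space d → ℂ}
    (hF : ∀ c : ℝ, Integrable fun v => Real.exp (c * ‖v‖) • F v) (ξ : Space d) :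
    opA ξ F = fun v => (-(Complex.I / (1 + (‖ξ‖ : ℂ) ^ 2)) * ladder ξ (fun α => coef α F) 0)
      * (maxwellian d v : ℂ) := by
  ext v
  rw [opA, integral_inner_mul_eq_ladder hF]

theorem ladder_sub (ξ : Space d) (b c : (Fin d → ℕ) → ℂ) (α : Fin d → ℕ) :
    ladder ξ (fun β => b β - c β) α = ladder ξ b α - ladder ξ c α := by
  rw [ladder, ladder, ladder, ← Finset.sum_sub_distrib]
  exact Finset.sum_congr rfl fun i _ => by ring

theorem ladder_const_mul (ξ : Space d) (z : ℂ) (c : (Fin d → ℕ) → ℂ) (α : Fin d → ℕ) :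
    ladder ξ (fun β => z * c β) α = z * ladder ξ c α := by
  rw [ladder, ladder, Finset.mul_sum]
  exact Finset.sum_congr rfl fun i _ => by ring

theorem ladder_zero (ξ : Space d) (c : (Fin d → ℕ) → ℂ) :
    ladder ξ c 0 = ∑ i, (ξ i : ℂ) * c (up 0 i) := by
  simp [ladder]

theorem coef_sub {F H : Space d → ℂ}
    (hF : ∀ c : ℝ, Integrable fun v => Real.exp (c * ‖v‖) • F v)
    (hH : ∀ c : ℝ, Integrable fun v => Real.exp (c * ‖v‖) • H v) (α : Fin d → ℕ) :
    coef α (F - H) = coef α F - coef α H := by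
  rw [coef, coef, coef, ← integral_sub (integrable_hermP_mul α hF) (integrable_hermP_mul α hH)]
  simp_rw [Pi.sub_apply, mul_sub]

theorem coef_const_mul (z : ℂ) (F : Space d → ℂ) (α : Fin d → ℕ) :
    coef α (fun v => z * F v) = z * coef α F := by
  rw [coef, coef, ← integral_const_mul]
  congr 1; ext v; ring

theorem transportMode_eq (ξ : Space d) (F : Space d → ℂ) :
    transportMode ξ F = fun v => Complex.I * (((⟪v, ξ⟫_ℝ : ℝ) : ℂ) * F v) := by
  ext v; rw [transportMode, mul_assoc]

theorem expIntegrable_const_mul {F : Space d → ℂ}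
    (hF : ∀ c : ℝ, Integrable fun v => Real.exp (c * ‖v‖) • F v) (z : ℂ) (c : ℝ) :
    Integrable fun v => Real.exp (c * ‖v‖) • (z * F v) :=
  ((hF c).const_mul z).congr (ae_of_all _ fun v => by
    simp only [Complex.real_smul]; ring)

theorem expIntegrable_transportMode {F : Space d → ℂ}
    (hF : ∀ c : ℝ, Integrable fun v => Real.exp (c * ‖v‖) • F v) (ξ : Space d) (c : ℝ) :
    Integrable fun v => Real.exp (c * ‖v‖) • transportMode ξ F v := by
  rw [transportMode_eq]
  exact expIntegrable_const_mul (integrable_exp_smul_apply_mul hF ξ) _ c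

theorem ladder_coef_transportMode {F : Space d → ℂ}
    (hF : ∀ c : ℝ, Integrable fun v => Real.exp (c * ‖v‖) • F v) (ξ : Space d) :
    ladder ξ (fun α => coef α (transportMode ξ F)) 0
      = Complex.I * ladder ξ (ladder ξ fun α => coef α F) 0 := by
  rw [transportMode_eq]
  simp_rw [coef_const_mul, coef_inner_mul hF]
  rw [ladder_const_mul]

theorem memLp_proj (F : Space d → ℂ) : MemLp (proj F) 2 (gammaMeasure d) := by
  have h : MemLp (fun v => (maxwellian d v : ℂ)) 2 (gammaMeasure d) := memLp_maxwellian.ofReal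
  exact h.mul_const _

/-- `1 + |ξ|²`. -/
def jap (ξ : Space d) : ℝ := 1 + ‖ξ‖ ^ 2

theorem jap_pos (ξ : Space d) : 0 < jap ξ := by unfold jap; positivity

theorem jap_cast (ξ : Space d) : (1 + (‖ξ‖ : ℂ) ^ 2) = (jap ξ : ℂ) := by simp [jap]

/-- The entropy as a function of the coefficients. -/
def entropyC (ξ : Space d) (δ q : ℝ) (c : (Fin d → ℕ) → ℂ) : ℝ :=
  q / 2 + δ / jap ξ * (-Complex.I * ladder ξ c 0 * (starRingEnd ℂ) (c 0)).re

/-- The part of the entropy production which is due to the twist. -/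
def twistC (ξ : Space d) (c : (Fin d → ℕ) → ℂ) : ℝ :=
  (ladder ξ (ladder ξ c) 0 * (starRingEnd ℂ) (c 0)).re - ‖ladder ξ c 0‖ ^ 2
    - (Complex.I * ladder ξ c 0 * (starRingEnd ℂ) (c 0)).re

theorem entropyH_eq {F : Space d → ℂ} (hF : MemLp F 2 (gammaMeasure d)) (ξ : Space d) (δ : ℝ) :
    entropyH ξ δ F = entropyC ξ δ (sqNorm F) fun α => coef α F := by
  rw [entropyH, entropyC, opA_eq (MemLp.integrable_exp_smul hF), ip_mul_maxwellian, jap_cast,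
    div_mul_eq_mul_div, mul_div_assoc]
  congr 2
  rw [show -(Complex.I / (jap ξ : ℂ)) * ladder ξ (fun α => coef α F) 0
      * (starRingEnd ℂ) (coef 0 F)
    = (-Complex.I * ladder ξ (fun α => coef α F) 0 * (starRingEnd ℂ) (coef 0 F)) / (jap ξ : ℂ) by
      ring, Complex.div_ofReal_re]

theorem ip_opA_transportMode {F H : Space d → ℂ}
    (hF : ∀ c : ℝ, Integrable fun v => Real.exp (c * ‖v‖) • F v) (ξ : Space d) :
    (ip (opA ξ (transportMode ξ F)) H).re
      = (ladder ξ (ladder ξ fun α => coef α F) 0 * (starRingEnd ℂ) (coef 0 H)).re / jap ξ := by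
  rw [opA_eq (expIntegrable_transportMode hF ξ), ip_mul_maxwellian, ladder_coef_transportMode hF,
    jap_cast, ← Complex.div_ofReal_re]
  congr 1
  linear_combination (-ladder ξ (ladder ξ fun α => coef α F) 0
    * (starRingEnd ℂ) (coef 0 H) / (jap ξ : ℂ)) * Complex.I_mul_I

theorem ip_transportMode_opA {F : Space d → ℂ} (hF : MemLp F 2 (gammaMeasure d)) (ξ : Space d) :
    (ip (transportMode ξ (opA ξ F)) F).re = ‖ladder ξ (fun α => coef α F) 0‖ ^ 2 / jap ξ := by
  have hFe := MemLp.integrable_exp_smul hF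
  set m := ladder ξ (fun α => coef α F) 0 with hm
  have h1 : ip (transportMode ξ (opA ξ F)) F
      = Complex.I * (-(Complex.I / (jap ξ : ℂ)) * m) * (starRingEnd ℂ) m := by
    rw [ip, integral_gamma, hm, ← integral_inner_mul_eq_ladder hFe, ← integral_conj,
      ← integral_const_mul]
    congr 1; ext v
    have h : (maxwellian d v : ℂ) ≠ 0 := by exact_mod_cast (maxwellian_pos v).ne'
    rw [opA_eq hFe, transportMode, jap_cast, integral_inner_mul_eq_ladder hFe,
      Complex.real_smul, Complex.ofReal_inv, map_mul, Complex.conj_ofReal, real_inner_comm ξ v]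
    field_simp
  rw [h1, show Complex.I * (-(Complex.I / (jap ξ : ℂ)) * m) * (starRingEnd ℂ) m
    = ((‖m‖ ^ 2 : ℝ) : ℂ) / (jap ξ : ℂ) by
      rw [← Complex.normSq_eq_norm_sq, ← Complex.mul_conj]
      linear_combination (-m * (starRingEnd ℂ) m / (jap ξ : ℂ)) * Complex.I_mul_I,
    Complex.div_ofReal_re, Complex.ofReal_re]

theorem ip_opA_collisionOp {op : Collision} {ξ : Space d} {F : Space d → ℂ}
    (hF : Admissible op ξ F) : (ip (opA ξ (collisionOp op F)) F).re
      = (Complex.I * ladder ξ (fun α => coef α F) 0 * (starRingEnd ℂ) (coef 0 F)).re / jap ξ := by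
  rw [opA_eq (MemLp.integrable_exp_smul hF.collision_memLp), ip_mul_maxwellian, jap_cast,
    ← Complex.div_ofReal_re, ladder_zero, ladder_zero]
  simp_rw [coef_collisionOp op hF.smooth hF.memLp hF.collision_memLp, decay_up_zero]
  rw [show ∑ i, (ξ i : ℂ) * (-((1 : ℝ) : ℂ) * coef (up 0 i) F)
    = -∑ i, (ξ i : ℂ) * coef (up 0 i) F by
      rw [← Finset.sum_neg_distrib]; exact Finset.sum_congr rfl fun i _ => by push_cast; ring]
  congr 1; ring

/-- The two terms containing `AT` recombine to `AT F`, so the projection drops out. The term in `AL`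
needs only the eigenvalue of `L` in degree one. -/
theorem productionD_eq {op : Collision} {ξ : Space d} {F : Space d → ℂ}
    (hF : Admissible op ξ F) (δ : ℝ) : productionD op ξ δ F
      = -(ip (collisionOp op F) F).re + δ / jap ξ * twistC ξ fun α => coef α F := by
  have hFe := MemLp.integrable_exp_smul hF.memLp
  have hPe := MemLp.integrable_exp_smul (memLp_proj F)
  have hFP := MemLp.integrable_exp_smul (hF.memLp.sub (memLp_proj F))
  rw [productionD, ip_opA_transportMode hPe, ip_opA_transportMode hFP,
    ip_transportMode_opA hF.memLp, ip_opA_collisionOp hF, twistC]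
  simp_rw [coef_sub hFe hPe]
  rw [show (ladder ξ fun α => coef α F - coef α (proj F))
    = fun α => ladder ξ (fun α => coef α F) α - ladder ξ (fun α => coef α (proj F)) α from
      funext fun α => ladder_sub _ _ _ _, ladder_sub, sub_mul, Complex.sub_re]
  ring

theorem hasSum_decay_mul {op : Collision} {ξ : Space d} {F : Space d → ℂ}
    (hF : Admissible op ξ F) :
    HasSum (fun α => decay op α * ‖coef α F‖ ^ 2) (-(ip (collisionOp op F) F).re) := by
  have h := (Complex.hasSum_re (hasSum_coef_mul_conj hF.collision_memLp hF.memLp)).neg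
  have e : (fun α => decay op α * ‖coef α F‖ ^ 2)
      = fun α => -(coef α (collisionOp op F) * (starRingEnd ℂ) (coef α F)).re := funext fun α => by
    rw [coef_collisionOp op hF.smooth hF.memLp hF.collision_memLp, mul_assoc, Complex.mul_conj,
      Complex.normSq_eq_norm_sq, ← Complex.ofReal_neg, ← Complex.ofReal_mul, Complex.ofReal_re]
    ring
  rw [e]
  exact h

/-! ### Finite combinations of Hermite functions -/

/-- The function with Hermite coefficients `c` on `S` and zero elsewhere. -/
def trial (S : Finset (Fin d → ℕ)) (c : (Fin d → ℕ) → ℂ) (v : Space d) : ℂ :=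
  ∑ α ∈ S, c α * (hermF α v : ℂ)

theorem contDiff_const_mul_hermF (z : ℂ) (α : Fin d → ℕ) :
    ContDiff ℝ ∞ fun v : Space d => z * (hermF α v : ℂ) :=
  contDiff_const.mul (Complex.ofRealCLM.contDiff.comp (contDiff_hermF α))

theorem integrable_const_mul_hermF (z : ℂ) (α : Fin d → ℕ) :
    Integrable fun v : Space d => z * (hermF α v : ℂ) := by
  have h : Integrable fun v : Space d => (hermF α v : ℂ) := (integrable_hermF α).ofReal
  exact h.const_mul z

theorem memLp_trial (S : Finset (Fin d → ℕ)) (c : (Fin d → ℕ) → ℂ) :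
    MemLp (trial S c) 2 (gammaMeasure d) :=
  memLp_finsetSum S fun α _ => (memLp_hermF_complex α).const_mul (c α)

theorem collisionOp_trial (op : Collision) (S : Finset (Fin d → ℕ)) (c : (Fin d → ℕ) → ℂ) :
    collisionOp op (trial S c) = trial S fun α => -decay op α * c α := by
  ext v
  rw [show trial S c = fun v => ∑ α ∈ S, c α * (hermF α v : ℂ) from rfl,
    collisionOp_sum op S (fun α => contDiff_const_mul_hermF (c α) α)
      (fun α => integrable_const_mul_hermF (c α) α), trial]
  refine Finset.sum_congr rfl fun α _ => ?_
  have h := collisionOp_clm_comp op ((ContinuousLinearMap.mul ℝ ℂ (c α)).comp Complex.ofRealCLM)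
    (contDiff_hermF α) (integrable_hermF α) v
  simp only [ContinuousLinearMap.comp_apply, Complex.ofRealCLM_apply,
    ContinuousLinearMap.mul_apply'] at h
  rw [h, collisionOp_hermF]
  push_cast; ring

theorem memLp_inner_mul_hermF (ξ : Space d) (α : Fin d → ℕ) :
    MemLp (fun v => ⟪v, ξ⟫_ℝ * hermF α v) 2 (gammaMeasure d) := by
  simp_rw [inner_mul_hermF]
  exact memLp_finsetSum _ fun i _ => (((memLp_hermF _).const_mul _).add
    ((memLp_hermF _).const_mul _)).const_mul _

theorem admissible_trial (op : Collision) (ξ : Space d) (S : Finset (Fin d → ℕ))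
    (c : (Fin d → ℕ) → ℂ) : Admissible op ξ (trial S c) where
  smooth := ContDiff.sum fun α _ => contDiff_const_mul_hermF (c α) α
  memLp := memLp_trial S c
  collision_memLp := by rw [collisionOp_trial]; exact memLp_trial _ _
  transport_memLp := by
    have e : transportMode ξ (trial S c) = fun v => ∑ α ∈ S, (Complex.I * c α)
        * ((⟪v, ξ⟫_ℝ * hermF α v : ℝ) : ℂ) := funext fun v => by
      rw [transportMode, trial, Finset.mul_sum]
      exact Finset.sum_congr rfl fun α _ => by push_cast; ring
    rw [e]
    refine memLp_finsetSum S fun α _ => MemLp.const_mul ?_ _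
    exact (memLp_inner_mul_hermF ξ α).ofReal

theorem coef_trial (S : Finset (Fin d → ℕ)) (c : (Fin d → ℕ) → ℂ) (β : Fin d → ℕ) :
    coef β (trial S c) = if β ∈ S then c β else 0 := by
  have hi : ∀ α, Integrable fun v => (hermP β v : ℂ) * (c α * (hermF α v : ℂ)) := fun α =>
    integrable_hermP_mul β (MemLp.integrable_exp_smul ((memLp_hermF_complex α).const_mul (c α)))
  rw [coef]
  simp_rw [trial, Finset.mul_sum]
  rw [integral_finsetSum _ fun α _ => hi α]
  have e : ∀ α, ∫ v, (hermP β v : ℂ) * (c α * (hermF α v : ℂ)) = c α * if β = α then 1 else 0 :=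
    fun α => by rw [← coef_hermF, ← coef_const_mul]; rfl
  simp_rw [e]
  simp

theorem sqNorm_trial (S : Finset (Fin d → ℕ)) (c : (Fin d → ℕ) → ℂ) :
    sqNorm (trial S c) = ∑ α ∈ S, ‖c α‖ ^ 2 := by
  refine (hasSum_norm_sq_coef (memLp_trial S c)).unique ?_
  have h : HasSum _ _ := hasSum_sum_of_ne_finset_zero (f := fun α => ‖coef α (trial S c)‖ ^ 2)
    (s := S) fun α hα => by rw [coef_trial, if_neg hα]; simp
  rwa [Finset.sum_congr rfl fun α hα => by rw [coef_trial, if_pos hα]] at h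

theorem ip_collisionOp_trial (op : Collision) (S : Finset (Fin d → ℕ)) (c : (Fin d → ℕ) → ℂ) :
    -(ip (collisionOp op (trial S c)) (trial S c)).re = ∑ α ∈ S, decay op α * ‖c α‖ ^ 2 := by
  -- The frequency matters only for admissibility, so zero serves.
  refine (hasSum_decay_mul (admissible_trial op 0 S c)).unique ?_
  have h : HasSum _ _ := hasSum_sum_of_ne_finset_zero
    (f := fun α => decay op α * ‖coef α (trial S c)‖ ^ 2)
    (s := S) fun α hα => by rw [coef_trial, if_neg hα]; simp
  rwa [Finset.sum_congr rfl fun α hα => by rw [coef_trial, if_pos hα]] at h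

/-! ### Bounds on the moments -/

theorem sum_norm_sq_le {c : (Fin d → ℕ) → ℂ} {q : ℝ} (h : HasSum (fun α => ‖c α‖ ^ 2) q)
    (S : Finset (Fin d → ℕ)) (hS : 0 ∉ S) : ∑ α ∈ S, ‖c α‖ ^ 2 ≤ q - ‖c 0‖ ^ 2 := by
  classical
  have := sum_le_hasSum (insert 0 S) (fun α _ => by positivity) h
  rw [Finset.sum_insert hS] at this
  linarith

theorem norm_sq_eq_sum (ξ : Space d) : ‖ξ‖ ^ 2 = ∑ i, ξ i ^ 2 := by
  rw [EuclideanSpace.norm_sq_eq]; simp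

theorem norm_sum_mul_sq_le {ι : Type*} (s : Finset ι) (a : ι → ℝ) (z : ι → ℂ) :
    ‖∑ i ∈ s, (a i : ℂ) * z i‖ ^ 2 ≤ (∑ i ∈ s, a i ^ 2) * ∑ i ∈ s, ‖z i‖ ^ 2 := by
  have h1 : ‖∑ i ∈ s, (a i : ℂ) * z i‖ ≤ ∑ i ∈ s, |a i| * ‖z i‖ :=
    (norm_sum_le _ _).trans (le_of_eq (by simp))
  calc _ ≤ (∑ i ∈ s, |a i| * ‖z i‖) ^ 2 := by gcongr
    _ ≤ _ := by simpa using Finset.sum_mul_sq_le_sq_mul_sq s (fun i => |a i|) fun i => ‖z i‖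

theorem up_zero_injective : Function.Injective fun i : Fin d => up 0 i := fun i k h => by
  by_contra hne
  have := congrFun h i
  simp only [up_self, up_ne _ hne] at this
  simp at this

/-- Cauchy-Schwarz over the degree-one indices, whose total mass is at most that of all nonzero
indices, i.e. `‖(1 - Π)F‖²`. -/
theorem norm_ladder_zero_sq_le {c : (Fin d → ℕ) → ℂ} {q : ℝ}
    (h : HasSum (fun α => ‖c α‖ ^ 2) q) (ξ : Space d) :
    ‖ladder ξ c 0‖ ^ 2 ≤ ‖ξ‖ ^ 2 * (q - ‖c 0‖ ^ 2) := by
  rw [ladder_zero]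
  refine (norm_sum_mul_sq_le _ _ _).trans ?_
  rw [norm_sq_eq_sum]
  refine mul_le_mul_of_nonneg_left ?_ (Finset.sum_nonneg fun i _ => sq_nonneg _)
  have h1 := sum_norm_sq_le h (Finset.univ.image fun i => up 0 i) (by
    simp only [Finset.mem_image, Finset.mem_univ, true_and, not_exists]
    exact fun i => up_zero_ne i)
  rwa [Finset.sum_image fun i _ k _ hik => up_zero_injective hik] at h1

theorem down_up (α : Fin d → ℕ) (i : Fin d) : down (up α i) i = α := by simp [up, down]

/-- From degree one, the second step either returns to degree zero, which forces the same coordinate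
and gives `‖ξ‖²`, or climbs to degree two. -/
theorem ladder_ladder_zero (ξ : Space d) (c : (Fin d → ℕ) → ℂ) :
    ladder ξ (ladder ξ c) 0 = (‖ξ‖ ^ 2 : ℝ) * c 0
      + ∑ i, ∑ k, ((ξ i * ξ k : ℝ) : ℂ) * ((√((up 0 i) k + 1) : ℝ) * c (up (up 0 i) k)) := by
  rw [ladder_zero, norm_sq_eq_sum, Complex.ofReal_sum, Finset.sum_mul, ← Finset.sum_add_distrib]
  refine Finset.sum_congr rfl fun i _ => ?_
  rw [ladder]
  simp_rw [mul_add]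
  rw [Finset.sum_add_distrib, mul_add, add_comm]
  congr 1
  · rw [Finset.sum_eq_single i, up_self, down_up]
    · simp; ring
    · intro k _ hk
      rw [up_ne _ hk]; simp
    · simp
  · rw [Finset.mul_sum]
    refine Finset.sum_congr rfl fun k _ => ?_
    push_cast; ring

theorem sum_up (α : Fin d → ℕ) (i : Fin d) : ∑ k, up α i k = ∑ k, α k + 1 := by
  simp [up, Finset.sum_add_distrib]

/-- After Cauchy-Schwarz over the pairs `(i, k)`, an index `α` of degree two is weighted by its
entries `α k`. Their sum over `k` is the degree, and this is the origin of the factor 2. -/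
theorem norm_ladder_ladder_sub_sq_le {c : (Fin d → ℕ) → ℂ} {q : ℝ}
    (h : HasSum (fun α => ‖c α‖ ^ 2) q) (ξ : Space d) :
    ‖ladder ξ (ladder ξ c) 0 - (‖ξ‖ ^ 2 : ℝ) * c 0‖ ^ 2 ≤ ‖ξ‖ ^ 4 * (2 * (q - ‖c 0‖ ^ 2)) := by
  rw [ladder_ladder_zero, add_sub_cancel_left, ← Finset.sum_product']
  refine (norm_sum_mul_sq_le (Finset.univ ×ˢ Finset.univ) (fun p : Fin d × Fin d => ξ p.1 * ξ p.2)
    (fun p => (√((up 0 p.1) p.2 + 1) : ℝ) * c (up (up 0 p.1) p.2))).trans ?_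
  have e1 : ∑ p ∈ (Finset.univ : Finset (Fin d)) ×ˢ (Finset.univ : Finset (Fin d)),
      (ξ p.1 * ξ p.2) ^ 2 = ‖ξ‖ ^ 4 := by
    rw [show ‖ξ‖ ^ 4 = ‖ξ‖ ^ 2 * ‖ξ‖ ^ 2 by ring, norm_sq_eq_sum, Finset.sum_mul_sum,
      Finset.sum_product]
    simp_rw [mul_pow]
  rw [e1]
  refine mul_le_mul_of_nonneg_left ?_ (by positivity)
  set S := Finset.piAntidiag (Finset.univ : Finset (Fin d)) 2 with hS
  have e2 : ∀ i k : Fin d, ‖(√((up 0 i) k + 1) : ℝ) * c (up (up 0 i) k)‖ ^ 2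
      = (up (up 0 i) k k : ℝ) * ‖c (up (up 0 i) k)‖ ^ 2 := fun i k => by
    rw [norm_mul, mul_pow, Complex.norm_real, Real.norm_eq_abs, sq_abs,
      Real.sq_sqrt (by positivity), up_self _ k]
    push_cast; ring
  rw [Finset.sum_product_right]
  simp_rw [e2]
  calc ∑ k, ∑ i, (up (up 0 i) k k : ℝ) * ‖c (up (up 0 i) k)‖ ^ 2
      ≤ ∑ k, ∑ α ∈ S, (α k : ℝ) * ‖c α‖ ^ 2 := by
        refine Finset.sum_le_sum fun k _ => ?_
        rw [← Finset.sum_image (f := fun α : Fin d → ℕ => (α k : ℝ) * ‖c α‖ ^ 2)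
          (g := fun i => up (up 0 i) k) (s := Finset.univ)
          fun i _ j _ hij => up_zero_injective (up_injective k hij)]
        refine Finset.sum_le_sum_of_subset_of_nonneg ?_ fun _ _ _ => by positivity
        intro α hα
        obtain ⟨i, -, rfl⟩ := Finset.mem_image.1 hα
        simp [hS, Finset.mem_piAntidiag, sum_up]
    _ = ∑ α ∈ S, 2 * ‖c α‖ ^ 2 := by
        rw [Finset.sum_comm]
        refine Finset.sum_congr rfl fun α hα => ?_
        rw [← Finset.sum_mul]
        have h2 := (Finset.mem_piAntidiag.1 hα).1
        congr 1
        exact_mod_cast h2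
    _ ≤ 2 * (q - ‖c 0‖ ^ 2) := by
        rw [← Finset.mul_sum]
        refine mul_le_mul_of_nonneg_left (sum_norm_sq_le h S fun h0 => ?_) two_pos.le
        simpa using (Finset.mem_piAntidiag.1 h0).1

end Functionals

/-! ### Bounds on the modal rates -/

section Rates

variable {d : ℕ}

/-- Microscopic coercivity: Parseval together with the spectral gap. -/
theorem neg_re_ip_collisionOp_ge {op : Collision} {ξ : Space d} {F : Space d → ℂ}
    (hF : Admissible op ξ F) :
    sqNorm F - ‖coef 0 F‖ ^ 2 ≤ -(ip (collisionOp op F) F).re := by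
  classical
  have h1 := (hasSum_norm_sq_coef hF.memLp).sub (hasSum_ite_eq (0 : Fin d → ℕ) (‖coef 0 F‖ ^ 2))
  refine hasSum_le (fun α => ?_) h1 (hasSum_decay_mul hF)
  by_cases h : α = 0
  · simp [h, decay_zero]
  · rw [if_neg h, sub_zero]
    exact le_mul_of_one_le_left (by positivity) (one_le_decay op h)

theorem norm_ladder_zero_le {c : (Fin d → ℕ) → ℂ} {q : ℝ}
    (h : HasSum (fun α => ‖c α‖ ^ 2) q) (ξ : Space d) :
    ‖ladder ξ c 0‖ ≤ ‖ξ‖ * √(q - ‖c 0‖ ^ 2) := by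
  rw [← Real.sqrt_sq (norm_nonneg ξ), ← Real.sqrt_mul (sq_nonneg _)]
  exact Real.le_sqrt_of_sq_le (norm_ladder_zero_sq_le h ξ)

/-- Macroscopic coercivity: `ATΠ` produces `‖ξ‖²‖c 0‖²`. The three error terms, from `AT(1 - Π)`,
`TA` and `AL`, involve the degrees one and two only and are bounded through `X`. -/
theorem twistC_ge {c : (Fin d → ℕ) → ℂ} {q : ℝ} (h : HasSum (fun α => ‖c α‖ ^ 2) q)
    (ξ : Space d) {X : ℝ} (hX : X = √(q - ‖c 0‖ ^ 2)) :
    ‖ξ‖ ^ 2 * ‖c 0‖ ^ 2 - ‖ξ‖ ^ 2 * √2 * X * ‖c 0‖ - ‖ξ‖ ^ 2 * X ^ 2 - ‖ξ‖ * X * ‖c 0‖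
      ≤ twistC ξ c := by
  have hq : 0 ≤ q - ‖c 0‖ ^ 2 := by simpa using sum_norm_sq_le h ∅ (by simp)
  have h1 := norm_ladder_zero_sq_le h ξ
  have h1' := norm_ladder_zero_le h ξ
  have h2 : ‖ladder ξ (ladder ξ c) 0 - (‖ξ‖ ^ 2 : ℝ) * c 0‖ ≤ ‖ξ‖ ^ 2 * √2 * X := by
    refine (le_abs_self _).trans (abs_le_of_sq_le_sq ?_ (by rw [hX]; positivity))
    refine (norm_ladder_ladder_sub_sq_le h ξ).trans (le_of_eq ?_)
    rw [mul_pow, mul_pow, Real.sq_sqrt two_pos.le, hX, Real.sq_sqrt hq]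
    ring
  have hX2 : X ^ 2 = q - ‖c 0‖ ^ 2 := by rw [hX, Real.sq_sqrt hq]
  rw [← hX] at h1'
  rw [← hX2] at h1
  rw [twistC]
  have h3 : ‖ξ‖ ^ 2 * ‖c 0‖ ^ 2 - ‖ξ‖ ^ 2 * √2 * X * ‖c 0‖
      ≤ (ladder ξ (ladder ξ c) 0 * (starRingEnd ℂ) (c 0)).re := by
    have e : (ladder ξ (ladder ξ c) 0 * (starRingEnd ℂ) (c 0)).re = ‖ξ‖ ^ 2 * ‖c 0‖ ^ 2
        + ((ladder ξ (ladder ξ c) 0 - (‖ξ‖ ^ 2 : ℝ) * c 0) * (starRingEnd ℂ) (c 0)).re := by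
      rw [sub_mul, mul_assoc, Complex.mul_conj, Complex.normSq_eq_norm_sq, Complex.sub_re,
        ← Complex.ofReal_mul, Complex.ofReal_re]
      ring
    have h4 := (abs_le.1 (Complex.abs_re_le_norm
      ((ladder ξ (ladder ξ c) 0 - (‖ξ‖ ^ 2 : ℝ) * c 0) * (starRingEnd ℂ) (c 0)))).1
    rw [norm_mul, RCLike.norm_conj] at h4
    have h5 := mul_le_mul_of_nonneg_right h2 (norm_nonneg (c 0))
    linarith
  have h6 : (Complex.I * ladder ξ c 0 * (starRingEnd ℂ) (c 0)).re ≤ ‖ξ‖ * X * ‖c 0‖ := by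
    refine (Complex.re_le_norm _).trans ?_
    rw [norm_mul, norm_mul, Complex.norm_I, one_mul, RCLike.norm_conj]
    exact mul_le_mul_of_nonneg_right h1' (norm_nonneg _)
  linarith

theorem abs_entropyC_sub_le {c : (Fin d → ℕ) → ℂ} {q : ℝ} (h : HasSum (fun α => ‖c α‖ ^ 2) q)
    (ξ : Space d) {δ : ℝ} (hδ : 0 ≤ δ) : |entropyC ξ δ q c - q / 2|
      ≤ δ / jap ξ * (‖ξ‖ * √(q - ‖c 0‖ ^ 2) * ‖c 0‖) := by
  rw [entropyC, add_sub_cancel_left, abs_mul, abs_of_nonneg (div_nonneg hδ (jap_pos ξ).le)]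
  refine mul_le_mul_of_nonneg_left ((Complex.abs_re_le_norm _).trans ?_)
    (div_nonneg hδ (jap_pos ξ).le)
  rw [norm_mul, norm_mul, norm_neg, Complex.norm_I, one_mul, RCLike.norm_conj]
  exact mul_le_mul_of_nonneg_right (norm_ladder_zero_le h ξ) (norm_nonneg _)

/-- The quadratic form inequality behind the lower bound on the rate. -/
theorem rate_quadratic_form {X Y κ η r c : ℝ} (hX : 0 ≤ X) (hY : 0 ≤ Y) (hκ : 0.9999 ≤ κ)
    (hκ' : κ ≤ 1) (hη : 0 ≤ η) (hη' : η ≤ 0.01) (hr : 0 ≤ r) (hr' : r ≤ 1.4143)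
    (hc' : c ≤ 0.3455) :
    c * ((X ^ 2 + Y ^ 2) / 2 + 0.3 * η * X * Y)
      ≤ X ^ 2 + 0.3 * (κ * Y ^ 2 - κ * r * X * Y - κ * X ^ 2 - η * X * Y) := by
  have hXY : 0 ≤ X * Y := mul_nonneg hX hY
  have h1 : c * X ^ 2 ≤ 0.3455 * X ^ 2 := by gcongr
  have h2 : c * Y ^ 2 ≤ 0.3455 * Y ^ 2 := by gcongr
  have h3 : c * η * (X * Y) ≤ 0.3455 * 0.01 * (X * Y) := by gcongr
  have h4 : κ * r * (X * Y) ≤ 1 * 1.4143 * (X * Y) := by gcongr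
  have h5 : κ * X ^ 2 ≤ 1 * X ^ 2 := by gcongr
  have h6 : 0.9999 * Y ^ 2 ≤ κ * Y ^ 2 := by gcongr
  have h7 : η * (X * Y) ≤ 0.01 * (X * Y) := by gcongr
  -- In the worst case the difference is about `0.527 X² - 0.428 XY + 0.127 Y²`, which already
  -- dominates `0.107 (2X - Y)²`.
  nlinarith [sq_nonneg (2 * X - Y), sq_nonneg (X - Y)]

theorem rate_const_bounds : 0 ≤ 1 - √(3 / 7 : ℝ) ∧ 1 - √(3 / 7 : ℝ) ≤ 0.3455 ∧
    0 < 1 - √(3 / 7 : ℝ) := by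
  have h1 : √(3 / 7 : ℝ) < 1 := by
    rw [Real.sqrt_lt' one_pos]; norm_num
  have h2 : (0.6545 : ℝ) ≤ √(3 / 7) := by
    apply Real.le_sqrt_of_sq_le; norm_num
  exact ⟨by linarith, by linarith, by linarith⟩

/-- For `‖ξ‖ ≥ 100` the ratio `κ = ‖ξ‖²/(1 + ‖ξ‖²)` is at least 0.9999 and `η = ‖ξ‖/(1 + ‖ξ‖²)` is
at most 0.01, so the quadratic form inequality applies with the same `δ = 0.3` at all such
frequencies. -/
theorem rate_lower_bound {op : Collision} {ξ : Space d} (hξ : 100 ≤ ‖ξ‖) {F : Space d → ℂ}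
    (hF : Admissible op ξ F) :
    (1 - √(3 / 7)) * entropyH ξ 0.3 F ≤ productionD op ξ 0.3 F := by
  have hsum := hasSum_norm_sq_coef hF.memLp
  have hP := neg_re_ip_collisionOp_ge hF
  rw [entropyH_eq hF.memLp, productionD_eq hF]
  set c : (Fin d → ℕ) → ℂ := fun α => coef α F
  set q := sqNorm F
  have hq : 0 ≤ q - ‖c 0‖ ^ 2 := by simpa using sum_norm_sq_le hsum ∅ (by simp)
  obtain ⟨X, hX⟩ : ∃ X, X = √(q - ‖c 0‖ ^ 2) := ⟨_, rfl⟩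
  have hX0 : 0 ≤ X := hX ▸ Real.sqrt_nonneg _
  have hX2 : X ^ 2 = q - ‖c 0‖ ^ 2 := by rw [hX, Real.sq_sqrt hq]
  have ht := twistC_ge hsum ξ hX
  have he := (abs_le.1 (abs_entropyC_sub_le hsum ξ (δ := 0.3) (by norm_num))).2
  rw [← hX] at he
  have hj := jap_pos ξ
  have hj' : jap ξ = 1 + ‖ξ‖ ^ 2 := rfl
  obtain ⟨b0, b1, -⟩ := rate_const_bounds
  have hs : ‖ξ‖ ^ 2 ≥ 10000 := by nlinarith
  have hr : √2 ≤ (1.4143 : ℝ) := by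
    rw [Real.sqrt_le_left (by norm_num)]; norm_num
  have key := rate_quadratic_form (X := X) (Y := ‖c 0‖) (κ := ‖ξ‖ ^ 2 / jap ξ) (η := ‖ξ‖ / jap ξ)
    (r := √2) (c := 1 - √(3 / 7)) hX0 (norm_nonneg _)
    (by rw [le_div_iff₀ hj, hj']; linarith) (by rw [div_le_one hj, hj']; linarith)
    (by positivity) (by rw [div_le_iff₀ hj, hj']; nlinarith) (Real.sqrt_nonneg _) hr b1
  have e1 : 0.3 * (‖ξ‖ ^ 2 / jap ξ * ‖c 0‖ ^ 2 - ‖ξ‖ ^ 2 / jap ξ * √2 * X * ‖c 0‖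
      - ‖ξ‖ ^ 2 / jap ξ * X ^ 2 - ‖ξ‖ / jap ξ * X * ‖c 0‖) = 0.3 / jap ξ *
      (‖ξ‖ ^ 2 * ‖c 0‖ ^ 2 - ‖ξ‖ ^ 2 * √2 * X * ‖c 0‖ - ‖ξ‖ ^ 2 * X ^ 2 - ‖ξ‖ * X * ‖c 0‖) := by
    ring
  have e2 : 0.3 * (‖ξ‖ / jap ξ) * X * ‖c 0‖ = 0.3 / jap ξ * (‖ξ‖ * X * ‖c 0‖) := by ring
  rw [e1, e2, hX2] at key
  have h3 := mul_le_mul_of_nonneg_left ht (by positivity : 0 ≤ 0.3 / jap ξ)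
  have h4 := mul_le_mul_of_nonneg_left he b0
  rw [hX2] at h3
  have hP' : q - ‖c 0‖ ^ 2 ≤ -(ip (collisionOp op F) F).re := hP
  nlinarith

/-! ### Upper bounds on the rates, and the frequencies of small tori -/

theorem coef_zero_trial_up (i : Fin d) (z : ℂ) :
    coef 0 (trial {up 0 i} fun _ => z) = 0 := by
  rw [coef_trial, if_neg]
  simpa using (up_zero_ne i).symm

/-- Testing with one Hermite function of degree one. -/
theorem rate_upper_bound {op : Collision} {ξ : Space d} {lam δ : ℝ}
    (h : ∀ F : Space d → ℂ, Admissible op ξ F → lam * entropyH ξ δ F ≤ productionD op ξ δ F)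
    (i : Fin d) : lam / 2 ≤ 1 - δ / jap ξ * ξ i ^ 2 := by
  have h1 := h _ (admissible_trial op ξ {up 0 i} fun _ => 1)
  have h0 := coef_zero_trial_up i 1
  have hl : ladder ξ (fun α => coef α (trial {up 0 i} fun _ => 1)) 0 = ξ i := by
    rw [ladder_zero]
    simp_rw [coef_trial, Finset.mem_singleton, up_zero_injective.eq_iff]
    simp
  rw [entropyH_eq (memLp_trial _ _), productionD_eq (admissible_trial op ξ _ _),
    ip_collisionOp_trial, sqNorm_trial, entropyC, twistC, hl, h0, Finset.sum_singleton,
    Finset.sum_singleton, decay_up_zero] at h1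
  simp only [map_zero, mul_zero, Complex.zero_re, norm_one, one_pow, mul_one, Complex.norm_real,
    Real.norm_eq_abs, sq_abs, zero_sub, add_zero] at h1
  linarith

/-- Boundedness makes the supremum in `modalRate` a genuine one. A degree-one function decays at
rate 2 under collisions and the twist only lowers this; `d > 0` supplies a coordinate to test. -/
theorem bddAbove_rates (hd : 0 < d) (op : Collision) (ξ : Space d) :
    BddAbove {lam : ℝ | ∃ δ : ℝ, 0 < δ ∧
      ∀ F : Space d → ℂ, Admissible op ξ F → lam * entropyH ξ δ F ≤ productionD op ξ δ F} := by
  refine ⟨2, ?_⟩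
  rintro lam ⟨δ, hδ, h⟩
  have := rate_upper_bound h ⟨0, hd⟩
  have h2 : 0 ≤ δ / jap ξ * ξ ⟨0, hd⟩ ^ 2 :=
    mul_nonneg (div_nonneg hδ.le (jap_pos ξ).le) (sq_nonneg _)
  linarith

theorem nonempty_rates (op : Collision) {ξ : Space d} (hξ : 100 ≤ ‖ξ‖) :
    {lam : ℝ | ∃ δ : ℝ, 0 < δ ∧ ∀ F : Space d → ℂ, Admissible op ξ F →
      lam * entropyH ξ δ F ≤ productionD op ξ δ F}.Nonempty :=
  ⟨1 - √(3 / 7), 0.3, by norm_num, fun _ hF => rate_lower_bound hξ hF⟩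

theorem le_modalRate (hd : 0 < d) (op : Collision) {ξ : Space d} (hξ : 100 ≤ ‖ξ‖) :
    1 - √(3 / 7) ≤ modalRate op ξ :=
  le_csSup (bddAbove_rates hd op ξ) ⟨0.3, by norm_num, fun _ hF => rate_lower_bound hξ hF⟩

theorem modalRate_le (hd : 0 < d) (op : Collision) {ξ : Space d} (hξ : 100 ≤ ‖ξ‖) :
    modalRate op ξ ≤ 2 := by
  refine csSup_le (nonempty_rates op hξ) ?_
  rintro lam ⟨δ, hδ, h⟩
  have := rate_upper_bound h ⟨0, hd⟩
  have h2 : 0 ≤ δ / jap ξ * ξ ⟨0, hd⟩ ^ 2 :=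
    mul_nonneg (div_nonneg hδ.le (jap_pos ξ).le) (sq_nonneg _)
  linarith

theorem frequency_apply (L : ℝ) (j : Fin d → ℤ) (i : Fin d) :
    frequency L j i = 2 * Real.pi / L * j i := rfl

theorem norm_frequency_ge {L : ℝ} (hL : 0 < L) {j : Fin d → ℤ} (hj : j ≠ 0) :
    2 * Real.pi / L ≤ ‖frequency L j‖ := by
  obtain ⟨i, hi⟩ := Function.ne_iff.1 hj
  refine le_trans ?_ (abs_apply_le_norm _ i)
  rw [frequency_apply, abs_mul, abs_of_pos (by positivity)]
  refine le_mul_of_one_le_right (by positivity) ?_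
  have h : (1 : ℤ) ≤ |j i| := Int.one_le_abs hi
  rw [← Int.cast_abs]
  exact_mod_cast h

theorem hundred_le_norm_frequency {L : ℝ} (hL : 0 < L) (hL' : L ≤ 0.06) {j : Fin d → ℤ}
    (hj : j ≠ 0) : 100 ≤ ‖frequency L j‖ := by
  refine le_trans ?_ (norm_frequency_ge hL hj)
  rw [le_div_iff₀ hL]
  -- The threshold 0.06 comes from `2π > 6` and `6 / 0.06 = 100`.
  nlinarith [Real.pi_gt_three]

theorem nonempty_modes (hd : 0 < d) : Nonempty {j : Fin d → ℤ // j ≠ 0} :=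
  ⟨⟨fun _ => 1, fun h => one_ne_zero (congrFun h ⟨0, hd⟩)⟩⟩

theorem eventually_small (a : ℝ) (ha : 0 < a) : ∀ᶠ L : ℝ in 𝓝[>] 0, 0 < L ∧ L ≤ a := by
  filter_upwards [Ioc_mem_nhdsGT ha] with L hL using hL

theorem bddBelow_modalRate (hd : 0 < d) (op : Collision) {L : ℝ} (hL : 0 < L) (hL' : L ≤ 0.06) :
    BddBelow (Set.range fun j : {j : Fin d → ℤ // j ≠ 0} => modalRate op (frequency L j.1)) :=
  ⟨1 - √(3 / 7), by
    rintro _ ⟨j, rfl⟩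
    exact le_modalRate hd op (hundred_le_norm_frequency hL hL' j.2)⟩

theorem eventually_le_iInf (hd : 0 < d) (op : Collision) : ∀ᶠ L : ℝ in 𝓝[>] 0,
    1 - √(3 / 7) ≤ ⨅ j : {j : Fin d → ℤ // j ≠ 0}, modalRate op (frequency L j.1) := by
  have := nonempty_modes hd
  filter_upwards [eventually_small 0.06 (by norm_num)] with L hL
  exact le_ciInf fun j => le_modalRate hd op (hundred_le_norm_frequency hL.1 hL.2 j.2)

theorem eventually_iInf_le (hd : 0 < d) (op : Collision) : ∀ᶠ L : ℝ in 𝓝[>] 0,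
    ⨅ j : {j : Fin d → ℤ // j ≠ 0}, modalRate op (frequency L j.1) ≤ 2 := by
  obtain ⟨j⟩ := nonempty_modes hd
  filter_upwards [eventually_small 0.06 (by norm_num)] with L hL
  exact (ciInf_le (bddBelow_modalRate hd op hL.1 hL.2) j).trans
    (modalRate_le hd op (hundred_le_norm_frequency hL.1 hL.2 j.2))

/-- The upper bound 2 on the rates also enters: it provides the coboundedness without which a real
`liminf` cannot be compared with lower bounds. -/
theorem le_lambdaStar (hd : 0 < d) (op : Collision) : 1 - √(3 / 7) ≤ lambdaStar d op :=
  le_liminf_of_le (IsBoundedUnder.isCoboundedUnder_ge ⟨2, eventually_iInf_le hd op⟩)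
    (eventually_le_iInf hd op)

/-- Below the limiting rate, all modes admit a common rate on small tori. -/
theorem exists_rate (hd : 0 < d) (op : Collision) {ε : ℝ} (hε : 0 < ε) :
    ∀ᶠ L : ℝ in 𝓝[>] 0, ∀ j : Fin d → ℤ, j ≠ 0 → ∃ lam δ : ℝ, 0 < lam ∧
      lambdaStar d op - ε < lam ∧ 0 < δ ∧ δ / jap (frequency L j) * ‖frequency L j‖ ≤ d * L ∧
      ∀ F : Space d → ℂ, Admissible op (frequency L j) F →
        lam * entropyH (frequency L j) δ F ≤ productionD op (frequency L j) δ F := by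
  obtain ⟨-, -, hpos⟩ := rate_const_bounds
  -- The maximum with zero keeps the selected rate positive even for large `ε`; it stays below the
  -- limit because `1 - √(3/7) > 0`.
  set m := max (lambdaStar d op - ε) 0 with hm
  have hlt : m < lambdaStar d op :=
    max_lt (by linarith) (hpos.trans_le (le_lambdaStar hd op))
  have h1 := eventually_lt_of_lt_liminf hlt ⟨_, eventually_le_iInf hd op⟩
  filter_upwards [h1, eventually_small 0.06 (by norm_num)] with L hL hL2 j hj
  have hξ := hundred_le_norm_frequency hL2.1 hL2.2 hj
  have h2 : m < modalRate op (frequency L j) :=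
    hL.trans_le (ciInf_le (bddBelow_modalRate hd op hL2.1 hL2.2)
      (⟨j, hj⟩ : {j : Fin d → ℤ // j ≠ 0}))
  obtain ⟨lam, ⟨δ, hδ, h⟩, hlam⟩ := exists_lt_of_lt_csSup
    (nonempty_rates op hξ) h2
  have hlam0 : 0 < lam := (le_max_right _ _).trans_lt hlam
  refine ⟨lam, δ, hlam0, (le_max_left _ _).trans_lt hlam, hδ, ?_, h⟩
  set ξ := frequency L j
  have hj0 := div_pos hδ (jap_pos ξ)
  -- The inequality itself constrains `δ`: for `lam > 0`, testing in direction `i` gives `δ / jap ξ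
  -- * ξ i ^ 2 ≤ 1`, and the coordinates are summed.
  have h3 : δ / jap ξ * ‖ξ‖ ^ 2 ≤ d := by
    rw [norm_sq_eq_sum, Finset.mul_sum]
    refine (Finset.sum_le_card_nsmul _ _ 1 fun i _ => ?_).trans (by simp)
    have := rate_upper_bound h i
    linarith
  -- One power of `‖ξ‖` is traded for `L`, which makes the twist small on small tori.
  have h4 : 1 ≤ L * ‖ξ‖ := by
    have := norm_frequency_ge hL2.1 hj
    rw [div_le_iff₀ hL2.1] at this
    nlinarith [Real.pi_gt_three]
  have hdL : δ / jap ξ * ‖ξ‖ * 1 ≤ δ / jap ξ * ‖ξ‖ * (L * ‖ξ‖) :=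
    mul_le_mul_of_nonneg_left h4 (mul_nonneg hj0.le (norm_nonneg _))
  nlinarith [mul_le_mul_of_nonneg_right h3 hL2.1.le]

end Rates

/-! ### Fourier series on the torus of size `L` -/

section Torus

variable {d : ℕ}

local instance : MeasureSpace UnitAddCircle := ⟨AddCircle.haarAddCircle⟩

/-- The unit box `(-1, 0]^d`. -/
def unitBox (d : ℕ) : Set (Fin d → ℝ) := {y | ∀ i, y i ∈ Set.Ioc (-1 : ℝ) (-1 + 1)}

theorem measurableSet_unitBox : MeasurableSet (unitBox d) :=
  MeasurableSet.univ_pi' fun _ => measurableSet_Ioc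

theorem lift_unitBox_apply (g : (Fin d → ℝ) → ℂ) {y : Fin d → ℝ} (hy : y ∈ unitBox d) :
    g (UnitAddTorus.measurableEquivPiIoc (fun _ => -1) fun i => (y i : UnitAddCircle)).1 = g y := by
  have h := (UnitAddTorus.measurableEquivPiIoc (fun _ : Fin d => (-1 : ℝ))).apply_symm_apply ⟨y, hy⟩
  rw [UnitAddTorus.coe_symm_measurableEquivPiIoc_apply] at h
  rw [h]

/-- Parseval on the unit torus, transported to the box through the measure-preserving equivalence
between them. -/
theorem ae_eq_zero_of_mFourier_eq_zero {g : (Fin d → ℝ) → ℂ}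
    (hg : MemLp g 2 (volume.restrict (unitBox d)))
    (h : ∀ n : Fin d → ℤ, ∫ y in unitBox d,
      UnitAddTorus.mFourier n (fun i => (y i : UnitAddCircle)) * g y = 0) :
    g =ᵐ[volume.restrict (unitBox d)] 0 := by
  set e := UnitAddTorus.measurableEquivPiIoc (fun _ : Fin d => (-1 : ℝ))
  have hf : MemLp (fun x : UnitAddTorus (Fin d) => g (e x).1) 2 volume :=
    (hg.comp_measurePreserving (measurePreserving_subtype_coe
      measurableSet_unitBox)).comp_measurePreserving
        (UnitAddTorus.measurePreserving_equivPiIoc (fun _ : Fin d => (-1 : ℝ)))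
  have hs := UnitAddTorus.hasSum_sq_mFourierCoeff (hf.toLp _)
  have hc : ∀ n, UnitAddTorus.mFourierCoeff (hf.toLp _) n = 0 := fun n => by
    rw [← h (-n), UnitAddTorus.mFourierCoeff]
    rw [integral_congr_ae (g := fun t => UnitAddTorus.mFourier (-n) t • g (e t).1)
      (by filter_upwards [hf.coeFn_toLp] with t ht; rw [ht]),
      UnitAddTorus.integral_preimage _ fun _ => (-1 : ℝ)]
    exact setIntegral_congr_fun measurableSet_unitBox fun y hy => by
      simp only [smul_eq_mul]; rw [lift_unitBox_apply g hy]
  simp only [hc, norm_zero, ne_eq, OfNat.ofNat_ne_zero, not_false_eq_true, zero_pow] at hs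
  have h0 := hs.unique hasSum_zero
  rw [integral_congr_ae (g := fun t => ‖g (e t).1‖ ^ 2)
      (by filter_upwards [hf.coeFn_toLp] with t ht; rw [ht]),
      UnitAddTorus.integral_preimage _ fun _ => (-1 : ℝ)] at h0
  have h1 : ∫ y in unitBox d, ‖g y‖ ^ 2 = 0 := by
    rw [← h0]
    exact setIntegral_congr_fun measurableSet_unitBox fun y hy =>
      (congrArg (fun z => ‖z‖ ^ 2) (lift_unitBox_apply g hy)).symm
  rw [integral_eq_zero_iff_of_nonneg (fun y => by positivity)
    ((memLp_two_iff_integrable_sq_norm hg.aestronglyMeasurable).1 hg)] at h1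
  filter_upwards [h1] with y hy
  simpa using hy

theorem integral_mFourier (n : Fin d → ℤ) :
    ∫ y in unitBox d, UnitAddTorus.mFourier n (fun i => (y i : UnitAddCircle))
      = if n = 0 then 1 else 0 := by
  have h := (orthonormal_iff_ite.1 (UnitAddTorus.orthonormal_mFourier (d := Fin d))) 0 n
  rw [ContinuousMap.inner_toLp, UnitAddTorus.integral_preimage _ fun _ => (-1 : ℝ)] at h
  simp only [UnitAddTorus.mFourier_zero, ContinuousMap.one_apply, map_one, mul_one,
    eq_comm (a := (0 : Fin d → ℤ))] at h
  exact h

end Torus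

/-! ### Plane waves on the cube of side `L` -/

section Cube

variable {d : ℕ}

/-- The dilation mapping `(-1, 0]^d` onto `[0, L)^d`. -/
def dilate (L : ℝ) (y : Fin d → ℝ) : Space d := (-L) • WithLp.toLp 2 y

/-- The factor `-L` exchanges the closed ends of the half-open intervals, turning `Ioc` into `Ico`.
Its price is the sign change of the frequency in `wave_frequency_dilate`. -/
theorem preimage_cube {L : ℝ} (hL : 0 < L) : dilate L ⁻¹' (cube d L) = unitBox d := by
  ext y
  simp only [Set.mem_preimage, cube, unitBox, Set.mem_ofPred_eq, Set.mem_Ico, Set.mem_Ioc, dilate,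
    PiLp.smul_apply, smul_eq_mul]
  refine forall_congr' fun i => ⟨fun h => ⟨by nlinarith, by nlinarith⟩,
    fun h => ⟨by nlinarith, by nlinarith⟩⟩

theorem measurableSet_cube (L : ℝ) : MeasurableSet (cube d L) := by
  have : cube d L = ⋂ i, (fun x : Space d => x i) ⁻¹' Set.Ico 0 L := by
    ext x; simp [cube]
  rw [this]
  exact MeasurableSet.iInter fun i => (by fun_prop : Measurable fun x : Space d => x i)
    measurableSet_Ico

theorem measurePreserving_dilate {L : ℝ} (hL : 0 < L) :
    MeasurePreserving (dilate L) (volume.restrict (unitBox d))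
      (ENNReal.ofReal (L ^ d)⁻¹ • volume.restrict (cube d L)) := by
  have h1 : MeasurePreserving (dilate L : (Fin d → ℝ) → Space d) volume
      (ENNReal.ofReal (L ^ d)⁻¹ • volume) := by
    have h2 : MeasurePreserving (fun x : Space d => (-L) • x) volume
        (ENNReal.ofReal (L ^ d)⁻¹ • volume) := by
      refine ⟨measurable_const_smul _, ?_⟩
      rw [Measure.map_addHaar_smul volume (by linarith : -L ≠ 0)]
      simp [abs_of_pos hL]
    exact h2.comp (PiLp.volume_preserving_toLp (Fin d))
  have h3 := h1.restrict_preimage (measurableSet_cube (d := d) L)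
  rwa [preimage_cube hL, Measure.restrict_smul] at h3

theorem integral_cube {V : Type*} [NormedAddCommGroup V] [NormedSpace ℝ V] {L : ℝ} (hL : 0 < L)
    (F : Space d → V) : ∫ x in cube d L, F x = (L ^ d) • ∫ y in unitBox d, F (dilate L y) := by
  have he : MeasurableEmbedding (dilate L : (Fin d → ℝ) → Space d) := by
    have h1 : MeasurableEmbedding fun x : Space d => (-L) • x :=
      (Homeomorph.smulOfNeZero (-L) (by linarith)).measurableEmbedding
    exact h1.comp (MeasurableEquiv.toLp 2 (Fin d → ℝ)).measurableEmbedding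
  rw [(measurePreserving_dilate hL).integral_comp he, integral_smul_measure, smul_smul,
    ENNReal.toReal_ofReal (by positivity), mul_inv_cancel₀ (by positivity), one_smul]

instance isFiniteMeasure_cube (L : ℝ) : IsFiniteMeasure (volume.restrict (cube d L)) := by
  constructor
  rw [Measure.restrict_apply_univ]
  have : cube d L ⊆ Metric.closedBall 0 (√(d * L ^ 2)) := fun x hx => by
    rw [mem_closedBall_zero_iff, EuclideanSpace.norm_eq]
    refine Real.sqrt_le_sqrt ((Finset.sum_le_card_nsmul _ _ (L ^ 2) fun i _ => ?_).trans (by simp))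
    have := hx i
    rw [Real.norm_eq_abs, sq_abs]
    exact pow_le_pow_left₀ this.1 this.2.le 2
  exact (measure_mono this).trans_lt measure_closedBall_lt_top

/-- The plane wave `exp(i ⟨x, ξ⟩)`. -/
def wave (ξ x : Space d) : ℂ := Complex.exp (((⟪x, ξ⟫_ℝ : ℝ) : ℂ) * Complex.I)

theorem wave_frequency_dilate {L : ℝ} (hL : 0 < L) (n : Fin d → ℤ) (y : Fin d → ℝ) :
    wave (frequency L n) (dilate L y)
      = UnitAddTorus.mFourier (-n) (fun i => (y i : UnitAddCircle)) := by
  simp only [UnitAddTorus.mFourier, ContinuousMap.coe_mk]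
  simp_rw [fourier_coe_apply]
  rw [← Complex.exp_sum, wave, PiLp.inner_apply]
  congr 1
  rw [Complex.ofReal_sum, Finset.sum_mul]
  refine Finset.sum_congr rfl fun i _ => ?_
  simp only [frequency_apply, dilate, PiLp.smul_apply, smul_eq_mul, RCLike.inner_apply, conj_trivial,
    Pi.neg_apply]
  push_cast
  have : (L : ℂ) ≠ 0 := by exact_mod_cast hL.ne'
  field_simp

theorem conj_wave (L : ℝ) (n : Fin d → ℤ) (x : Space d) :
    (starRingEnd ℂ) (wave (frequency L n) x) = wave (frequency L (-n)) x := by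
  have : frequency L (-n) = -frequency L n := by
    ext i; simp [frequency_apply]
  rw [wave, wave, ← Complex.exp_conj, this, inner_neg_right]
  simp

theorem norm_wave (ξ x : Space d) : ‖wave ξ x‖ = 1 := Complex.norm_exp_ofReal_mul_I _

theorem continuous_wave (ξ : Space d) : Continuous (wave ξ) := by unfold wave; fun_prop

theorem wave_mul_conj_wave (L : ℝ) (m n : Fin d → ℤ) (x : Space d) :
    wave (frequency L m) x * (starRingEnd ℂ) (wave (frequency L n) x)
      = wave (frequency L (m - n)) x := by
  have : frequency L (m - n) = frequency L m + frequency L (-n) := by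
    ext i; simp [frequency_apply]; ring
  rw [conj_wave, wave, wave, wave, ← Complex.exp_add, this, inner_add_right]
  push_cast; ring_nf

theorem integral_wave {L : ℝ} (hL : 0 < L) (n : Fin d → ℤ) :
    ∫ x in cube d L, wave (frequency L n) x = if n = 0 then ((L ^ d : ℝ) : ℂ) else 0 := by
  rw [integral_cube hL]
  simp_rw [wave_frequency_dilate hL]
  rw [integral_mFourier]
  simp only [neg_eq_zero]
  split_ifs <;> simp

theorem ae_eq_zero_of_integral_wave_eq_zero {L : ℝ} (hL : 0 < L) {g : Space d → ℂ}
    (hg : MemLp g 2 (volume.restrict (cube d L)))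
    (h : ∀ n : Fin d → ℤ, ∫ x in cube d L, wave (frequency L n) x * g x = 0) :
    g =ᵐ[volume.restrict (cube d L)] 0 := by
  have hp := measurePreserving_dilate (d := d) hL
  have hg' : MemLp (g ∘ dilate L) 2 (volume.restrict (unitBox d)) :=
    (hg.smul_measure ENNReal.ofReal_ne_top).comp_measurePreserving hp
  have h1 := ae_eq_zero_of_mFourier_eq_zero hg' fun n => by
    have h2 := h (-n)
    rw [integral_cube hL, smul_eq_zero] at h2
    have h3 := h2.resolve_left (by positivity)
    simp_rw [wave_frequency_dilate hL, neg_neg] at h3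
    exact h3
  -- An almost everywhere statement is pushed forward here, which requires a measurable set and
  -- hence a measurable representative of `g`.
  have h4 : ∀ᵐ x ∂(Measure.map (dilate L) (volume.restrict (unitBox d))), g x = 0 := by
    have hgm : AEMeasurable g (Measure.map (dilate L) (volume.restrict (unitBox d))) := by
      rw [hp.map_eq]; exact (hg.aestronglyMeasurable.aemeasurable).smul_measure _
    have := (ae_map_iff hp.measurable.aemeasurable
      (measurableSet_eq_fun hgm.measurable_mk measurable_const)
      (p := fun x => hgm.mk g x = 0)).2 (by
        filter_upwards [h1, ae_of_ae_map hp.measurable.aemeasurable hgm.ae_eq_mk] with y h1 h2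
        rw [← h2]; exact h1)
    filter_upwards [this, hgm.ae_eq_mk] with x h1 h2
    rw [h2, h1]
  rw [hp.map_eq] at h4
  exact (Measure.ae_ennreal_smul_measure_iff (ENNReal.ofReal_pos.2 (by positivity)).ne').1 h4

end Cube

/-! ### The Fourier-Hermite basis of the phase space -/

section Phase

variable {d : ℕ}

theorem memLp_two_prod {X Y : Type*} [MeasurableSpace X] [MeasurableSpace Y] {μ : Measure X}
    {ν : Measure Y} [SFinite μ] [SFinite ν] {a : X → ℂ} {b : Y → ℂ} (ha : MemLp a 2 μ)
    (hb : MemLp b 2 ν) : MemLp (fun p : X × Y => a p.1 * b p.2) 2 (μ.prod ν) := by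
  have hm : AEStronglyMeasurable (fun p : X × Y => a p.1 * b p.2) (μ.prod ν) :=
    ha.aestronglyMeasurable.comp_fst.mul hb.aestronglyMeasurable.comp_snd
  rw [memLp_two_iff_integrable_sq_norm hm]
  simp_rw [norm_mul, mul_pow]
  exact ((memLp_two_iff_integrable_sq_norm ha.aestronglyMeasurable).1 ha).mul_prod
    ((memLp_two_iff_integrable_sq_norm hb.aestronglyMeasurable).1 hb)

theorem memLp_wave (L : ℝ) (ξ : Space d) : MemLp (wave ξ) 2 (volume.restrict (cube d L)) :=
  MemLp.of_bound (continuous_wave ξ).aestronglyMeasurable 1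
    (ae_of_all _ fun x => (norm_wave ξ x).le)

/-- The Fourier-Hermite functions. -/
def mode (L : ℝ) (j : Fin d → ℤ) (α : Fin d → ℕ) (p : Space d × Space d) : ℂ :=
  ((√(L ^ d))⁻¹ : ℝ) * (wave (frequency L j) p.1 * (hermF α p.2 : ℂ))

theorem memLp_wave_mul (L : ℝ) (ξ : Space d) {b : Space d → ℂ} (hb : MemLp b 2 (gammaMeasure d)) :
    MemLp (fun p : Space d × Space d => wave ξ p.1 * b p.2) 2 (phaseMeasure d L) :=
  memLp_two_prod (memLp_wave L ξ) hb

theorem memLp_mode (L : ℝ) (j : Fin d → ℤ) (α : Fin d → ℕ) :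
    MemLp (mode L j α) 2 (phaseMeasure d L) :=
  (memLp_wave_mul L _ (memLp_hermF_complex α)).const_mul _

/-- The Fourier-Hermite functions as elements of `L²(dx dγ)`. -/
def modeLp (L : ℝ) (jα : (Fin d → ℤ) × (Fin d → ℕ)) : Lp ℂ 2 (phaseMeasure d L) :=
  (memLp_mode L jα.1 jα.2).toLp _

theorem inner_modeLp (L : ℝ) (jα : (Fin d → ℤ) × (Fin d → ℕ)) (f : Lp ℂ 2 (phaseMeasure d L)) :
    ⟪modeLp L jα, f⟫_ℂ
      = ∫ p, (starRingEnd ℂ) (mode L jα.1 jα.2 p) * f p ∂(phaseMeasure d L) := by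
  rw [L2.inner_def]
  refine integral_congr_ae ?_
  filter_upwards [(memLp_mode L jα.1 jα.2).coeFn_toLp] with p hp
  rw [modeLp, hp]
  simp [mul_comm]

theorem orthonormal_modeLp {L : ℝ} (hL : 0 < L) : Orthonormal ℂ (modeLp (d := d) L) := by
  classical
  rw [orthonormal_iff_ite]
  rintro ⟨j, α⟩ ⟨k, β⟩
  rw [inner_modeLp, integral_congr_ae (g := fun p : Space d × Space d =>
    (((L ^ d)⁻¹ : ℝ) * wave (frequency L (k - j)) p.1) * ((hermF α p.2 : ℂ) * (hermF β p.2 : ℂ)))]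
  · rw [phaseMeasure, integral_prod_mul (fun x => (((L ^ d)⁻¹ : ℝ) : ℂ) * wave (frequency L (k - j)) x)
      (fun v => (hermF α v : ℂ) * (hermF β v : ℂ)), integral_const_mul, integral_wave hL,
      integral_mul_hermF_gamma, coef_hermF]
    have hne : (L : ℂ) ^ d ≠ 0 := pow_ne_zero _ (by exact_mod_cast hL.ne')
    by_cases h1 : j = k
    · by_cases h2 : α = β
      · simp [h1, h2, hne]
      · simp [h2]
    · simp [sub_eq_zero, h1, Ne.symm h1]
  · filter_upwards [(memLp_mode L k β).coeFn_toLp] with p hp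
    rw [modeLp, hp, mode, mode, ← wave_mul_conj_wave]
    simp only [map_mul, Complex.conj_ofReal]
    have h : (((√(L ^ d))⁻¹ : ℝ) : ℂ) * ((√(L ^ d))⁻¹ : ℝ) = (((L ^ d)⁻¹ : ℝ) : ℂ) := by
      rw [← Complex.ofReal_mul, ← mul_inv, Real.mul_self_sqrt (by positivity)]
    rw [← h]; ring

/-- The partial Fourier coefficients in the position variable. -/
theorem ae_eq_zero_of_modes {L : ℝ} (hL : 0 < L) {f : Space d × Space d → ℂ}
    (hfm : StronglyMeasurable f) (hf : MemLp f 2 (phaseMeasure d L))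
    (h : ∀ (j : Fin d → ℤ) (α : Fin d → ℕ),
      ∫ p, wave (frequency L j) p.1 * (hermF α p.2 : ℂ) * f p ∂(phaseMeasure d L) = 0) :
    f =ᵐ[phaseMeasure d L] 0 := by
  -- The `j`-th Fourier coefficient in `x`, as a function of `v`, has exponential moments and
  -- vanishing Hermite coefficients, so it vanishes for almost every `v`.
  have hG : ∀ (j : Fin d → ℤ),
      (fun v => ∫ x in cube d L, wave (frequency L j) x * f (x, v)) =ᵐ[gammaMeasure d] 0 := fun j => by
    refine gamma_absolutelyContinuous.ae_eq (ae_eq_zero_of_coef_eq_zero (fun c => ?_) fun α => ?_)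
    · have hE : MemLp (fun v : Space d => ((Real.exp (c * ‖v‖) * maxwellian d v : ℝ) : ℂ)) 2
        (gammaMeasure d) := (memLp_exp_mul_maxwellian (d := d) c).ofReal
      have h1 : Integrable (fun p : Space d × Space d => wave (frequency L j) p.1
          * ((Real.exp (c * ‖p.2‖) * maxwellian d p.2 : ℝ) : ℂ) * f p)
          ((volume.restrict (cube d L)).prod (gammaMeasure d)) :=
        MemLp.integrable_mul (memLp_wave_mul L _ hE) hf
      have h2 := h1.integral_prod_right
      rw [integrable_gamma] at h2
      refine h2.congr (ae_of_all _ fun v => ?_)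
      have hM : (maxwellian d v : ℂ) ≠ 0 := by exact_mod_cast (maxwellian_pos v).ne'
      have e : ∀ x, wave (frequency L j) x * ((Real.exp (c * ‖v‖) * maxwellian d v : ℝ) : ℂ)
          * f (x, v) = ((Real.exp (c * ‖v‖) * maxwellian d v : ℝ) : ℂ)
          * (wave (frequency L j) x * f (x, v)) := fun x => by ring
      simp_rw [e]
      rw [integral_const_mul, Complex.real_smul, Complex.real_smul, Complex.ofReal_mul,
        Complex.ofReal_inv]
      field_simp
    · have hI : Integrable (fun p : Space d × Space d => wave (frequency L j) p.1
          * (hermF α p.2 : ℂ) * f p) ((volume.restrict (cube d L)).prod (gammaMeasure d)) :=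
        MemLp.integrable_mul (memLp_wave_mul L _ (memLp_hermF_complex α)) hf
      rw [← integral_mul_hermF_gamma, ← h j α, phaseMeasure, integral_prod_symm _ hI]
      congr 1; ext v
      rw [← integral_const_mul]
      congr 1; ext x; ring
  have hsq : Integrable (fun p => ‖f p‖ ^ 2)
      ((volume.restrict (cube d L)).prod (gammaMeasure d)) :=
    (memLp_two_iff_integrable_sq_norm hf.aestronglyMeasurable).1 hf
  -- There are countably many `j`, so for almost every `v` all Fourier coefficients of the slice
  -- vanish at once.
  have hae : ∀ᵐ v ∂(gammaMeasure d), (fun x => f (x, v)) =ᵐ[volume.restrict (cube d L)] 0 := by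
    filter_upwards [ae_all_iff.2 hG, hsq.prod_left_ae] with v h1 h2
    refine ae_eq_zero_of_integral_wave_eq_zero hL ?_ h1
    exact (memLp_two_iff_integrable_sq_norm
      (hfm.comp_measurable measurable_prodMk_right).aestronglyMeasurable).2 h2
  have h0 : ∫⁻ p, ‖f p‖ₑ ∂(phaseMeasure d L) = 0 := by
    rw [phaseMeasure, lintegral_prod_symm _ hfm.enorm.aemeasurable]
    rw [lintegral_eq_zero_iff' (Measurable.lintegral_prod_left' hfm.enorm).aemeasurable]
    filter_upwards [hae] with v hv
    have hm : Measurable fun x => ‖f (x, v)‖ₑ := hfm.enorm.comp measurable_prodMk_right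
    rw [Pi.zero_apply, lintegral_eq_zero_iff hm]
    filter_upwards [hv] with x hx
    simp [hx]
  rw [lintegral_eq_zero_iff hfm.enorm] at h0
  filter_upwards [h0] with p hp
  simpa using hp

/-- The Fourier-Hermite basis. -/
def modeBasis {L : ℝ} (hL : 0 < L) :
    HilbertBasis ((Fin d → ℤ) × (Fin d → ℕ)) ℂ (Lp ℂ 2 (phaseMeasure d L)) :=
  HilbertBasis.mkOfOrthogonalEqBot (orthonormal_modeLp hL) (by
    rw [Submodule.eq_bot_iff]
    intro f hf
    rw [Lp.eq_zero_iff_ae_eq_zero]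
    refine ae_eq_zero_of_modes hL (Lp.stronglyMeasurable f) (Lp.memLp f) fun j α => ?_
    -- The inner product conjugates the wave, so the index `-j` is the one that yields frequency
    -- `j`.
    have h1 : ⟪modeLp L (-j, α), f⟫_ℂ = 0 := hf _ (Submodule.subset_span ⟨(-j, α), rfl⟩)
    rw [inner_modeLp] at h1
    have hs : (((√(L ^ d))⁻¹ : ℝ) : ℂ) ≠ 0 := by
      have : (0 : ℝ) < (√(L ^ d))⁻¹ := by positivity
      exact_mod_cast this.ne'
    have e : ∀ p, (starRingEnd ℂ) (mode L (-j) α p) * f p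
        = ((√(L ^ d))⁻¹ : ℝ) * (wave (frequency L j) p.1 * (hermF α p.2 : ℂ) * f p) := fun p => by
      rw [mode, map_mul, map_mul, conj_wave, neg_neg]
      simp only [Complex.conj_ofReal]; ring
    simp_rw [e] at h1
    rw [integral_const_mul, mul_eq_zero] at h1
    exact h1.resolve_left hs)

theorem modeBasis_apply {L : ℝ} (hL : 0 < L) (jα : (Fin d → ℤ) × (Fin d → ℕ)) :
    modeBasis hL jα = modeLp L jα := by
  rw [modeBasis, HilbertBasis.coe_mkOfOrthogonalEqBot]

theorem hasSum_norm_inner_modeLp {L : ℝ} (hL : 0 < L) (f : Lp ℂ 2 (phaseMeasure d L)) :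
    HasSum (fun jα => ‖⟪modeLp L jα, f⟫_ℂ‖ ^ 2) (‖f‖ ^ 2) := by
  have h := Complex.hasSum_re ((modeBasis hL).hasSum_inner_mul_inner f f)
  have e : (fun jα => ‖⟪modeLp L jα, f⟫_ℂ‖ ^ 2)
      = fun jα => (⟪f, modeBasis hL jα⟫_ℂ * ⟪modeBasis hL jα, f⟫_ℂ).re := funext fun jα => by
    rw [modeBasis_apply, ← inner_conj_symm f, mul_comm, Complex.mul_conj,
      Complex.normSq_eq_norm_sq, Complex.ofReal_re]
  rw [e, ← inner_self_eq_norm_sq (𝕜 := ℂ) f]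
  exact h

end Phase

/-! ### From the weak formulation to the equations for the Fourier-Hermite coefficients -/

section Weak

variable {d : ℕ}

theorem contDiff_wave (ξ : Space d) : ContDiff ℝ ∞ (wave ξ) :=
  ((Complex.ofRealCLM.contDiff.comp (contDiff_id.inner ℝ contDiff_const)).mul contDiff_const).cexp

theorem fderiv_wave (ξ x v : Space d) :
    fderiv ℝ (wave ξ) x v = wave ξ x * (Complex.I * ((⟪v, ξ⟫_ℝ : ℝ) : ℂ)) := by
  have h : HasFDerivAt (fun y : Space d => ((⟪y, ξ⟫_ℝ : ℝ) : ℂ) * Complex.I)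
      ((Complex.ofRealCLM.comp ((innerSL ℝ).flip ξ)).smulRight Complex.I) x :=
    ((Complex.ofRealCLM.comp ((innerSL ℝ).flip ξ)).smulRight Complex.I).hasFDerivAt
  have h2 : HasFDerivAt (wave ξ) _ x := h.cexp
  rw [h2.fderiv]
  simp only [wave, _root_.smul_apply, ContinuousLinearMap.smulRight_apply,
    ContinuousLinearMap.comp_apply, ContinuousLinearMap.flip_apply, innerSL_apply_apply,
    Complex.ofRealCLM_apply, smul_eq_mul]
  ring

theorem wave_add_single {L : ℝ} (hL : 0 < L) (j : Fin d → ℤ) (x : Space d) (i : Fin d) :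
    wave (frequency L j) (x + EuclideanSpace.single i L) = wave (frequency L j) x := by
  have hL' : (L : ℂ) ≠ 0 := by exact_mod_cast hL.ne'
  rw [wave, wave, inner_add_left, EuclideanSpace.inner_single_left, frequency_apply,
    Complex.ofReal_add, add_mul, Complex.exp_add]
  have : ((((starRingEnd ℝ) L * (2 * Real.pi / L * (j i : ℝ)) : ℝ)) : ℂ) * Complex.I
      = (j i : ℂ) * (2 * Real.pi * Complex.I) := by
    simp only [conj_trivial]
    push_cast
    field_simp
  rw [this, Complex.exp_int_mul_two_pi_mul_I, mul_one]

/-- Test functions are real valued; composing with an arbitrary real functional `l` treats real and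
imaginary parts simultaneously. -/
theorem isTestFunction_wave_mul {L : ℝ} (hL : 0 < L) (j : Fin d → ℤ) {K : Space d → ℝ}
    (hK : ContDiff ℝ ∞ K) {R : ℝ} (hR : ∀ v, R < ‖v‖ → K v = 0) (l : ℂ →L[ℝ] ℝ) :
    IsTestFunction d L fun p => l (wave (frequency L j) p.1 * (K p.2 : ℂ)) where
  smooth := l.contDiff.comp (((contDiff_wave _).comp contDiff_fst).mul
    (Complex.ofRealCLM.contDiff.comp (hK.comp contDiff_snd)))
  periodic x v i := by simp only [wave_add_single hL]
  compact := ⟨R, fun x v h => by simp [hR v h]⟩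

theorem adjointGenerator_wave_mul (op : Collision) (ξ : Space d) {K : Space d → ℝ}
    (hK : ContDiff ℝ ∞ K) (hi : Integrable K) (l : ℂ →L[ℝ] ℝ) (p : Space d × Space d) :
    adjointGenerator op (fun p => l (wave ξ p.1 * (K p.2 : ℂ))) p
      = l (Complex.I * (wave ξ p.1 * ((⟪p.2, ξ⟫_ℝ * K p.2 : ℝ) : ℂ))
        + wave ξ p.1 * ((collisionOp op K p.2 : ℝ) : ℂ)) := by
  rw [adjointGenerator, map_add]
  congr 1
  · have h := l.hasFDerivAt.comp p.1
      ((((contDiff_wave ξ).differentiable (by simp) p.1).hasFDerivAt).mul_const (K p.2 : ℂ))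
    have h2 : HasFDerivAt (fun y => l (wave ξ y * (K p.2 : ℂ))) _ p.1 := h
    rw [h2.fderiv]
    simp only [ContinuousLinearMap.comp_apply, _root_.smul_apply, fderiv_wave]
    congr 1
    rw [smul_eq_mul]
    push_cast
    ring
  · have h := collisionOp_clm_comp op
      (l.comp ((ContinuousLinearMap.mul ℝ ℂ (wave ξ p.1)).comp Complex.ofRealCLM)) hK hi p.2
    exact h

/-- The real-linear functional `f ↦ ∫ Ψ f` on real `L²`. -/
def pairing {X : Type*} [MeasurableSpace X] {μ : Measure X} {Ψ : X → ℂ} (hΨ : MemLp Ψ 2 μ) :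
    Lp ℝ 2 μ →L[ℝ] ℂ :=
  ((innerSL ℂ (hΨ.star.toLp (star Ψ))).restrictScalars ℝ).comp (Complex.ofRealCLM.compLpL 2 μ)

theorem pairing_apply {X : Type*} [MeasurableSpace X] {μ : Measure X} {Ψ : X → ℂ}
    (hΨ : MemLp Ψ 2 μ) (f : Lp ℝ 2 μ) : pairing hΨ f = ∫ p, Ψ p * (f p : ℂ) ∂μ := by
  change ⟪hΨ.star.toLp (star Ψ), Complex.ofRealCLM.compLpL 2 μ f⟫_ℂ = _
  rw [L2.inner_def]
  refine integral_congr_ae ?_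
  filter_upwards [hΨ.star.coeFn_toLp, Complex.ofRealCLM.coeFn_compLpL (p := 2) f] with p h1 h2
  rw [h1, h2]
  simp [mul_comm]

theorem integral_mul_clm {X : Type*} [MeasurableSpace X] {μ : Measure X} {Ψ : X → ℂ}
    (hΨ : MemLp Ψ 2 μ) (l : ℂ →L[ℝ] ℝ) (f : Lp ℝ 2 μ) :
    ∫ p, f p * l (Ψ p) ∂μ = l (pairing hΨ f) := by
  have hf : MemLp (fun p => (f p : ℂ)) 2 μ := (Lp.memLp f).ofReal
  have hi : Integrable (fun p => Ψ p * (f p : ℂ)) μ := MemLp.integrable_mul hΨ hf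
  rw [pairing_apply, ← l.integral_comp_comm hi]
  refine integral_congr_ae (ae_of_all _ fun p => ?_)
  change f p * l (Ψ p) = l (Ψ p * (f p : ℂ))
  rw [mul_comm (Ψ p), ← Complex.real_smul, map_smul, smul_eq_mul]

/-- The weak formulation tested against a plane wave times a function of the velocity. -/
theorem IsSolution.weak_wave {L : ℝ} (hL : 0 < L) {op : Collision} {f₀ : PhaseL2 d L}
    {f : ℝ → PhaseL2 d L} (hf : IsSolution op f₀ f) (j : Fin d → ℤ) {K : Space d → ℝ}
    (hK : ContDiff ℝ ∞ K) {R : ℝ} (hR : ∀ v, R < ‖v‖ → K v = 0) (hi : Integrable K)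
    {ξ : Space d} (hξ : ξ = frequency L j)
    (h0 : MemLp (fun p : Space d × Space d => wave ξ p.1 * (K p.2 : ℂ)) 2 (phaseMeasure d L))
    (h1 : MemLp (fun p : Space d × Space d => Complex.I * (wave ξ p.1 * ((⟪p.2, ξ⟫_ℝ * K p.2 : ℝ) : ℂ))
        + wave ξ p.1 * ((collisionOp op K p.2 : ℝ) : ℂ)) 2 (phaseMeasure d L)) {t : ℝ} (ht : 0 ≤ t) :
    pairing h0 (f t) - pairing h0 f₀ = pairing h1 (∫ s in (0 : ℝ)..t, f s) := by
  have hcont : ContinuousOn f (Set.uIcc 0 t) :=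
    hf.continuousOn.mono (by rw [Set.uIcc_of_le ht]; exact Set.Icc_subset_Ici_self)
  have key : ∀ l : ℂ →L[ℝ] ℝ, l (pairing h0 (f t) - pairing h0 f₀)
      = l (pairing h1 (∫ s in (0 : ℝ)..t, f s)) := fun l => by
    have hw := hf.weak _ (hξ ▸ isTestFunction_wave_mul hL j hK hR l) t ht
    simp_rw [adjointGenerator_wave_mul op ξ hK hi l] at hw
    simp_rw [integral_mul_clm h0 l, integral_mul_clm h1 l] at hw
    rw [map_sub, hw]
    -- Continuity in time makes `f` Bochner integrable, so the time integral can be taken inside the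
    -- pairing.
    exact (l.comp (pairing h1)).intervalIntegral_comp_comm hcont.intervalIntegrable
  refine Complex.ext ?_ ?_
  · exact key Complex.reCLM
  · exact key Complex.imCLM

theorem memLp_phase_snd (L : ℝ) {B : Space d → ℝ} (hB : MemLp B 2 (gammaMeasure d)) :
    MemLp (fun p : Space d × Space d => B p.2) 2 (phaseMeasure d L) := hB.comp_snd _

theorem memLp_wave_mul_real (L : ℝ) (ξ : Space d) {K : Space d → ℝ}
    (hK : MemLp K 2 (gammaMeasure d)) :
    MemLp (fun p : Space d × Space d => wave ξ p.1 * (K p.2 : ℂ)) 2 (phaseMeasure d L) :=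
  memLp_wave_mul L ξ (b := fun v => (K v : ℂ)) hK.ofReal

theorem tendsto_pairing_wave {L : ℝ} (ξ : Space d) {K : ℕ → Space d → ℝ} {B h : Space d → ℝ}
    (hK : ∀ n, MemLp (K n) 2 (gammaMeasure d)) (hh : MemLp h 2 (gammaMeasure d))
    (hB : MemLp B 2 (gammaMeasure d)) (hb : ∀ n v, |K n v| ≤ B v)
    (ht : ∀ v, Tendsto (fun n => K n v) atTop (𝓝 (h v))) (f : PhaseL2 d L) :
    Tendsto (fun n => pairing (memLp_wave_mul_real L ξ (hK n)) f) atTop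
      (𝓝 (pairing (memLp_wave_mul_real L ξ hh) f)) := by
  have hf : MemLp (fun p => (f p : ℂ)) 2 (phaseMeasure d L) := (Lp.memLp f).ofReal
  have hF : MemLp (fun p => wave ξ p.1 * (f p : ℂ)) 2 (phaseMeasure d L) := by
    refine hf.mono ((continuous_wave ξ).comp_aestronglyMeasurable
      measurable_fst.aestronglyMeasurable |>.mul hf.aestronglyMeasurable) (ae_of_all _ fun p => ?_)
    simp [norm_wave]
  have := tendsto_integral_mul_of_memLp (μ := phaseMeasure d L) (K := fun n p => K n p.2)
    (h := fun p => h p.2) (B := fun p => B p.2) hF (memLp_phase_snd L hB)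
    (fun n => (memLp_phase_snd L (hK n)).aestronglyMeasurable) (fun n p => hb n p.2)
    (fun p => ht p.2)
  simp_rw [pairing_apply]
  have e : ∀ (k : Space d → ℝ) (p : Space d × Space d), wave ξ p.1 * (k p.2 : ℂ) * (f p : ℂ)
      = (k p.2 : ℂ) * (wave ξ p.1 * (f p : ℂ)) := fun k p => by ring
  simp_rw [e]
  exact this

/-- The Fourier-Hermite coefficients, not normalized in the position variable. -/
def rawCoef (L : ℝ) (ξ : Space d) (α : Fin d → ℕ) : PhaseL2 d L →L[ℝ] ℂ :=
  pairing (memLp_wave_mul_real L ξ (memLp_hermF α))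

theorem pairing_inner_mul_hermF (L : ℝ) (ξ : Space d) (α : Fin d → ℕ) (f : PhaseL2 d L) :
    pairing (memLp_wave_mul_real L ξ (memLp_inner_mul_hermF ξ α)) f
      = ladder ξ (fun β => rawCoef L ξ β f) α := by
  have hf : MemLp (fun p => (f p : ℂ)) 2 (phaseMeasure d L) := (Lp.memLp f).ofReal
  have hI : ∀ β, Integrable (fun p => wave ξ p.1 * (hermF β p.2 : ℂ) * (f p : ℂ))
      (phaseMeasure d L) := fun β =>
    MemLp.integrable_mul (memLp_wave_mul_real L ξ (memLp_hermF β)) hf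
  simp only [ladder, rawCoef, pairing_apply, inner_mul_hermF]
  have e : ∀ p : Space d × Space d, wave ξ p.1 * ((∑ i, ξ i * (√(α i + 1) * hermF (up α i) p.2
      + √(α i) * hermF (down α i) p.2) : ℝ) : ℂ) * (f p : ℂ)
      = ∑ i, (ξ i : ℂ) * ((√(α i + 1) : ℝ) * (wave ξ p.1 * (hermF (up α i) p.2 : ℂ) * (f p : ℂ))
        + (√(α i) : ℝ) * (wave ξ p.1 * (hermF (down α i) p.2 : ℂ) * (f p : ℂ))) := fun p => by
    push_cast
    rw [Finset.mul_sum, Finset.sum_mul]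
    exact Finset.sum_congr rfl fun i _ => by ring
  simp_rw [e]
  have hs : ∀ i, Integrable (fun p : Space d × Space d => (ξ i : ℂ)
      * ((√(α i + 1) : ℝ) * (wave ξ p.1 * (hermF (up α i) p.2 : ℂ) * (f p : ℂ))
        + (√(α i) : ℝ) * (wave ξ p.1 * (hermF (down α i) p.2 : ℂ) * (f p : ℂ))))
      (phaseMeasure d L) := fun i =>
    (((hI _).const_mul _).add ((hI _).const_mul _)).const_mul _
  rw [integral_finsetSum _ fun i _ => hs i]
  refine Finset.sum_congr rfl fun i _ => ?_
  rw [integral_const_mul, integral_add ((hI _).const_mul _) ((hI _).const_mul _),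
    integral_const_mul, integral_const_mul]

/-- The identity is first written for cut-off Hermite functions, which are admissible in velocity.
The time integral already sits inside the pairing, so dominated convergence at fixed elements of
`L²` removes the cutoff with no uniformity in time. -/
theorem IsSolution.rawCoef_eq {L : ℝ} (hL : 0 < L) {op : Collision} {f₀ : PhaseL2 d L}
    {f : ℝ → PhaseL2 d L} (hf : IsSolution op f₀ f) (j : Fin d → ℤ) (α : Fin d → ℕ) {t : ℝ}
    (ht : 0 ≤ t) :
    rawCoef L (frequency L j) α (f t) - rawCoef L (frequency L j) α f₀
      = Complex.I * ladder (frequency L j)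
          (fun β => rawCoef L (frequency L j) β (∫ s in (0 : ℝ)..t, f s)) α
        - decay op α * rawCoef L (frequency L j) α (∫ s in (0 : ℝ)..t, f s) := by
  set ξ := frequency L j with hξ
  obtain ⟨B, hB, hBle, hBt⟩ := exists_bound_collisionOp_cut op α
  have hb0 : ∀ n v, |hermF α v * cut n v| ≤ |hermF α v| := fun n v => by
    rw [abs_mul]; exact mul_le_of_le_one_right (abs_nonneg _) (abs_cut_le n v)
  have hb1 : ∀ n v, |⟪v, ξ⟫_ℝ * (hermF α v * cut n v)| ≤ |⟪v, ξ⟫_ℝ * hermF α v| := fun n v => by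
    rw [← mul_assoc, abs_mul]; exact mul_le_of_le_one_right (abs_nonneg _) (abs_cut_le n v)
  have hK0 : ∀ n, MemLp (fun v : Space d => hermF α v * cut n v) 2 (gammaMeasure d) := fun n =>
    (memLp_hermF α).abs.mono' (contDiff_hermF_cut α n).continuous.aestronglyMeasurable
      (ae_of_all _ (hb0 n))
  have hK1 : ∀ n, MemLp (fun v : Space d => ⟪v, ξ⟫_ℝ * (hermF α v * cut n v)) 2
      (gammaMeasure d) := fun n =>
    (memLp_inner_mul_hermF ξ α).abs.mono' ((continuous_id.inner continuous_const).mul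
      (contDiff_hermF_cut α n).continuous).aestronglyMeasurable (ae_of_all _ (hb1 n))
  have hK2 : ∀ n, MemLp (collisionOp op fun v : Space d => hermF α v * cut n v) 2
      (gammaMeasure d) := fun n =>
    hB.mono' (continuous_collisionOp op (contDiff_hermF_cut α n)).aestronglyMeasurable
      (ae_of_all _ (hBle n))
  have hc : ∀ v : Space d, Tendsto (fun n => hermF α v * cut n v) atTop (𝓝 (hermF α v)) :=
    fun v => by simpa using (tendsto_cut v).const_mul (hermF α v)
  have heq : ∀ n, pairing (memLp_wave_mul_real L ξ (hK0 n)) (f t)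
        - pairing (memLp_wave_mul_real L ξ (hK0 n)) f₀
      = Complex.I * pairing (memLp_wave_mul_real L ξ (hK1 n)) (∫ s in (0 : ℝ)..t, f s)
        + pairing (memLp_wave_mul_real L ξ (hK2 n)) (∫ s in (0 : ℝ)..t, f s) := fun n => by
    have h1 := ((memLp_wave_mul_real L ξ (hK1 n)).const_mul Complex.I).add
      (memLp_wave_mul_real L ξ (hK2 n))
    rw [hf.weak_wave hL j (contDiff_hermF_cut α n) (R := 2 * ((n : ℝ) + 1))
      (fun v hv => by rw [cut_eq_zero n v hv, mul_zero]) (integrable_hermF_cut α n) hξ _ h1 ht]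
    have hg : MemLp (fun p => ((∫ s in (0 : ℝ)..t, f s : PhaseL2 d L) p : ℂ)) 2
      (phaseMeasure d L) := (Lp.memLp _).ofReal
    rw [pairing_apply, pairing_apply, pairing_apply, ← integral_const_mul]
    refine Eq.trans ?_ (integral_add
      ((MemLp.integrable_mul (memLp_wave_mul_real L ξ (hK1 n)) hg).const_mul Complex.I)
      (MemLp.integrable_mul (memLp_wave_mul_real L ξ (hK2 n)) hg))
    refine integral_congr_ae (ae_of_all _ fun p => ?_)
    dsimp only
    ring
  have hlim0 := fun g : PhaseL2 d L =>
    tendsto_pairing_wave ξ hK0 (memLp_hermF α) (memLp_hermF α).abs hb0 hc g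
  have hlim1 := fun g : PhaseL2 d L =>
    tendsto_pairing_wave ξ hK1 (memLp_inner_mul_hermF ξ α) (memLp_inner_mul_hermF ξ α).abs hb1
      (fun v => (hc v).const_mul _) g
  have hlim2 := fun g : PhaseL2 d L =>
    tendsto_pairing_wave ξ hK2 ((memLp_hermF α).const_mul _) hB hBle hBt g
  have hl := (hlim0 (f t)).sub (hlim0 f₀)
  simp_rw [heq] at hl
  have hr := ((hlim1 (∫ s in (0 : ℝ)..t, f s)).const_mul Complex.I).add
    (hlim2 (∫ s in (0 : ℝ)..t, f s))
  have hfin := tendsto_nhds_unique hl hr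
  rw [pairing_inner_mul_hermF] at hfin
  rw [show rawCoef L ξ α = pairing (memLp_wave_mul_real L ξ (memLp_hermF α)) from rfl, hfin, sub_eq_add_neg, ← neg_mul]
  congr 1
  rw [pairing_apply, pairing_apply, ← integral_const_mul]
  refine integral_congr_ae (ae_of_all _ fun p => ?_)
  change wave ξ p.1 * ((-decay op α * hermF α p.2 : ℝ) : ℂ) * _ = _
  push_cast
  ring

end Weak

/-! ### The differential equations for the Fourier-Hermite coefficients -/

section Coefficients

variable {d : ℕ}

theorem frequency_neg (L : ℝ) (j : Fin d → ℤ) : frequency L (-j) = -frequency L j := by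
  ext i; simp [frequency_apply]

theorem ladder_neg (ξ : Space d) (c : (Fin d → ℕ) → ℂ) (α : Fin d → ℕ) :
    ladder (-ξ) c α = -ladder ξ c α := by
  simp [ladder]

/-- The coefficients of a real function in the Fourier-Hermite basis. -/
def modeCoef (L : ℝ) (j : Fin d → ℤ) (α : Fin d → ℕ) : PhaseL2 d L →L[ℝ] ℂ :=
  (√(L ^ d))⁻¹ • rawCoef L (frequency L (-j)) α

theorem modeCoef_apply (L : ℝ) (j : Fin d → ℤ) (α : Fin d → ℕ) (f : PhaseL2 d L) :
    modeCoef L j α f = ((√(L ^ d))⁻¹ : ℝ) * rawCoef L (frequency L (-j)) α f := by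
  rw [modeCoef, _root_.smul_apply, Complex.real_smul]

/-- `rawCoef` pairs with the wave itself and not its conjugate; the index `-j` in `modeCoef`
compensates for this. -/
theorem modeCoef_eq_inner (L : ℝ) (j : Fin d → ℤ) (α : Fin d → ℕ) (f : PhaseL2 d L) :
    modeCoef L j α f = ⟪modeLp L (j, α), Complex.ofRealCLM.compLpL 2 (phaseMeasure d L) f⟫_ℂ := by
  rw [inner_modeLp, modeCoef_apply, rawCoef, pairing_apply, ← integral_const_mul]
  refine integral_congr_ae ?_
  filter_upwards [Complex.ofRealCLM.coeFn_compLpL (p := 2) f] with p hp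
  rw [hp, mode, map_mul, map_mul, conj_wave, Complex.conj_ofReal, Complex.conj_ofReal,
    Complex.ofRealCLM_apply]
  ring

theorem hasSum_norm_modeCoef {L : ℝ} (hL : 0 < L) (f : PhaseL2 d L) :
    HasSum (fun jα : (Fin d → ℤ) × (Fin d → ℕ) => ‖modeCoef L jα.1 jα.2 f‖ ^ 2) (‖f‖ ^ 2) := by
  have h := hasSum_norm_inner_modeLp hL (Complex.ofRealCLM.compLpL 2 (phaseMeasure d L) f)
  have hn : ‖Complex.ofRealCLM.compLpL 2 (phaseMeasure d L) f‖ = ‖f‖ := by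
    refine le_antisymm (Lp.norm_le_norm_of_ae_le ?_) (Lp.norm_le_norm_of_ae_le ?_) <;>
    · filter_upwards [Complex.ofRealCLM.coeFn_compLpL (p := 2) f] with p hp
      rw [hp]; simp
  rw [hn] at h
  simp_rw [modeCoef_eq_inner]
  exact h

theorem IsSolution.modeCoef_eq {L : ℝ} (hL : 0 < L) {op : Collision} {f₀ : PhaseL2 d L}
    {f : ℝ → PhaseL2 d L} (hf : IsSolution op f₀ f) (j : Fin d → ℤ) (α : Fin d → ℕ) {t : ℝ}
    (ht : 0 ≤ t) :
    modeCoef L j α (f t) = modeCoef L j α f₀ +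
      (-decay op α * modeCoef L j α (∫ s in (0 : ℝ)..t, f s) - Complex.I * ladder (frequency L j)
          (fun β => modeCoef L j β (∫ s in (0 : ℝ)..t, f s)) α) := by
  have h := hf.rawCoef_eq hL (-j) α ht
  simp_rw [modeCoef_apply]
  rw [ladder_const_mul, ← neg_neg (frequency L j), ladder_neg, ← frequency_neg]
  linear_combination (((√(L ^ d))⁻¹ : ℝ) : ℂ) * h

theorem hasDerivAt_ladder (ξ : Space d) {c : ℝ → (Fin d → ℕ) → ℂ} {c' : (Fin d → ℕ) → ℂ} {t : ℝ}
    (h : ∀ α, HasDerivAt (fun s => c s α) (c' α) t) (α : Fin d → ℕ) :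
    HasDerivAt (fun s => ladder ξ (c s) α) (ladder ξ c' α) t := by
  have := HasDerivAt.fun_sum (u := Finset.univ) fun (i : Fin d) _ =>
    (((h (up α i)).const_mul ((√(α i + 1) : ℝ) : ℂ)).fun_add
      ((h (down α i)).const_mul ((√(α i) : ℝ) : ℂ))).const_mul (ξ i : ℂ)
  exact this

/-- The fundamental theorem of calculus in the integrated equation. The ladder couples finitely many
coefficients, so each equation holds classically for `t > 0`. -/
theorem IsSolution.hasDerivAt_modeCoef {L : ℝ} (hL : 0 < L) {op : Collision} {f₀ : PhaseL2 d L}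
    {f : ℝ → PhaseL2 d L} (hf : IsSolution op f₀ f) (j : Fin d → ℤ) (α : Fin d → ℕ) {t : ℝ}
    (ht : 0 < t) :
    HasDerivAt (fun s => modeCoef L j α (f s)) (-decay op α * modeCoef L j α (f t)
      - Complex.I * ladder (frequency L j) (fun β => modeCoef L j β (f t)) α) t := by
  have hcont : ContinuousOn f (Set.uIcc 0 t) :=
    hf.continuousOn.mono (by rw [Set.uIcc_of_le ht.le]; exact Set.Icc_subset_Ici_self)
  have hg : HasDerivAt (fun u => ∫ s in (0 : ℝ)..u, f s) (f t) t :=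
    intervalIntegral.integral_hasDerivAt_right hcont.intervalIntegrable
      (ContinuousOn.stronglyMeasurableAtFilter isOpen_Ioi
        (hf.continuousOn.mono Set.Ioi_subset_Ici_self) t ht)
      (hf.continuousOn.continuousAt (Ici_mem_nhds ht))
  have hc : ∀ β, HasDerivAt (fun u => modeCoef L j β (∫ s in (0 : ℝ)..u, f s))
      (modeCoef L j β (f t)) t := fun β => (modeCoef L j β).hasFDerivAt.comp_hasDerivAt t hg
  have h := (((hc α).const_mul (-decay op α : ℂ)).fun_sub
    ((hasDerivAt_ladder (frequency L j) hc α).const_mul Complex.I)).const_add (modeCoef L j α f₀)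
  refine h.congr_of_eventuallyEq ?_
  filter_upwards [Ioi_mem_nhds ht] with s hs
  exact hf.modeCoef_eq hL j α (Set.mem_Ioi.1 hs).le

theorem IsSolution.continuousOn_modeCoef {L : ℝ} {op : Collision} {f₀ : PhaseL2 d L}
    {f : ℝ → PhaseL2 d L} (hf : IsSolution op f₀ f) (j : Fin d → ℤ) (α : Fin d → ℕ) :
    ContinuousOn (fun s => modeCoef L j α (f s)) (Set.Ici 0) :=
  (modeCoef L j α).continuous.comp_continuousOn hf.continuousOn

end Coefficients

/-! ### Decay of the modal functional along solutions -/

section Truncation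

variable {d : ℕ}

/-- The multi-indices of total degree at most `N`. -/
def simplex (d N : ℕ) : Finset (Fin d → ℕ) :=
  (Fintype.piFinset fun _ => Finset.range (N + 1)).filter fun α => ∑ i, α i ≤ N

theorem mem_simplex {N : ℕ} {α : Fin d → ℕ} : α ∈ simplex d N ↔ ∑ i, α i ≤ N := by
  simp only [simplex, Finset.mem_filter, Fintype.mem_piFinset, Finset.mem_range,
    and_iff_right_iff_imp]
  exact fun h i => Nat.lt_succ_of_le ((Finset.single_le_sum (f := α) (fun _ _ => Nat.zero_le _)
    (Finset.mem_univ i)).trans h)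

theorem simplex_mono : Monotone (simplex d) := fun _ _ h _ hα =>
  mem_simplex.2 ((mem_simplex.1 hα).trans h)

theorem up_mem_simplex {N : ℕ} {α : Fin d → ℕ} {i : Fin d} :
    up α i ∈ simplex d (N + 1) ↔ α ∈ simplex d N := by
  rw [mem_simplex, mem_simplex, sum_up]; omega

/-- The squared norm of the coefficients of degree at most `N`. -/
def lowNorm (N : ℕ) (c : (Fin d → ℕ) → ℂ) : ℝ := ∑ α ∈ simplex d N, ‖c α‖ ^ 2

theorem lowNorm_le {c : (Fin d → ℕ) → ℂ} {q : ℝ} (h : HasSum (fun α => ‖c α‖ ^ 2) q) (N : ℕ) :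
    lowNorm N c ≤ q := sum_le_hasSum _ (fun _ _ => by positivity) h

theorem lowNorm_nonneg (N : ℕ) (c : (Fin d → ℕ) → ℂ) : 0 ≤ lowNorm N c :=
  Finset.sum_nonneg fun _ _ => by positivity

theorem tendsto_lowNorm {c : (Fin d → ℕ) → ℂ} {q : ℝ} (h : HasSum (fun α => ‖c α‖ ^ 2) q) :
    Tendsto (fun N => lowNorm N c) atTop (𝓝 q) := by
  have h' : Tendsto (fun s : Finset (Fin d → ℕ) => ∑ α ∈ s, ‖c α‖ ^ 2) atTop (𝓝 q) := by
    simpa [HasSum] using h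
  exact h'.comp (tendsto_atTop_finset_of_monotone simplex_mono fun α =>
    ⟨∑ i, α i, mem_simplex.2 le_rfl⟩)

theorem sum_sdiff_simplex (N : ℕ) (g : (Fin d → ℕ) → ℝ) :
    ∑ α ∈ simplex d (N + 1) \ simplex d N, g α
      = ∑ α ∈ simplex d (N + 1), g α - ∑ α ∈ simplex d N, g α :=
  eq_sub_of_add_eq (Finset.sum_sdiff (simplex_mono N.le_succ))

/-- The transport term only moves mass across the boundary of a simplex. -/
theorem sum_im_conj_mul_ladder (ξ : Space d) (c : (Fin d → ℕ) → ℂ) (N : ℕ) :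
    ∑ α ∈ simplex d (N + 1), ((starRingEnd ℂ) (c α) * ladder ξ c α).im
      = ∑ i, ∑ α ∈ simplex d (N + 1) \ simplex d N,
          ξ i * √(α i + 1) * ((starRingEnd ℂ) (c α) * c (up α i)).im := by
  have e : ∀ α, ((starRingEnd ℂ) (c α) * ladder ξ c α).im
      = ∑ i, (ξ i * √(α i + 1) * ((starRingEnd ℂ) (c α) * c (up α i)).im
        + ξ i * √(α i) * ((starRingEnd ℂ) (c α) * c (down α i)).im) := fun α => by
    rw [ladder, Finset.mul_sum, Complex.im_sum]
    refine Finset.sum_congr rfl fun i _ => ?_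
    rw [show (starRingEnd ℂ) (c α) * ((ξ i : ℂ) * ((√(α i + 1) : ℝ) * c (up α i)
        + (√(α i) : ℝ) * c (down α i))) = ((ξ i * √(α i + 1) : ℝ) : ℂ)
        * ((starRingEnd ℂ) (c α) * c (up α i)) + ((ξ i * √(α i) : ℝ) : ℂ)
        * ((starRingEnd ℂ) (c α) * c (down α i)) by push_cast; ring,
      Complex.add_im, Complex.im_ofReal_mul, Complex.im_ofReal_mul]
  simp_rw [e]
  rw [Finset.sum_comm]
  refine Finset.sum_congr rfl fun i _ => ?_
  rw [sum_sdiff_simplex, Finset.sum_add_distrib, sub_eq_add_neg]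
  congr 1
  have h1 : (simplex d N).image (fun α => up α i) ⊆ simplex d (N + 1) := fun β hβ => by
    obtain ⟨α, hα, rfl⟩ := Finset.mem_image.1 hβ
    exact up_mem_simplex.2 hα
  rw [← Finset.sum_subset h1 fun β hβ hβ' => ?_, Finset.sum_image (up_injective i).injOn,
    ← Finset.sum_neg_distrib]
  · refine Finset.sum_congr rfl fun α _ => ?_
    rw [down_up, up_self]
    simp only [Complex.mul_im, Complex.conj_re, Complex.conj_im]
    push_cast
    ring
  · by_cases hz : β i = 0
    · simp [hz]
    · refine absurd (Finset.mem_image.2 ⟨down β i, ?_, up_down β i hz⟩) hβ'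
      rw [← up_mem_simplex (i := i), up_down β i hz]
      exact hβ

/-- The flux pairs the shell of degree `N + 1` with that of degree `N + 2`, and `ab ≤ a² + b²`
splits each product. The weight `√(N + 2)` grows too slowly to survive averaging. -/
theorem abs_sum_im_conj_mul_ladder_le (ξ : Space d) (c : (Fin d → ℕ) → ℂ) (N : ℕ) :
    |∑ α ∈ simplex d (N + 1), ((starRingEnd ℂ) (c α) * ladder ξ c α).im|
      ≤ (∑ i, |ξ i|) * √(N + 2) * (lowNorm (N + 2) c - lowNorm N c) := by
  rw [sum_im_conj_mul_ladder, mul_assoc, Finset.sum_mul]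
  refine (Finset.abs_sum_le_sum_abs _ _).trans (Finset.sum_le_sum fun i _ => ?_)
  have hA : ∑ α ∈ simplex d (N + 1) \ simplex d N, ‖c α‖ ^ 2
      = lowNorm (N + 1) c - lowNorm N c := sum_sdiff_simplex N _
  have hB : ∑ α ∈ simplex d (N + 1) \ simplex d N, ‖c (up α i)‖ ^ 2
      ≤ lowNorm (N + 2) c - lowNorm (N + 1) c := by
    rw [lowNorm, lowNorm, ← sum_sdiff_simplex, ← Finset.sum_image (f := fun α => ‖c α‖ ^ 2)
      (up_injective i).injOn]
    refine Finset.sum_le_sum_of_subset_of_nonneg (fun β hβ => ?_) fun _ _ _ => by positivity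
    obtain ⟨α, hα, rfl⟩ := Finset.mem_image.1 hβ
    rw [Finset.mem_sdiff] at hα ⊢
    rwa [up_mem_simplex, up_mem_simplex]
  calc |∑ α ∈ simplex d (N + 1) \ simplex d N,
        ξ i * √(α i + 1) * ((starRingEnd ℂ) (c α) * c (up α i)).im|
      ≤ ∑ α ∈ simplex d (N + 1) \ simplex d N,
        |ξ i| * √(N + 2) * (‖c α‖ ^ 2 + ‖c (up α i)‖ ^ 2) := by
        refine (Finset.abs_sum_le_sum_abs _ _).trans (Finset.sum_le_sum fun α hα => ?_)
        rw [abs_mul, abs_mul, abs_of_nonneg (Real.sqrt_nonneg _)]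
        have h1 : α i ≤ N + 1 := (Finset.single_le_sum (f := α) (fun _ _ => Nat.zero_le _)
          (Finset.mem_univ i)).trans (mem_simplex.1 (Finset.mem_sdiff.1 hα).1)
        have h2 : (α i : ℝ) + 1 ≤ N + 2 := by
          have : (α i : ℝ) ≤ N + 1 := by exact_mod_cast h1
          linarith
        have h3 : |((starRingEnd ℂ) (c α) * c (up α i)).im| ≤ ‖c α‖ ^ 2 + ‖c (up α i)‖ ^ 2 := by
          refine (Complex.abs_im_le_norm _).trans ?_
          rw [norm_mul, RCLike.norm_conj]
          nlinarith [sq_nonneg (‖c α‖ - ‖c (up α i)‖), norm_nonneg (c α), norm_nonneg (c (up α i))]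
        gcongr
    _ = |ξ i| * (√(N + 2) * (∑ α ∈ simplex d (N + 1) \ simplex d N, ‖c α‖ ^ 2
        + ∑ α ∈ simplex d (N + 1) \ simplex d N, ‖c (up α i)‖ ^ 2)) := by
        rw [← Finset.sum_add_distrib, ← Finset.mul_sum, mul_assoc]
    _ ≤ |ξ i| * (√(N + 2) * (lowNorm (N + 2) c - lowNorm N c)) := by
        gcongr
        linarith

/-- Every difference consists of two consecutive shells, so the sum splits into two telescoping
ones. -/
theorem sum_lowNorm_sub_le {c : (Fin d → ℕ) → ℂ} {q : ℝ} (h : HasSum (fun α => ‖c α‖ ^ 2) q)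
    (M : ℕ) : ∑ k ∈ Finset.range M, (lowNorm (k + 1 + 2) c - lowNorm (k + 1) c) ≤ 2 * q := by
  have e : ∀ k, lowNorm (k + 1 + 2) c - lowNorm (k + 1) c
      = (lowNorm (k + 1 + 2) c - lowNorm (k + 2) c)
        + (lowNorm (k + 1 + 1) c - lowNorm (k + 1) c) := fun k => by ring
  simp_rw [e]
  rw [Finset.sum_add_distrib, Finset.sum_range_sub (fun k => lowNorm (k + 2) c),
    Finset.sum_range_sub (fun k => lowNorm (k + 1) c)]
  linarith [lowNorm_le h (M + 2), lowNorm_le h (M + 1), lowNorm_nonneg (0 + 2) c,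
    lowNorm_nonneg (0 + 1) c]

/-- The entropy - entropy production inequality for truncated coefficients. -/
theorem mul_entropyC_lowNorm_le {op : Collision} {ξ : Space d} {lam δ : ℝ}
    (h : ∀ F : Space d → ℂ, Admissible op ξ F → lam * entropyH ξ δ F ≤ productionD op ξ δ F)
    (c : (Fin d → ℕ) → ℂ) (k : ℕ) : lam * entropyC ξ δ (lowNorm (k + 2) c) c
      ≤ ∑ α ∈ simplex d (k + 2), decay op α * ‖c α‖ ^ 2 + δ / jap ξ * twistC ξ c := by
  have h0 := h _ (admissible_trial op ξ (simplex d (k + 2)) c)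
  rw [entropyH_eq (memLp_trial _ c), productionD_eq (admissible_trial op ξ _ c), sqNorm_trial,
    ip_collisionOp_trial] at h0
  simp_rw [coef_trial] at h0
  -- The twist involves degrees at most two, so truncating at degree `k + 2` leaves it unchanged.
  have hu : ∀ i : Fin d, up 0 i ∈ simplex d (k + 2) := fun i =>
    mem_simplex.2 (by rw [sum_up]; simp)
  have huu : ∀ i j : Fin d, up (up 0 i) j ∈ simplex d (k + 2) := fun i j =>
    mem_simplex.2 (by rw [sum_up, sum_up]; simp)
  have hz : (0 : Fin d → ℕ) ∈ simplex d (k + 2) := mem_simplex.2 (by simp)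
  have e1 : ladder ξ (fun β => if β ∈ simplex d (k + 2) then c β else 0) 0 = ladder ξ c 0 := by
    rw [ladder_zero, ladder_zero]
    exact Finset.sum_congr rfl fun i _ => by rw [if_pos (hu i)]
  have e2 : ladder ξ (ladder ξ fun β => if β ∈ simplex d (k + 2) then c β else 0) 0
      = ladder ξ (ladder ξ c) 0 := by
    rw [ladder_ladder_zero, ladder_ladder_zero]
    simp only [huu, hz, if_true]
  rw [entropyC, twistC, e1, e2, if_pos hz] at h0
  exact h0

end Truncation

/-! ### Gronwall's inequality for truncated entropies and removal of the truncation -/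

section Evolution

variable {d : ℕ}

/-- Gronwall's lemma with a constant source: `exp (lam t) (G t - e / lam)` is nonincreasing. -/
theorem le_exp_mul_of_deriv_le {G G' : ℝ → ℝ} {lam e T : ℝ} (hlam : 0 < lam) (hT : 0 ≤ T)
    (hc : ContinuousOn G (Set.Ici 0)) (hd : ∀ t, 0 < t → HasDerivAt G (G' t) t)
    (hle : ∀ t ∈ Set.Ioo 0 T, G' t ≤ -lam * G t + e) :
    G T ≤ Real.exp (-lam * T) * (G 0 - e / lam) + e / lam := by
  have hder : ∀ t, 0 < t → HasDerivAt (fun s => Real.exp (lam * s) * (G s - e / lam))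
      (Real.exp (lam * t) * (lam * 1) * (G t - e / lam) + Real.exp (lam * t) * G' t) t :=
    fun t ht => (((hasDerivAt_id' t).const_mul lam).exp).mul ((hd t ht).sub_const _)
  have hanti : AntitoneOn (fun s => Real.exp (lam * s) * (G s - e / lam)) (Set.Icc 0 T) := by
    refine antitoneOn_of_deriv_nonpos (convex_Icc 0 T) ?_ ?_ ?_
    · exact (Continuous.continuousOn (by fun_prop)).mul
        ((hc.mono Set.Icc_subset_Ici_self).sub continuousOn_const)
    · rw [interior_Icc]
      exact fun t ht => (hder t ht.1).differentiableAt.differentiableWithinAt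
    · rw [interior_Icc]
      intro t ht
      rw [(hder t ht.1).deriv]
      have h1 := hle t ht
      have h2 : Real.exp (lam * t) * (lam * 1) * (G t - e / lam) + Real.exp (lam * t) * G' t
          = Real.exp (lam * t) * (lam * G t - e + G' t) := by
        field_simp
      rw [h2]
      exact mul_nonpos_of_nonneg_of_nonpos (Real.exp_pos _).le (by linarith)
  have h := hanti (Set.left_mem_Icc.2 hT) (Set.right_mem_Icc.2 hT) hT
  simp only [mul_zero, Real.exp_zero, one_mul] at h
  have h2 : G T - e / lam = Real.exp (-lam * T) * (Real.exp (lam * T) * (G T - e / lam)) := by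
    rw [← mul_assoc, ← Real.exp_add, neg_mul, neg_add_cancel, Real.exp_zero, one_mul]
  have h3 := mul_le_mul_of_nonneg_left h (Real.exp_pos (-lam * T)).le
  rw [← h2] at h3
  linarith

theorem hasDerivAt_norm_sq {z : ℝ → ℂ} {w : ℂ} {t : ℝ} (h : HasDerivAt z w t) :
    HasDerivAt (fun s => ‖z s‖ ^ 2) (2 * ((starRingEnd ℂ) (z t) * w).re) t := by
  have h1 := h.norm_sq
  rw [Complex.inner, mul_comm] at h1
  rw [mul_comm ((starRingEnd ℂ) (z t))]
  rw [mul_comm]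
  simpa [mul_comm] using h1

variable {op : Collision} {ξ : Space d} {c : ℝ → (Fin d → ℕ) → ℂ}

/-- The twist is differentiated exactly, since it closes on the degrees up to two. The truncated
norm differs from its formal balance only by the flux of the transport term. -/
theorem hasDerivAt_entropyC_lowNorm {t : ℝ} (δ : ℝ) (k : ℕ)
    (hder : ∀ α, HasDerivAt (fun s => c s α)
      (-decay op α * c t α - Complex.I * ladder ξ (c t) α) t) :
    HasDerivAt (fun s => entropyC ξ δ (lowNorm (k + 2) (c s)) (c s))
      (∑ α ∈ simplex d (k + 2), ((starRingEnd ℂ) (c t α) * ladder ξ (c t) α).im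
        - (∑ α ∈ simplex d (k + 2), decay op α * ‖c t α‖ ^ 2 + δ / jap ξ * twistC ξ (c t))) t := by
  have h1 : HasDerivAt (fun s => lowNorm (k + 2) (c s))
      (∑ α ∈ simplex d (k + 2), 2 * ((starRingEnd ℂ) (c t α)
        * (-decay op α * c t α - Complex.I * ladder ξ (c t) α)).re) t :=
    HasDerivAt.fun_sum fun α _ => hasDerivAt_norm_sq (hder α)
  have h2 := hasDerivAt_ladder ξ hder 0
  have h3 : HasDerivAt (fun s => (starRingEnd ℂ) (c s 0)) _ t := (hder 0).star
  have h4 : HasDerivAt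
      (fun s => (-Complex.I * ladder ξ (c s) 0 * (starRingEnd ℂ) (c s 0)).re) _ t :=
    Complex.reCLM.hasFDerivAt.comp_hasDerivAt t ((h2.const_mul (-Complex.I)).mul h3)
  have h5 := (h1.div_const 2).add (h4.const_mul (δ / jap ξ))
  refine HasDerivAt.congr_deriv (f := fun s => entropyC ξ δ (lowNorm (k + 2) (c s)) (c s)) h5 ?_
  have e1 : (∑ α ∈ simplex d (k + 2), 2 * ((starRingEnd ℂ) (c t α)
        * (-decay op α * c t α - Complex.I * ladder ξ (c t) α)).re) / 2
      = ∑ α ∈ simplex d (k + 2), ((starRingEnd ℂ) (c t α) * ladder ξ (c t) α).im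
        - ∑ α ∈ simplex d (k + 2), decay op α * ‖c t α‖ ^ 2 := by
    rw [Finset.sum_div, ← Finset.sum_sub_distrib]
    refine Finset.sum_congr rfl fun α _ => ?_
    rw [← Complex.normSq_eq_norm_sq, Complex.normSq_apply]
    simp
    ring
  have e2 : ladder ξ (fun α => -decay op α * c t α - Complex.I * ladder ξ (c t) α) 0
      = -ladder ξ (c t) 0 - Complex.I * ladder ξ (ladder ξ (c t)) 0 := by
    rw [ladder_sub, ladder_const_mul, ladder_zero, ladder_zero ξ (c t), ← Finset.sum_neg_distrib]
    congr 1
    refine Finset.sum_congr rfl fun i _ => ?_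
    rw [decay_up_zero]; simp
  rw [e1, e2, decay_zero, twistC, ← Complex.normSq_eq_norm_sq, Complex.normSq_apply]
  simp
  ring

/-- A single truncation leaves an uncontrolled flux. Summing over `k < M` lets each shell be counted
at most twice, so the total flux is at most `C √(M + 3)`; after division by `M` it vanishes, while
the Cesàro means of the truncated entropies converge to the full entropy. -/
theorem entropyC_le_of_production {lam δ : ℝ} (hlam : 0 < lam) {q : ℝ → ℝ} {Q T : ℝ} (hT : 0 ≤ T)
    (hcont : ∀ α, ContinuousOn (fun s => c s α) (Set.Ici 0))
    (hder : ∀ t, 0 < t → ∀ α, HasDerivAt (fun s => c s α)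
      (-decay op α * c t α - Complex.I * ladder ξ (c t) α) t)
    (hq : ∀ t, 0 ≤ t → HasSum (fun α => ‖c t α‖ ^ 2) (q t))
    (hQ : ∀ t ∈ Set.Icc 0 T, q t ≤ Q)
    (h : ∀ F : Space d → ℂ, Admissible op ξ F → lam * entropyH ξ δ F ≤ productionD op ξ δ F) :
    entropyC ξ δ (q T) (c T) ≤ Real.exp (-lam * T) * entropyC ξ δ (q 0) (c 0) := by
  set E : ℕ → ℝ → ℝ := fun k s => entropyC ξ δ (lowNorm (k + 2) (c s)) (c s) with hE
  set C := (∑ i, |ξ i|) * (2 * Q)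
  have hC0 : 0 ≤ ∑ i, |ξ i| := Finset.sum_nonneg fun _ _ => abs_nonneg _
  have hlc : ∀ α, ContinuousOn (fun s => ladder ξ (c s) α) (Set.Ici 0) := fun α =>
    continuousOn_finsetSum _ fun i _ => continuousOn_const.mul
      ((continuousOn_const.mul (hcont _)).add (continuousOn_const.mul (hcont _)))
  have hEc : ∀ k, ContinuousOn (E k) (Set.Ici 0) := fun k =>
    ((continuousOn_finsetSum _ fun α _ => (hcont α).norm.pow 2).div_const 2).add
      (continuousOn_const.mul (Complex.continuous_re.comp_continuousOn
        ((continuousOn_const.mul (hlc 0)).mul (Complex.continuous_conj.comp_continuousOn (hcont 0)))))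
  have hgron : ∀ M : ℕ, ∑ k ∈ Finset.range M, E k T
      ≤ Real.exp (-lam * T) * (∑ k ∈ Finset.range M, E k 0 - C * √(M + 3) / lam)
        + C * √(M + 3) / lam := fun M => by
    refine le_exp_mul_of_deriv_le (G := fun s => ∑ k ∈ Finset.range M, E k s) hlam hT
      (continuousOn_finsetSum _ fun k _ => hEc k)
      (fun t ht => HasDerivAt.fun_sum fun k _ => hasDerivAt_entropyC_lowNorm δ k (hder t ht))
      fun t ht => ?_
    have h1 : ∀ k ∈ Finset.range M,
        (∑ α ∈ simplex d (k + 2), ((starRingEnd ℂ) (c t α) * ladder ξ (c t) α).im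
        - (∑ α ∈ simplex d (k + 2), decay op α * ‖c t α‖ ^ 2 + δ / jap ξ * twistC ξ (c t)))
        ≤ -lam * E k t + (∑ i, |ξ i|) * √(M + 3)
          * (lowNorm (k + 1 + 2) (c t) - lowNorm (k + 1) (c t)) := fun k hk => by
      have h2 := (le_abs_self _).trans (abs_sum_im_conj_mul_ladder_le ξ (c t) (k + 1))
      have h3 := mul_entropyC_lowNorm_le h (c t) k
      have h4 : √(((k + 1 : ℕ) : ℝ) + 2) ≤ √(M + 3) := by
        refine Real.sqrt_le_sqrt ?_
        have : ((k + 1 : ℕ) : ℝ) ≤ M := by exact_mod_cast Finset.mem_range.1 hk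
        linarith
      have h5 : 0 ≤ lowNorm (k + 1 + 2) (c t) - lowNorm (k + 1) (c t) :=
        sub_nonneg.2 (Finset.sum_le_sum_of_subset_of_nonneg (simplex_mono (by omega))
          fun _ _ _ => by positivity)
      have h6 := mul_le_mul_of_nonneg_right (mul_le_mul_of_nonneg_left h4 hC0) h5
      simp only [hE]
      linarith
    refine (Finset.sum_le_sum h1).trans ?_
    rw [Finset.sum_add_distrib, ← Finset.mul_sum, ← Finset.mul_sum]
    have h7 := (sum_lowNorm_sub_le (hq t ht.1.le) M).trans
      (mul_le_mul_of_nonneg_left (hQ t ⟨ht.1.le, ht.2.le⟩) zero_le_two)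
    have h8 := mul_le_mul_of_nonneg_left h7 (mul_nonneg hC0 (Real.sqrt_nonneg ((M : ℝ) + 3)))
    simp only [C]
    linarith
  have hlim : ∀ s, 0 ≤ s → Tendsto (fun M : ℕ => (M⁻¹ : ℝ) * ∑ k ∈ Finset.range M, E k s) atTop
      (𝓝 (entropyC ξ δ (q s) (c s))) := fun s hs => by
    refine Filter.Tendsto.cesaro ?_
    exact ((((tendsto_lowNorm (hq s hs)).comp (tendsto_add_atTop_nat 2)).div_const 2).add_const _)
  have hsq : Tendsto (fun M : ℕ => (M⁻¹ : ℝ) * √(M + 3)) atTop (𝓝 0) := by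
    have h1 : Tendsto (fun M : ℕ => √((M : ℝ)⁻¹ + 3 * ((M : ℝ)⁻¹) ^ 2)) atTop (𝓝 0) := by
      have h2 := tendsto_inv_atTop_nhds_zero_nat (𝕜 := ℝ)
      simpa using (h2.add ((h2.pow 2).const_mul 3)).sqrt
    refine h1.congr' ?_
    filter_upwards [eventually_gt_atTop 0] with M hM
    have hM' : (0 : ℝ) < M := by exact_mod_cast hM
    rw [← Real.sqrt_sq (inv_pos.2 hM').le, ← Real.sqrt_mul (by positivity)]
    congr 1
    rw [Real.sqrt_sq (inv_pos.2 hM').le]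
    field_simp
  have hr := (((hlim 0 le_rfl).sub (hsq.const_mul (C / lam))).const_mul
    (Real.exp (-lam * T))).add (hsq.const_mul (C / lam))
  simp only [mul_zero, sub_zero, add_zero] at hr
  refine le_of_tendsto_of_tendsto' (hlim T hT) hr fun M => ?_
  have := mul_le_mul_of_nonneg_left (hgron M) (inv_nonneg.2 (Nat.cast_nonneg (α := ℝ) M))
  refine this.trans (le_of_eq ?_)
  ring

/-- Decay of a single Fourier mode. -/
theorem norm_sq_decay_of_production {lam δ κ : ℝ} (hlam : 0 < lam) (hδ : 0 ≤ δ)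
    (hκ : δ / jap ξ * ‖ξ‖ ≤ κ) {q : ℝ → ℝ} {Q T : ℝ} (hT : 0 ≤ T)
    (hcont : ∀ α, ContinuousOn (fun s => c s α) (Set.Ici 0))
    (hder : ∀ t, 0 < t → ∀ α, HasDerivAt (fun s => c s α)
      (-decay op α * c t α - Complex.I * ladder ξ (c t) α) t)
    (hq : ∀ t, 0 ≤ t → HasSum (fun α => ‖c t α‖ ^ 2) (q t))
    (hQ : ∀ t ∈ Set.Icc 0 T, q t ≤ Q)
    (h : ∀ F : Space d → ℂ, Admissible op ξ F → lam * entropyH ξ δ F ≤ productionD op ξ δ F) :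
    (1 - κ) * q T ≤ Real.exp (-lam * T) * ((1 + κ) * q 0) := by
  have hb : ∀ t, 0 ≤ t → |entropyC ξ δ (q t) (c t) - q t / 2| ≤ κ * (q t / 2) := fun t ht => by
    have h0 : ‖c t 0‖ ^ 2 ≤ q t := by
      have := sum_le_hasSum {0} (fun α _ => by positivity) (hq t ht)
      simpa using this
    have hs := Real.sq_sqrt (sub_nonneg.2 h0)
    -- The two factors have squares summing to `q t`, so `ab ≤ (a² + b²)/2` gives the factor one
    -- half.
    have h1 : √(q t - ‖c t 0‖ ^ 2) * ‖c t 0‖ ≤ q t / 2 := by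
      nlinarith [sq_nonneg (√(q t - ‖c t 0‖ ^ 2) - ‖c t 0‖)]
    have h2 : 0 ≤ δ / jap ξ * ‖ξ‖ := by have := jap_pos ξ; positivity
    refine (abs_entropyC_sub_le (hq t ht) ξ hδ).trans ?_
    calc δ / jap ξ * (‖ξ‖ * √(q t - ‖c t 0‖ ^ 2) * ‖c t 0‖)
        = δ / jap ξ * ‖ξ‖ * (√(q t - ‖c t 0‖ ^ 2) * ‖c t 0‖) := by ring
      _ ≤ δ / jap ξ * ‖ξ‖ * (q t / 2) := mul_le_mul_of_nonneg_left h1 h2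
      _ ≤ κ * (q t / 2) := mul_le_mul_of_nonneg_right hκ
          (by linarith [sq_nonneg ‖c t 0‖])
  have hE := entropyC_le_of_production hlam hT hcont hder hq hQ h
  have hT' := (abs_le.1 (hb T hT)).1
  have h0' := (abs_le.1 (hb 0 le_rfl)).2
  have h0'' : entropyC ξ δ (q 0) (c 0) ≤ (1 + κ) * q 0 / 2 := by linarith
  have := mul_le_mul_of_nonneg_left h0'' (Real.exp_pos (-lam * T)).le
  linarith

end Evolution

/-! ### Decay to equilibrium -/

section Equilibrium

variable {d : ℕ}

theorem phaseMeasure_eq_withDensity (L : ℝ) : phaseMeasure d L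
    = ((volume.restrict (cube d L)).prod (volume : Measure (Space d))).withDensity
      fun p => ENNReal.ofReal (maxwellian d p.2)⁻¹ := by
  rw [phaseMeasure, gammaMeasure, prod_withDensity_right measurable_maxwellian_inv]

theorem integral_phase {V : Type*} [NormedAddCommGroup V] [NormedSpace ℝ V] (L : ℝ)
    (F : Space d × Space d → V) : ∫ p, F p ∂(phaseMeasure d L)
      = ∫ p, (maxwellian d p.2)⁻¹ • F p
        ∂((volume.restrict (cube d L)).prod (volume : Measure (Space d))) := by
  have hm : Measurable fun p : Space d × Space d => ENNReal.ofReal (maxwellian d p.2)⁻¹ :=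
    measurable_maxwellian_inv.comp measurable_snd
  rw [phaseMeasure_eq_withDensity, integral_withDensity_eq_integral_toReal_smul hm (ae_of_all _ fun _ => ENNReal.ofReal_lt_top)]
  simp_rw [ENNReal.toReal_ofReal (inv_pos.2 (maxwellian_pos _)).le]

theorem frequency_zero (L : ℝ) : frequency L (0 : Fin d → ℤ) = 0 := by
  ext i; simp [frequency_apply]

theorem wave_zero (x : Space d) : wave 0 x = 1 := by simp [wave]

theorem modeCoef_zero_zero {L : ℝ} (hL : 0 < L) (f : PhaseL2 d L) :
    modeCoef L 0 0 f = ((√(L ^ d) * average f : ℝ) : ℂ) := by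
  rw [modeCoef_apply, rawCoef, pairing_apply, neg_zero, frequency_zero, average, integral_phase]
  have e : ∀ p : Space d × Space d, (maxwellian d p.2)⁻¹ • (wave 0 p.1
      * (hermF (0 : Fin d → ℕ) p.2 : ℂ) * (f p : ℂ)) = (f p : ℂ) := fun p => by
    have hM : (maxwellian d p.2 : ℂ) ≠ 0 := by exact_mod_cast (maxwellian_pos p.2).ne'
    rw [wave_zero, hermF_zero, Complex.real_smul, Complex.ofReal_inv]
    field_simp
  simp_rw [e]
  rw [integral_complex_ofReal, ← Complex.ofReal_mul]
  congr 1
  rw [← mul_assoc]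
  congr 1
  have h := Real.sq_sqrt (pow_pos hL d).le
  have h' : √(L ^ d) ≠ 0 := (Real.sqrt_pos.2 (pow_pos hL d)).ne'
  rw [← h]
  field_simp
  rw [Real.sqrt_sq (Real.sqrt_nonneg _)]

theorem norm_sq_eq_integral {X : Type*} [MeasurableSpace X] {μ : Measure X} (h : Lp ℂ 2 μ) :
    ‖h‖ ^ 2 = ∫ p, ‖h p‖ ^ 2 ∂μ := by
  rw [← inner_self_eq_norm_sq (𝕜 := ℂ) h, L2.inner_def, ← integral_re (L2.integrable_inner h h)]
  refine integral_congr_ae (ae_of_all _ fun p => ?_)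
  exact inner_self_eq_norm_sq (𝕜 := ℂ) (h p)

/-- The hypothesis says that `c M` is the orthogonal projection onto the mode `(0, 0)`, so this is
Pythagoras. -/
theorem sqDistEquilibrium_eq {L : ℝ} (hL : 0 < L) (f : PhaseL2 d L) {c : ℝ}
    (hc : modeCoef L 0 0 f = ((√(L ^ d) * c : ℝ) : ℂ)) :
    sqDistEquilibrium f c = ‖f‖ ^ 2 - ‖modeCoef L 0 0 f‖ ^ 2 := by
  set g := Complex.ofRealCLM.compLpL 2 (phaseMeasure d L) f
  set a : ℂ := ((√(L ^ d) * c : ℝ) : ℂ) with ha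
  have h1 : sqDistEquilibrium f c = ‖g - a • modeLp L (0, 0)‖ ^ 2 := by
    rw [norm_sq_eq_integral, sqDistEquilibrium]
    refine integral_congr_ae ?_
    filter_upwards [Lp.coeFn_sub g (a • modeLp L (0, 0)), Lp.coeFn_smul a (modeLp (d := d) L (0, 0)),
      (memLp_mode (d := d) L 0 0).coeFn_toLp, Complex.ofRealCLM.coeFn_compLpL (p := 2) f]
      with p h1 h2 h3 h4
    have h' : (√(L ^ d) : ℂ) ≠ 0 := by exact_mod_cast (Real.sqrt_pos.2 (pow_pos hL d)).ne'
    have h5 : a * mode L 0 0 p = ((c * maxwellian d p.2 : ℝ) : ℂ) := by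
      rw [mode, frequency_zero, wave_zero, hermF_zero, ha]
      push_cast
      field_simp
    rw [h1, Pi.sub_apply, h2, Pi.smul_apply, modeLp, h3, h4, smul_eq_mul, h5,
      Complex.ofRealCLM_apply, ← Complex.ofReal_sub, Complex.norm_real, Real.norm_eq_abs]
  have h2 : HasSum _ _ := hasSum_norm_inner_modeLp hL g
  have h3 : HasSum _ _ := hasSum_norm_modeCoef hL f
  simp_rw [modeCoef_eq_inner] at h3
  have hn : ‖g‖ ^ 2 = ‖f‖ ^ 2 := h2.unique h3
  have hin : ⟪g, modeLp L (0, 0)⟫_ℂ = (starRingEnd ℂ) a := by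
    rw [← inner_conj_symm, ← modeCoef_eq_inner, hc]
  rw [h1, norm_sub_sq (𝕜 := ℂ), inner_smul_right, hin, norm_smul,
    (orthonormal_modeLp hL).1 (0, 0), hn, hc, Complex.mul_conj, Complex.normSq_eq_norm_sq,
    RCLike.re_eq_complex_re, Complex.ofReal_re]
  ring

/-- Conservation of mass: transport vanishes at frequency zero and the Maxwellian is in the kernel
of the collisions. -/
theorem IsSolution.modeCoef_zero_zero_eq {L : ℝ} (hL : 0 < L) {op : Collision} {f₀ : PhaseL2 d L}
    {f : ℝ → PhaseL2 d L} (hf : IsSolution op f₀ f) {t : ℝ} (ht : 0 ≤ t) :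
    modeCoef L 0 0 (f t) = modeCoef L 0 0 f₀ := by
  rw [hf.modeCoef_eq hL 0 0 ht, decay_zero, frequency_zero, ladder_zero]
  simp

/-- The spatially homogeneous modes are damped by the collisions. -/
theorem IsSolution.norm_sq_modeCoef_zero_le {L : ℝ} (hL : 0 < L) {op : Collision}
    {f₀ : PhaseL2 d L} {f : ℝ → PhaseL2 d L} (hf : IsSolution op f₀ f) {α : Fin d → ℕ}
    (hα : α ≠ 0) {T : ℝ} (hT : 0 ≤ T) :
    ‖modeCoef L 0 α (f T)‖ ^ 2 ≤ Real.exp (-2 * T) * ‖modeCoef L 0 α (f 0)‖ ^ 2 := by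
  have h := le_exp_mul_of_deriv_le (G := fun s => ‖modeCoef L 0 α (f s)‖ ^ 2) (e := 0)
    -- The squared modulus decays at twice the spectral gap, whence the 2 in the minimum.
    zero_lt_two hT ((hf.continuousOn_modeCoef 0 α).norm.pow 2)
    (fun t ht => hasDerivAt_norm_sq (hf.hasDerivAt_modeCoef hL 0 α ht)) fun t _ => by
      have h1 := one_le_decay op hα
      rw [frequency_zero, show ∀ c : (Fin d → ℕ) → ℂ, ladder 0 c α = 0 from
        fun c => by simp [ladder]]
      rw [← Complex.normSq_eq_norm_sq, Complex.normSq_apply]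
      simp only [mul_zero, sub_zero, Complex.mul_re, Complex.conj_re, Complex.conj_im,
        Complex.neg_re, Complex.neg_im, Complex.ofReal_re, Complex.ofReal_im, Complex.mul_im,
        neg_zero, zero_mul]
      nlinarith [mul_self_nonneg (modeCoef L 0 α (f t)).re, mul_self_nonneg (modeCoef L 0 α (f t)).im]
  simpa using h

theorem IsSolution.hasSum_sqDistEquilibrium {L : ℝ} (hL : 0 < L) {op : Collision}
    {f₀ : PhaseL2 d L} {f : ℝ → PhaseL2 d L} (hf : IsSolution op f₀ f) {t : ℝ} (ht : 0 ≤ t) :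
    HasSum (fun jα : (Fin d → ℤ) × (Fin d → ℕ) =>
      if jα = 0 then 0 else ‖modeCoef L jα.1 jα.2 (f t)‖ ^ 2)
      (sqDistEquilibrium (f t) (average f₀)) := by
  have h := (hasSum_norm_modeCoef hL (f t)).update 0 (0 : ℝ)
  rw [sqDistEquilibrium_eq hL (f t) (c := average f₀)
    ((hf.modeCoef_zero_zero_eq hL ht).trans (modeCoef_zero_zero hL f₀))]
  have e : (fun jα : (Fin d → ℤ) × (Fin d → ℕ) =>
      if jα = 0 then 0 else ‖modeCoef L jα.1 jα.2 (f t)‖ ^ 2)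
      = Function.update (fun jα : (Fin d → ℤ) × (Fin d → ℕ) =>
        ‖modeCoef L jα.1 jα.2 (f t)‖ ^ 2) 0 0 := by
    ext jα
    rw [Function.update_apply]
  rw [e, show ‖f t‖ ^ 2 - ‖modeCoef L 0 0 (f t)‖ ^ 2
    = 0 - ‖modeCoef L 0 0 (f t)‖ ^ 2 + ‖f t‖ ^ 2 by ring]
  exact h

/-- The modes are orthogonal, so it suffices to bound each separately: `j ≠ 0` by the twisted
entropy with `κ = dL`, and `j = 0`, `α ≠ 0` by the collisions alone. -/
theorem IsSolution.sqDistEquilibrium_le {L : ℝ} (hL : 0 < L) {op : Collision}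
    {f₀ : PhaseL2 d L} {f : ℝ → PhaseL2 d L} (hf : IsSolution op f₀ f) {ε rate : ℝ}
    (hε : 0 < ε) (hκ : d * L * (2 + ε) ≤ ε) (hrate : rate ≤ 2)
    (h : ∀ j : Fin d → ℤ, j ≠ 0 → ∃ lam δ : ℝ, 0 < lam ∧
      rate < lam ∧ 0 < δ ∧ δ / jap (frequency L j) * ‖frequency L j‖ ≤ d * L ∧
      ∀ F : Space d → ℂ, Admissible op (frequency L j) F →
        lam * entropyH (frequency L j) δ F ≤ productionD op (frequency L j) δ F)
    {T : ℝ} (hT : 0 ≤ T) :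
    sqDistEquilibrium (f T) (average f₀)
      ≤ (1 + ε) * sqDistEquilibrium f₀ (average f₀) * Real.exp (-rate * T) := by
  have hq : ∀ (j : Fin d → ℤ) (t : ℝ), HasSum (fun α => ‖modeCoef L j α (f t)‖ ^ 2)
      (∑' α, ‖modeCoef L j α (f t)‖ ^ 2) := fun j t =>
    ((hasSum_norm_modeCoef hL (f t)).summable.prod_factor j).hasSum
  have hQ : ∀ (j : Fin d → ℤ) (t : ℝ), ∑' α, ‖modeCoef L j α (f t)‖ ^ 2 ≤ ‖f t‖ ^ 2 := fun j t =>
    le_hasSum ((hasSum_norm_modeCoef hL (f t)).prod_fiberwise (hq · t)) j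
      fun k _ => tsum_nonneg fun α => by positivity
  obtain ⟨C, hC⟩ := (isCompact_Icc (a := (0 : ℝ)) (b := T)).exists_bound_of_continuousOn
    (hf.continuousOn.mono Set.Icc_subset_Ici_self)
  have hCQ : ∀ t ∈ Set.Icc 0 T, ‖f t‖ ^ 2 ≤ C ^ 2 := fun t ht =>
    pow_le_pow_left₀ (norm_nonneg _) (hC t ht) 2
  have hexp : ∀ r, rate ≤ r → Real.exp (-r * T) ≤ Real.exp (-rate * T) := fun r hr =>
    Real.exp_le_exp.2 (by nlinarith)
  have hmode : ∀ j : Fin d → ℤ, j ≠ 0 → ∑' α, ‖modeCoef L j α (f T)‖ ^ 2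
      ≤ (1 + ε) * Real.exp (-rate * T) * ∑' α, ‖modeCoef L j α (f 0)‖ ^ 2 := fun j hj => by
    obtain ⟨lam, δ, hlam, hlr, hδ, hδκ, hD⟩ := h j hj
    have h1 := norm_sq_decay_of_production (c := fun s α => modeCoef L j α (f s)) hlam hδ.le hδκ hT
      (hf.continuousOn_modeCoef j) (fun t ht α => hf.hasDerivAt_modeCoef hL j α ht)
      (fun t _ => hq j t) (fun t ht => (hQ j t).trans (hCQ t ht)) hD
    have h0 : 0 ≤ ∑' α, ‖modeCoef L j α (f 0)‖ ^ 2 := tsum_nonneg fun α => by positivity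
    have hκ1 : d * L < 1 := by
      have : 0 ≤ (d : ℝ) * L := by positivity
      nlinarith
    -- This rearranges `dL (2 + ε) ≤ ε` and bounds the loss incurred in comparing entropy and norm
    -- at both ends.
    have hκ2 : 1 + d * L ≤ (1 + ε) * (1 - d * L) := by linarith
    have h2 : (1 - d * L) * ∑' α, ‖modeCoef L j α (f T)‖ ^ 2 ≤ (1 - d * L)
        * ((1 + ε) * Real.exp (-rate * T) * ∑' α, ‖modeCoef L j α (f 0)‖ ^ 2) := by
      refine h1.trans ?_
      calc Real.exp (-lam * T) * ((1 + d * L) * ∑' α, ‖modeCoef L j α (f 0)‖ ^ 2)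
          ≤ Real.exp (-rate * T) * (((1 + ε) * (1 - d * L))
            * ∑' α, ‖modeCoef L j α (f 0)‖ ^ 2) :=
            mul_le_mul (hexp lam hlr.le) (mul_le_mul_of_nonneg_right hκ2 h0)
              (mul_nonneg (by positivity) h0) (Real.exp_pos _).le
        _ = _ := by ring
    exact le_of_mul_le_mul_left h2 (by linarith)
  have hS : ∀ {t : ℝ}, 0 ≤ t → ∀ j : Fin d → ℤ, HasSum (fun α : Fin d → ℕ =>
      if (j, α) = 0 then (0 : ℝ) else ‖modeCoef L j α (f t)‖ ^ 2)
      (∑' α : Fin d → ℕ, if (j, α) = 0 then (0 : ℝ) else ‖modeCoef L j α (f t)‖ ^ 2) :=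
    fun ht j => ((hf.hasSum_sqDistEquilibrium hL ht).summable.prod_factor j).hasSum
  have hT' := (hf.hasSum_sqDistEquilibrium hL hT).prod_fiberwise (hS hT)
  have h0' := (hf.hasSum_sqDistEquilibrium hL le_rfl).prod_fiberwise (hS le_rfl)
  rw [hf.initial] at h0'
  have hfin := hasSum_le (fun j => ?_) hT' (h0'.mul_left ((1 + ε) * Real.exp (-rate * T)))
  · linarith
  · rw [← hf.initial]
    by_cases hj : j = 0
    · subst hj
      refine hasSum_le (fun α => ?_) (hS hT 0)
        ((hS le_rfl 0).mul_left ((1 + ε) * Real.exp (-rate * T)))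
      by_cases hα : α = 0
      · simp [hα]
      · have hne : ((0 : Fin d → ℤ), α) ≠ 0 := fun h => hα (congrArg Prod.snd h)
        rw [if_neg hne, if_neg hne]
        refine (hf.norm_sq_modeCoef_zero_le hL hα hT).trans
          (mul_le_mul_of_nonneg_right ?_ (by positivity))
        have := hexp 2 hrate
        nlinarith [Real.exp_pos (-rate * T)]
    · have hne : ∀ α : Fin d → ℕ, (j, α) ≠ 0 := fun α h => hj (congrArg Prod.fst h)
      simp only [hne, if_false]
      exact hmode j hj

end Equilibrium

end Kinetic

end

theorem proposition4 (d : ℕ) (hd : 0 < d) :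
    (∀ op : Kinetic.Collision, 1 - Real.sqrt (3 / 7) ≤ Kinetic.lambdaStar d op) ∧
    ∀ ε : ℝ, 0 < ε → ∃ Lε : ℝ, 0 < Lε ∧ ∀ L : ℝ, 0 < L → L ≤ Lε →
      ∀ (op : Kinetic.Collision) (f₀ : Kinetic.PhaseL2 d L) (f : ℝ → Kinetic.PhaseL2 d L),
        Kinetic.IsSolution op f₀ f → ∀ t : ℝ, 0 ≤ t →
          Kinetic.sqDistEquilibrium (f t) (Kinetic.average f₀)
            ≤ (1 + ε) * Kinetic.sqDistEquilibrium f₀ (Kinetic.average f₀)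
              * Real.exp (-(min 2 (Kinetic.lambdaStar d op - ε)) * t) := by
  refine ⟨Kinetic.le_lambdaStar hd, fun ε hε => ?_⟩
  have hd' : (0 : ℝ) < d := by exact_mod_cast hd
  -- The threshold at which `(1 + dL)/(1 - dL)` equals `1 + ε`. It is intersected with the
  -- conditions of both operators, so `Lε` does not depend on `op`.
  have hsmall : ∀ᶠ L : ℝ in 𝓝[>] 0, L ≤ ε / (d * (2 + ε)) :=
    nhdsWithin_le_nhds (Iic_mem_nhds (by positivity))
  obtain ⟨Lε, hLε, h⟩ := mem_nhdsGT_iff_exists_Ioc_subset.1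
    (((Kinetic.exists_rate hd Kinetic.Collision.fokkerPlanck hε).and
      (Kinetic.exists_rate hd Kinetic.Collision.bgk hε)).and hsmall)
  refine ⟨Lε, hLε, fun L hL hLle op f₀ f hf t ht => ?_⟩
  obtain ⟨⟨h1, h2⟩, h3⟩ := h ⟨hL, hLle⟩
  have hκ : d * L * (2 + ε) ≤ ε := by
    rw [le_div_iff₀ (by positivity)] at h3
    linarith
  refine hf.sqDistEquilibrium_le hL hε hκ (min_le_left _ _) (fun j hj => ?_) ht
  cases op with
  | fokkerPlanck =>
    obtain ⟨lam, δ, hlam, hl, hrest⟩ := h1 j hj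
    exact ⟨lam, δ, hlam, (min_le_right _ _).trans_lt hl, hrest⟩
  | bgk =>
    obtain ⟨lam, δ, hlam, hl, hrest⟩ := h2 j hj
    exact ⟨lam, δ, hlam, (min_le_right _ _).trans_lt hl, hrest⟩
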